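/- **Proposition.** For every integer $i\ge 1$ there exist an oriented virtual knot $L$, and also an oriented virtual link $L$ with at least two components, such that $L$ has minimal genus $1$ and, for every diagram of $L$, some summand (monomial with non-zero coefficient) of the arrow polynomial $\langle L\rangle_A$ contains the variable $K_i$. Here a *virtual link* is an equivalence class of oriented virtual link diagrams under the classical and virtual Reidemeister moves (equivalently, an equivalence class of Gauss diagrams under the Reidemeister moves I, II, III); a *virtual knot* is a virtual link with one component. The *minimal genus* of $L$ is the least genus of a closed connected oriented surface on which $L$ can be represented, i.e. on which some diagram of $L$ can be drawn without virtual crossings. The *arrow polynomial* of a diagram $D$ is $$\langle D\rangle_A=\sum_S A^{\alpha(S)-\beta(S)}\,(-A^2-A^{-2})^{|S|-1}\prod_{C\in S}K_{a(C)}\ \in\ \mathbb Z[A,A^{-1},K_1,K_2,\dots],\qquad K_0:=1 .$$ The sum runs over all states $S$, obtained by replacing each classical crossing either by its oriented smoothing or by its disoriented smoothing; the latter joins the two incoming strands in a cusp and the two outgoing strands in a cusp. The oriented smoothing of a positive crossing and the disoriented smoothing of a negative crossing contribute a factor $A$, the other two smoothings a factor $A^{-1}$, and $A^{\alpha(S)-\beta(S)}$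 is the product of these factors. $|S|$ is the number of loops of $S$. For a loop $C$ of $S$, the arrow number $a(C)$ is half the number of cusps that remain on $C$ after repeatedly cancelling adjacent cusps that point to the same side of $C$. -/

import Mathlib

/-- An oriented Gauss diagram, i.e. an oriented virtual link diagram up to virtual Reidemeister
(detour) moves.  `Pt` is a finite set of points on a disjoint union of oriented circles, each circle
carrying at least one point, and `next` sends a point to the following one along its circle.
The involution `mate` pairs the two preimages of every classical crossing; its fixed points are
plain marked points, which carry no crossing (they allow circles without crossings, and may be
inserted and deleted freely).  `isOver p` says whether `p` lies on the overpassing strand, and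
`isPos p` whether the crossing is positive; both are meaningless at plain points. -/
structure GaussDiagram where
  Pt : Type
  [fintypePt : Fintype Pt]
  [decEqPt : DecidableEq Pt]
  next : Equiv.Perm Pt
  mate : Pt → Pt
  isOver : Pt → Bool
  isPos : Pt → Bool
  mate_mate : ∀ p, mate (mate p) = p
  isOver_mate : ∀ p, mate p ≠ p → isOver (mate p) = !(isOver p)
  isPos_mate : ∀ p, isPos (mate p) = isPos p

namespace GaussDiagram

attribute [instance] GaussDiagram.fintypePt GaussDiagram.decEqPt

/-- Two diagrams agree up to renaming of their points. -/
structure Iso (D D' : GaussDiagram) where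
  e : D.Pt ≃ D'.Pt
  next_eq : ∀ p, e (D.next p) = D'.next (e p)
  mate_eq : ∀ p, e (D.mate p) = D'.mate (e p)
  isOver_eq : ∀ p, D.mate p ≠ p → D.isOver p = D'.isOver (e p)
  isPos_eq : ∀ p, D.mate p ≠ p → D.isPos p = D'.isPos (e p)

/-- `D'` arises from `D` by deleting the plain point `m`, which must not be the only point of its
circle. -/
structure Unmark (D D' : GaussDiagram) where
  m : D.Pt
  mate_m : D.mate m = m
  next_m : D.next m ≠ m
  f : D'.Pt → D.Pt
  f_inj : Function.Injective f
  f_range : Set.range f = {m}ᶜ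
  next_eq : ∀ p, f (D'.next p) = if D.next (f p) = m then D.next m else D.next (f p)
  mate_eq : ∀ p, f (D'.mate p) = D.mate (f p)
  isOver_eq : ∀ p, D'.mate p ≠ p → D'.isOver p = D.isOver (f p)
  isPos_eq : ∀ p, D'.mate p ≠ p → D'.isPos p = D.isPos (f p)

/-- Forget the crossing at `c` (as if it were made virtual): its two preimages become plain points. -/
def erase (D : GaussDiagram) (c : D.Pt) : GaussDiagram where
  Pt := D.Pt
  next := D.next
  mate := fun q => if q = c ∨ q = D.mate c then q else D.mate q
  isOver := D.isOver
  isPos := fun q => D.isPos q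
  mate_mate := by
    intro q
    have h1 := D.mate_mate q
    have h2 := D.mate_mate c
    grind
  isOver_mate := by
    intro q h
    have h1 := D.isOver_mate q
    grind
  isPos_mate := by
    intro q
    have h1 := D.isPos_mate q
    grind

/-- The permutation exchanging `x ↔ y`, `mate x ↔ z`, `mate y ↔ mate z` (three disjoint
transpositions in the situation of a third Reidemeister move). -/
def triangleSwap (D : GaussDiagram) (x y z : D.Pt) : Equiv.Perm D.Pt :=
  Equiv.swap x y * Equiv.swap (D.mate x) z * Equiv.swap (D.mate y) (D.mate z)

/-- Reorder the points along the circles by `triangleSwap`. -/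
def slide (D : GaussDiagram) (x y z : D.Pt) : GaussDiagram :=
  { D with next := D.triangleSwap x y z * D.next * (D.triangleSwap x y z)⁻¹ }

/-- `p` and `q` are neighbours on their circle: `p` directly before `q` if `ε` is `true`, and
directly after `q` if `ε` is `false`. -/
def Adj (D : GaussDiagram) (ε : Bool) (p q : D.Pt) : Prop :=
  if ε then D.next p = q else D.next q = p

/-- The elementary moves between Gauss diagrams: renaming, deletion of a plain point, and the
classical Reidemeister moves I, II, III, in all their oriented versions.  (Virtual Reidemeister
moves do not change the Gauss diagram.) -/
inductive Move : GaussDiagram → GaussDiagram → Prop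
  | iso {D D' : GaussDiagram} (h : Iso D D') : Move D D'
  | unmark {D D' : GaussDiagram} (h : Unmark D D') : Move D D'
  /-- the two passages through the crossing `c` follow each other directly -/
  | r1 (D : GaussDiagram) (c : D.Pt) (hc : D.mate c ≠ c) (h : D.next c = D.mate c) :
      Move D (D.erase c)
  /-- two crossings of opposite signs between an overpassing segment (from `c` to `d`) and an
  underpassing one, of either direction -/
  | r2 (D : GaussDiagram) (c d : D.Pt) (hc : D.mate c ≠ c) (hd : D.mate d ≠ d)
      (oc : D.isOver c = true) (od : D.isOver d = true) (hs : D.isPos c ≠ D.isPos d)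
      (h : D.next c = d)
      (h' : D.next (D.mate c) = D.mate d ∨ D.next (D.mate d) = D.mate c) :
      Move D ((D.erase c).erase d)
  /-- three segments: the top one passes over the middle one at `x` and over the bottom one at
  `y`, and the middle one passes over the bottom one at `z`.  The orders in which the segments run
  through the crossings are `t, m, b`; the last two hypotheses say that orders and signs are those
  of a triangle formed by three oriented lines in the plane. -/
  | r3 (D : GaussDiagram) (x y z : D.Pt) (t m b : Bool)
      (hx : D.mate x ≠ x) (hy : D.mate y ≠ y) (hz : D.mate z ≠ z)
      (ox : D.isOver x = true) (oy : D.isOver y = true) (oz : D.isOver z = true)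
      (hxy : x ≠ y) (hxz : x ≠ z) (hyz : y ≠ z)
      (ht : D.Adj t x y) (hm : D.Adj m (D.mate x) z) (hb : D.Adj b (D.mate y) (D.mate z))
      (s1 : (t ^^ D.isPos x ^^ D.isPos y) = (m ^^ D.isPos x ^^ D.isPos z))
      (s2 : (t ^^ D.isPos x ^^ D.isPos y) = (b ^^ D.isPos y ^^ D.isPos z)) :
      Move D (D.slide x y z)

/-- The number of components (circles) of the link. -/
noncomputable def numComponents (D : GaussDiagram) : ℕ :=
  Nat.card (Quot fun p q : D.Pt => q = D.next p)

/-! ### The arrow polynomial -/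

/-- Half-edges.  The diagram has one edge for each point `p`, running from `p` to `next p`;
`(p, true)` is the outgoing end at `p` of the edge leaving `p`, and `(p, false)` is the incoming
end at `p` of the edge arriving at `p`. -/
abbrev Half (D : GaussDiagram) : Type := D.Pt × Bool

/-- The other end of the same edge. -/
def edge (D : GaussDiagram) (h : D.Half) : D.Half :=
  if h.2 then (D.next h.1, false) else (D.next.symm h.1, true)

theorem edge_involutive (D : GaussDiagram) : Function.Involutive D.edge := by
  rintro ⟨p, b⟩
  cases b <;> simp [edge]

/-- At a crossing: the other strand crosses the strand through `p` from the right to the left. -/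
def fromRight (D : GaussDiagram) (p : D.Pt) : Bool := D.isOver p == D.isPos p

theorem fromRight_mate (D : GaussDiagram) (p : D.Pt) (h : D.mate p ≠ p) :
    D.fromRight (D.mate p) = !(D.fromRight p) := by
  simp only [fromRight, D.isOver_mate p h, D.isPos_mate p]
  cases D.isOver p <;> cases D.isPos p <;> rfl

/-- A state chooses for each crossing the oriented smoothing (`false`) or the disoriented smoothing
with two cusps (`true`).  Plain points get the value `false`. -/
abbrev State (D : GaussDiagram) : Type :=
  {s : D.Pt → Bool // (∀ p, s (D.mate p) = s p) ∧ ∀ p, D.mate p = p → s p = false}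

/-- How the half-edges at a crossing are joined in a state: the oriented smoothing joins incoming
to outgoing ends of different strands, the disoriented smoothing joins the two incoming ends, and
the two outgoing ends.  At a plain point, the incoming and outgoing ends are joined. -/
def join (D : GaussDiagram) (s : D.State) (h : D.Half) : D.Half :=
  if s.1 h.1 then (D.mate h.1, h.2) else (D.mate h.1, !h.2)

theorem join_involutive (D : GaussDiagram) (s : D.State) : Function.Involutive (D.join s) := by
  rintro ⟨p, b⟩
  have h := s.2.1 p
  by_cases hp : s.1 p = true <;> simp_all [join, D.mate_mate]

/-- One step of a traversal of a state loop: leave along the half-edge `h`, arrive at the other end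
of its edge, and pass to the half-edge joined to it. -/
def step (D : GaussDiagram) (s : D.State) : Equiv.Perm D.Half :=
  (D.join_involutive s).toPerm * (D.edge_involutive).toPerm

/-- The loops of a state. -/
def Loop (D : GaussDiagram) (s : D.State) : Type :=
  Quot fun h k : D.Half => k = D.edge h ∨ k = D.join s h

noncomputable instance (D : GaussDiagram) (s : D.State) : Fintype (D.Loop s) :=
  @Fintype.ofFinite _ (inferInstanceAs (Finite (Quot _)))

/-- The signed value of the cusp (if any) met when a loop arrives at the crossing through the
half-edge `h`.  The first factor is the label of the edge, which changes at every cusp: it tells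
whether the traversal agrees with the orientation of the link.  The second is the side to which the
cusp points: it is `1` if the smoothed crossing lies to the left of the traversed strand, and `-1` if
it lies to the right. -/
def cuspValue (D : GaussDiagram) (s : D.State) (h : D.Half) : ℤ :=
  if s.1 h.1 then (if h.2 then -1 else 1) * (if D.fromRight h.1 then 1 else -1) else 0

/-- The sum of the values of the cusps met in one full traversal of a loop, beginning along `h`. -/
noncomputable def cuspSum (D : GaussDiagram) (s : D.State) (h : D.Half) : ℤ :=
  open Classical in
  ∑ k with (D.step s).SameCycle h k, D.cuspValue s (D.edge k)

theorem step_apply (D : GaussDiagram) (s : D.State) (h : D.Half) :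
    D.step s h = D.join s (D.edge h) := rfl

theorem cuspSum_step (D : GaussDiagram) (s : D.State) (h : D.Half) :
    D.cuspSum s (D.step s h) = D.cuspSum s h := by
  simp [cuspSum, Equiv.Perm.sameCycle_apply_left]

theorem cuspValue_join (D : GaussDiagram) (s : D.State) (h : D.Half) :
    D.cuspValue s (D.join s h) = - D.cuspValue s h := by
  obtain ⟨p, b⟩ := h
  have h1 := s.2.1 p
  have h2 := s.2.2 p
  by_cases hp : s.1 p = true
  · have h3 := D.fromRight_mate p (by grind)
    simp only [cuspValue, join, hp, h1, h3, if_true]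
    cases b <;> cases D.fromRight p <;> simp
  · simp [cuspValue, join, hp, h1]

theorem step_edge_step (D : GaussDiagram) (s : D.State) (h : D.Half) :
    D.step s (D.edge (D.step s h)) = D.edge h := by
  rw [step_apply D s (D.edge _), D.edge_involutive, step_apply, D.join_involutive]

theorem sameCycle_edge (D : GaussDiagram) (s : D.State) {h k : D.Half}
    (hk : (D.step s).SameCycle h k) : (D.step s).SameCycle (D.edge h) (D.edge k) := by
  obtain ⟨n, rfl⟩ := hk
  have conj : ∀ k, D.edge (D.step s k) = (D.step s).symm (D.edge k) := by
    intro k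
    rw [Equiv.eq_symm_apply, step_edge_step]
  have conj' : ∀ k, D.edge ((D.step s).symm k) = D.step s (D.edge k) := by
    intro k
    have := conj ((D.step s).symm k)
    rw [Equiv.apply_symm_apply] at this
    rw [this, Equiv.apply_symm_apply]
  induction n with
  | zero => exact Equiv.Perm.SameCycle.refl _ _
  | succ n ih =>
    refine ih.trans ?_
    rw [add_comm, zpow_add, Equiv.Perm.mul_apply, zpow_one, conj]
    exact Equiv.Perm.sameCycle_symm_apply_right.2 (Equiv.Perm.SameCycle.refl _ _)
  | pred n ih =>
    refine ih.trans ?_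
    rw [sub_eq_neg_add, zpow_add, Equiv.Perm.mul_apply, zpow_neg_one, Equiv.Perm.inv_def, conj']
    exact Equiv.Perm.sameCycle_apply_right.2 (Equiv.Perm.SameCycle.refl _ _)

theorem cuspSum_edge (D : GaussDiagram) (s : D.State) (h : D.Half) :
    D.cuspSum s (D.edge h) = - D.cuspSum s h := by
  classical
  rw [cuspSum, cuspSum, ← Finset.sum_neg_distrib]
  refine Finset.sum_bij' (fun k _ => D.edge (D.step s k)) (fun k _ => D.edge (D.step s k))
    ?_ ?_ ?_ ?_ ?_
  · intro k hk
    simp only [Finset.mem_filter, Finset.mem_univ, true_and] at hk ⊢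
    have := D.sameCycle_edge s (Equiv.Perm.sameCycle_apply_right.2 hk)
    rwa [D.edge_involutive] at this
  · intro k hk
    simp only [Finset.mem_filter, Finset.mem_univ, true_and] at hk ⊢
    exact D.sameCycle_edge s (Equiv.Perm.sameCycle_apply_right.2 hk)
  · intro k _
    rw [step_edge_step, D.edge_involutive]
  · intro k _
    rw [step_edge_step, D.edge_involutive]
  · intro k _
    rw [D.edge_involutive, step_apply, cuspValue_join, neg_neg]

/-- The arrow number of a state loop: half the number of cusps that remain when adjacent cusps
pointing to the same side are cancelled; this is half the absolute value of the sum of the cusp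
values, as remaining cusps point alternately to both sides. -/
noncomputable def arrowNumber (D : GaussDiagram) (s : D.State) : D.Loop s → ℕ :=
  Quot.lift (fun h => (D.cuspSum s h).natAbs / 2) (by
    rintro h k (rfl | rfl)
    · rw [cuspSum_edge, Int.natAbs_neg]
    · have := D.cuspSum_step s (D.edge h)
      rw [step_apply, D.edge_involutive] at this
      rw [this, cuspSum_edge, Int.natAbs_neg])

/-- The ring `ℤ[A, A⁻¹, K₁, K₂, …]`. -/
abbrev ArrowRing : Type := MvPolynomial ℕ+ (LaurentPolynomial ℤ)

/-- The variable `K n` for `n ≥ 1`, and `1` for `n = 0`. -/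
noncomputable def K (n : ℕ) : ArrowRing :=
  if h : 0 < n then MvPolynomial.X ⟨n, h⟩ else 1

/-- The exponent `α - β` of a state: `+1` for an oriented smoothing of a positive crossing and for a
disoriented smoothing of a negative one, `-1` for the others.  Each crossing is counted once, at its
overpassing point. -/
def exponent (D : GaussDiagram) (s : D.State) : ℤ :=
  ∑ p with D.mate p ≠ p ∧ D.isOver p = true, if D.isPos p ^^ s.1 p then 1 else -1

/-- The loop value `d = -A² - A⁻²`. -/
noncomputable def loopValue : LaurentPolynomial ℤ :=
  - LaurentPolynomial.T 2 - LaurentPolynomial.T (-2)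

/-- The (unnormalized) arrow polynomial, the sum over all states `s` of
`A ^ (α - β) * d ^ (number of loops - 1) * ∏ K_{a(C)}`, the product running over the loops `C`.
(There is at least one loop unless the diagram is empty.) -/
noncomputable def arrowPolynomial (D : GaussDiagram) : ArrowRing :=
  ∑ s : D.State,
    MvPolynomial.C (LaurentPolynomial.T (D.exponent s) *
      loopValue ^ (Fintype.card (D.Loop s) - 1)) * ∏ C : D.Loop s, K (D.arrowNumber s C)

/-! ### Representations on closed surfaces -/

/-- Counterclockwise rotation of the half-edges around a crossing (or plain point) in an oriented
surface. -/
def rot (D : GaussDiagram) (h : D.Half) : D.Half :=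
  if D.mate h.1 = h.1 then (h.1, !h.2)
  else if D.fromRight h.1 then (D.mate h.1, h.2) else (D.mate h.1, !h.2)

/-- The boundary circles of the regular neighbourhood of the diagram in an oriented surface. -/
def Boundary (D : GaussDiagram) : Type :=
  Quot fun h k : D.Half => k = D.rot (D.edge h)

/-- A realization of the diagram as a link diagram (without virtual crossings) on a closed connected
oriented surface.  Such a surface consists of the regular neighbourhood of the diagram and of
finitely many complementary regions: each region is a compact connected oriented surface of some
genus, glued to the neighbourhood along the boundary circles that belong to it.  The regions need
not be discs. -/
structure SurfaceRep (D : GaussDiagram) where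
  Region : Type
  [fintypeRegion : Fintype Region]
  /-- the region adjacent to a boundary circle -/
  region : D.Boundary → Region
  regionGenus : Region → ℕ
  nonempty : Nonempty Region
  /-- the surface is connected -/
  connected : ∀ u v : D.Half ⊕ Region, Relation.EqvGen
    (fun u v => ∃ h : D.Half, u = Sum.inl h ∧
      (v = Sum.inl (D.edge h) ∨ v = Sum.inl (D.rot h) ∨ v = Sum.inr (region (Quot.mk _ h)))) u v

attribute [instance] SurfaceRep.fintypeRegion

/-- The Euler characteristic of the surface: vertices minus edges of the diagram, plus the Euler
characteristics `2 - 2 * genus - (number of boundary circles)` of the regions. -/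
noncomputable def SurfaceRep.eulerChar {D : GaussDiagram} (S : D.SurfaceRep) : ℤ :=
  (Nat.card (Quot fun p q : D.Pt => q = D.mate p) - Fintype.card D.Pt : ℤ) +
    ∑ r : S.Region, (2 - 2 * S.regionGenus r - Nat.card {c : D.Boundary // S.region c = r} : ℤ)

/-- The genus of the closed surface. -/
def SurfaceRep.HasGenus {D : GaussDiagram} (S : D.SurfaceRep) (g : ℕ) : Prop :=
  S.eulerChar = 2 - 2 * g

theorem card_quot_eq_of_maps {α β : Type} (r : α → α → Prop) (r' : β → β → Prop)
    (f : α → β) (g : β → α)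
    (hf : ∀ a a', r a a' → Quot.mk r' (f a) = Quot.mk r' (f a'))
    (hg : ∀ b b', r' b b' → Quot.mk r (g b) = Quot.mk r (g b'))
    (hgf : ∀ a, Quot.mk r (g (f a)) = Quot.mk r a)
    (hfg : ∀ b, Quot.mk r' (f (g b)) = Quot.mk r' b) :
    Nat.card (Quot r) = Nat.card (Quot r') :=
  Nat.card_congr
    { toFun := Quot.lift (fun a => Quot.mk r' (f a)) hf
      invFun := Quot.lift (fun b => Quot.mk r (g b)) hg
      left_inv := by rintro ⟨a⟩; exact hgf a
      right_inv := by rintro ⟨b⟩; exact hfg b }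

theorem numComponents_of_conj (D D' : GaussDiagram) (e : D.Pt ≃ D'.Pt)
    (h : ∀ p, e (D.next p) = D'.next (e p)) : D.numComponents = D'.numComponents := by
  refine card_quot_eq_of_maps _ _ e e.symm ?_ ?_ ?_ ?_
  · rintro p _ rfl
    exact Quot.sound (h p)
  · rintro p _ rfl
    refine Quot.sound ?_
    rw [Equiv.symm_apply_eq, h, Equiv.apply_symm_apply]
  · intro p
    rw [Equiv.symm_apply_apply]
  · intro p
    rw [Equiv.apply_symm_apply]

theorem Move.numComponents_eq {D D' : GaussDiagram} (h : Move D D') :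
    D.numComponents = D'.numComponents := by
  classical
  cases h with
  | iso h => exact numComponents_of_conj D D' h.e h.next_eq
  | r1 => rfl
  | r2 => rfl
  | r3 x y z t m b =>
    refine numComponents_of_conj D (D.slide x y z) (D.triangleSwap x y z) ?_
    intro p
    change _ = (D.triangleSwap x y z * D.next * (D.triangleSwap x y z)⁻¹) (D.triangleSwap x y z p)
    rw [Equiv.Perm.mul_apply, Equiv.Perm.mul_apply, Equiv.Perm.inv_def, Equiv.symm_apply_apply]
    rfl
  | unmark h =>
    have hr : ∀ q, q ≠ h.m → ∃ p, h.f p = q := by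
      intro q hq
      have : q ∈ Set.range h.f := by rw [h.f_range]; exact hq
      exact this
    have hm : ∀ p, h.f p ≠ h.m := by
      intro p
      have : h.f p ∈ Set.range h.f := ⟨p, rfl⟩
      rw [h.f_range] at this
      exact this
    obtain ⟨p₀, -⟩ := hr _ h.next_m
    have : Nonempty D'.Pt := ⟨p₀⟩
    choose! g hg using hr
    have gf : ∀ p, g (h.f p) = p := fun p => h.f_inj (hg _ (hm p))
    symm
    refine card_quot_eq_of_maps _ _ h.f (fun q => if q = h.m then g (D.next h.m) else g q)
      ?_ ?_ ?_ ?_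
    · rintro p _ rfl
      rw [h.next_eq]
      split_ifs with hp
      · have e1 : Quot.mk (fun p q : D.Pt => q = D.next p) (h.f p) = Quot.mk _ h.m :=
          Quot.sound hp.symm
        exact e1.trans (Quot.sound rfl)
      · exact Quot.sound rfl
    · rintro q _ rfl
      by_cases hq : q = h.m
      · subst hq
        simp [h.next_m]
      · rw [if_neg hq]
        obtain ⟨p, rfl⟩ : ∃ p, h.f p = q := ⟨g q, hg q hq⟩
        have hn := h.next_eq p
        refine Quot.sound ?_
        split_ifs with hp
        · rw [if_pos hp] at hn
          rw [← hn, gf, gf]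
        · rw [if_neg hp] at hn
          rw [← hn, gf, gf]
    · intro p
      simp [hm, gf]
    · intro q
      split_ifs with hq
      · subst hq
        rw [hg _ h.next_m]
        have e1 : Quot.mk (fun p q : D.Pt => q = D.next p) h.m = Quot.mk _ (D.next h.m) :=
          Quot.sound rfl
        exact e1.symm
      · rw [hg _ hq]

end GaussDiagram

/-- An oriented virtual link: an equivalence class of Gauss diagrams under the equivalence relation
generated by the moves. -/
def VirtualLink : Type 1 := Quot GaussDiagram.Move

namespace VirtualLink

/-- `D` is a diagram of the virtual link `L`. -/
def IsDiagram (L : VirtualLink) (D : GaussDiagram) : Prop := Quot.mk GaussDiagram.Move D = L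

/-- The number of components of a virtual link. -/
noncomputable def numComponents : VirtualLink → ℕ :=
  Quot.lift GaussDiagram.numComponents fun _ _ h => h.numComponents_eq

/-- The minimal genus of `L` is `g`: the least genus of a closed connected oriented surface carrying
a diagram of `L`. -/
def HasMinimalGenus (L : VirtualLink) (g : ℕ) : Prop :=
  IsLeast {n : ℕ | ∃ D, L.IsDiagram D ∧ ∃ S : D.SurfaceRep, S.HasGenus n} g

/-- The variable `K i` occurs in some summand (monomial with non-zero coefficient) of the arrow
polynomial of every diagram of `L`. -/
def ArrowPolynomialContains (L : VirtualLink) (i : ℕ+) : Prop :=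
  ∀ D, L.IsDiagram D → i ∈ D.arrowPolynomial.vars

end VirtualLink

/-! Multiplied by d = -A² - A⁻², the arrow polynomial becomes a state sum in which every loop C has
the weight d K_{a(C)}; the same variables occur in it (`mem_vars_stateSum`). Each move multiplies
this sum by a unit ± A ^ n (`Move.stateSum_eq`), so the set of variables that occur is an invariant
of the virtual link, and a single diagram decides whether K_i occurs
(`VirtualLink.arrowPolynomialContains_mk`).

Invariance is a local matter. Cutting an edge out of a state as a separate trivial loop costs
exactly one factor d (`LoopSystem.ev_excise`). Once all edges inside the tangle of a Reidemeister
move are cut out, only a table remains: how the ends of the tangle are joined, and with which cusp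
sums. The move is thereby reduced, for an arbitrary exterior, to an identity between finite formal
sums of tables (`LoopSystem.sum_ev_eq_sum_ev`), which is settled by evaluation.

Genus zero is excluded by an index function. On a sphere, a dimension count shows that every flow on
the edges of the diagram is the jump of a function on the regions. For the constant flow 1 this
function turns each cusp value into a difference, the cusp sum of a loop telescopes to zero, and no
variable occurs (`SurfaceRep.vars_arrowPolynomial`). Hence a diagram of genus one whose polynomial
contains some variable represents a link of minimal genus one (`hasMinimalGenus_one`).

To exhibit K_i, A is specialised to ζ with ζ⁴ = -1. Then d = 0 and only the states with a single
loop survive; those of arrow number i cannot cancel if they share one exponent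
(`mem_vars_of_single_loop`). The examples are cyclic chains of i blocks on a torus: `chainLink`,
with one crossing per block, and `chainKnot`, with two. Arrow number i requires 2 i disoriented
points (`natAbs_cuspSum_le`); this determines the state in the case of the link, and its exponent in
the case of the knot. -/

/-! ### Loop systems: closed loops with signed turns. -/

/-- Two fixed-point-free involutions `edge` and `join` on a set of half-edges, whose orbits are closed
loops, together with a value for each turn that changes sign when the turn is reversed. -/
@[ext]
structure LoopSystem (H : Type) where
  edge : H → H
  join : H → H
  value : H → ℤ
  edge_edge : ∀ h, edge (edge h) = h
  join_join : ∀ h, join (join h) = h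
  edge_ne : ∀ h, edge h ≠ h
  join_ne : ∀ h, join h ≠ h
  value_join : ∀ h, value (join h) = - value h

namespace LoopSystem

variable {H H' : Type}

/-- One step of a traversal: along an edge, then through a turn. -/
def step (L : LoopSystem H) : Equiv.Perm H :=
  (show Function.Involutive L.join from L.join_join).toPerm *
    (show Function.Involutive L.edge from L.edge_edge).toPerm

theorem step_apply (L : LoopSystem H) (h : H) : L.step h = L.join (L.edge h) := rfl

/-- The loops: orbits of the two involutions. -/
def Loop (L : LoopSystem H) : Type := Quot fun h k : H => k = L.edge h ∨ k = L.join h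

/-- The sum of the values of the turns met in one traversal beginning along `h`. -/
noncomputable def sum [Fintype H] (L : LoopSystem H) (h : H) : ℤ :=
  open Classical in
  ∑ k with L.step.SameCycle h k, L.value (L.edge k)

theorem sum_eq_ite [Fintype H] (L : LoopSystem H) (h : H)
    [DecidablePred (L.step.SameCycle h)] :
    L.sum h = ∑ k, if L.step.SameCycle h k then L.value (L.edge k) else 0 := by
  rw [sum, Finset.sum_filter]
  refine Finset.sum_congr rfl fun k _ => ?_
  by_cases hk : L.step.SameCycle h k <;> simp only [hk, if_true, if_false]

theorem sum_step [Fintype H] (L : LoopSystem H) (h : H) : L.sum (L.step h) = L.sum h := by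
  classical
  rw [sum_eq_ite, sum_eq_ite]
  simp only [Equiv.Perm.sameCycle_apply_left]

/-- A step is a product of two involutions, so conjugating by one of them inverts it: this is the
reversal of the direction of travel. -/
theorem edge_step (L : LoopSystem H) (h : H) : L.edge (L.step h) = L.step.symm (L.edge h) := by
  rw [Equiv.eq_symm_apply, step_apply, L.edge_edge, step_apply, L.join_join]

theorem zpow_apply_of_semiconj {φ : H → H'} {σ : Equiv.Perm H} {σ' : Equiv.Perm H'}
    (h : ∀ x, φ (σ x) = σ' (φ x)) (n : ℤ) (x : H) : φ ((σ ^ n) x) = (σ' ^ n) (φ x) := by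
  have hs : ∀ x, φ (σ.symm x) = σ'.symm (φ x) := fun x => by
    rw [Equiv.eq_symm_apply, ← h, Equiv.apply_symm_apply]
  induction n with
  | zero => simp
  | succ n ih =>
    rw [add_comm, zpow_one_add, zpow_one_add, Equiv.Perm.mul_apply, h, ih, Equiv.Perm.mul_apply]
  | pred n ih =>
    rw [sub_eq_neg_add, zpow_add, zpow_add, Equiv.Perm.mul_apply, Equiv.Perm.mul_apply,
      zpow_neg_one, zpow_neg_one, Equiv.Perm.inv_def, Equiv.Perm.inv_def, hs, ih]

theorem edge_zpow (L : LoopSystem H) (n : ℤ) (h : H) :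
    L.edge ((L.step ^ n) h) = (L.step ^ (-n)) (L.edge h) := by
  rw [zpow_neg, ← inv_zpow]
  exact zpow_apply_of_semiconj (σ' := L.step⁻¹) L.edge_step n h

theorem sameCycle_edge (L : LoopSystem H) {h k : H} (hk : L.step.SameCycle h k) :
    L.step.SameCycle (L.edge h) (L.edge k) := by
  obtain ⟨n, rfl⟩ := hk
  exact ⟨-n, (L.edge_zpow n h).symm⟩

/-- A loop is never traversed in both directions by the same cycle. -/
theorem not_sameCycle_edge (L : LoopSystem H) (h : H) : ¬ L.step.SameCycle h (L.edge h) := by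
  rintro ⟨n, hn⟩
  -- Halfway between a half-edge and its reversal the traversal would have to turn back: at a fixed
  -- point of `edge` if the number of steps is even, of `join` if it is odd.
  obtain ⟨k, rfl | rfl⟩ := Int.even_or_odd' n
  · refine L.edge_ne ((L.step ^ k) h) ?_
    rw [edge_zpow, ← hn, ← Equiv.Perm.mul_apply, ← zpow_add]
    congr 2
    ring
  · refine L.join_ne (L.edge ((L.step ^ k) h)) ?_
    rw [← step_apply, edge_zpow, ← hn, ← Equiv.Perm.mul_apply, ← Equiv.Perm.mul_apply, ← zpow_add,
      ← zpow_one_add]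
    congr 2
    ring

/-- The reversed traversal meets the same turns from the other side. The map `k ↦ edge (step k)`
matches them, and `value_join` changes each sign. -/
theorem sum_edge [Fintype H] (L : LoopSystem H) (h : H) : L.sum (L.edge h) = - L.sum h := by
  classical
  have key : ∀ h k, L.step.SameCycle (L.edge h) k → L.step.SameCycle h (L.edge (L.step k)) := by
    intro h k hk
    have := L.sameCycle_edge (Equiv.Perm.sameCycle_apply_right.2 hk)
    rwa [L.edge_edge] at this
  have inv : ∀ k, L.edge (L.step (L.edge (L.step k))) = k := by
    intro k
    rw [edge_step, L.edge_edge, Equiv.symm_apply_apply]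
  rw [sum, sum, ← Finset.sum_neg_distrib]
  refine Finset.sum_bij' (fun k _ => L.edge (L.step k)) (fun k _ => L.edge (L.step k))
    ?_ ?_ ?_ ?_ ?_
  · intro k hk
    simp only [Finset.mem_filter, Finset.mem_univ, true_and] at hk ⊢
    exact key h k hk
  · intro k hk
    simp only [Finset.mem_filter, Finset.mem_univ, true_and] at hk ⊢
    exact key _ k (by rwa [L.edge_edge])
  · exact fun k _ => inv k
  · exact fun k _ => inv k
  · intro k _
    rw [L.edge_edge, step_apply, L.value_join, neg_neg]

theorem sum_join [Fintype H] (L : LoopSystem H) (h : H) : L.sum (L.join h) = - L.sum h := by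
  have := L.sum_step (L.edge h)
  rwa [step_apply, L.edge_edge, sum_edge] at this

/-- The loop through a half-edge. -/
def loopOf (L : LoopSystem H) (h : H) : L.Loop := Quot.mk _ h

theorem exists_loopOf (L : LoopSystem H) (C : L.Loop) : ∃ h, L.loopOf h = C := Quot.exists_rep C

theorem loopOf_edge (L : LoopSystem H) (h : H) : L.loopOf (L.edge h) = L.loopOf h :=
  (Quot.sound (r := fun h k : H => k = L.edge h ∨ k = L.join h) (Or.inl rfl)).symm

theorem loopOf_join (L : LoopSystem H) (h : H) : L.loopOf (L.join h) = L.loopOf h :=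
  (Quot.sound (r := fun h k : H => k = L.edge h ∨ k = L.join h) (Or.inr rfl)).symm

/-- A function on half-edges that is constant along loops. -/
def lift {α : Sort*} (L : LoopSystem H) (f : H → α) (he : ∀ h, f (L.edge h) = f h)
    (hj : ∀ h, f (L.join h) = f h) : L.Loop → α :=
  Quot.lift f (by
    rintro h k (rfl | rfl)
    · exact (he h).symm
    · exact (hj h).symm)

theorem lift_loopOf {α : Sort*} (L : LoopSystem H) (f : H → α) (he : ∀ h, f (L.edge h) = f h)
    (hj : ∀ h, f (L.join h) = f h) (h : H) : L.lift f he hj (L.loopOf h) = f h := rfl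

/-- A set closed under both involutions is a union of loops. -/
theorem mem_iff_of_loopOf_eq (L : LoopSystem H) {p : H → Prop} (he : ∀ h, p h → p (L.edge h))
    (hj : ∀ h, p h → p (L.join h)) {h k : H} (hk : L.loopOf h = L.loopOf k) : p h ↔ p k := by
  have hE : ∀ h, p (L.edge h) ↔ p h :=
    fun h => ⟨fun x => by simpa [L.edge_edge] using he _ x, he h⟩
  have hJ : ∀ h, p (L.join h) ↔ p h :=
    fun h => ⟨fun x => by simpa [L.join_join] using hj _ x, hj h⟩
  exact iff_of_eq (congrArg (L.lift p (fun h => propext (hE h)) fun h => propext (hJ h)) hk)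

theorem loopOf_step_zpow (L : LoopSystem H) (n : ℤ) (h : H) : L.loopOf ((L.step ^ n) h) = L.loopOf h := by
  have h1 : ∀ x, L.loopOf (L.step x) = L.loopOf x := fun x => by rw [step_apply, loopOf_join, loopOf_edge]
  have := zpow_apply_of_semiconj (φ := L.loopOf) (σ := L.step) (σ' := 1) h1 n h
  simpa using this

variable [Fintype H] [Fintype H']

/-- The absolute value of the sum of the turns of a loop. -/
noncomputable def absSum (L : LoopSystem H) : L.Loop → ℕ :=
  L.lift (fun h => (L.sum h).natAbs) (fun h => by rw [sum_edge, Int.natAbs_neg])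
    fun h => by rw [sum_join, Int.natAbs_neg]

theorem absSum_loopOf (L : LoopSystem H) (h : H) : L.absSum (L.loopOf h) = (L.sum h).natAbs := rfl

noncomputable instance (L : LoopSystem H) : Fintype L.Loop :=
  @Fintype.ofFinite _ (inferInstanceAs (Finite (Quot _)))

/-- The product over the loops of a weight depending on their absolute sums. -/
noncomputable def ev {R : Type*} [CommMonoid R] (δ : ℕ → R) (L : LoopSystem H) : R :=
  ∏ C : L.Loop, δ (L.absSum C)

variable {R : Type*} [CommMonoid R] (δ : ℕ → R)

/-- If `L'` has one more loop than `L`, with sum zero, then its weight has a factor `δ 0` more. -/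
theorem ev_eq_mul_of_injective (L : LoopSystem H) (L' : LoopSystem H')
    (f : L.Loop → L'.Loop) (t : L'.Loop) (ht : L'.absSum t = 0)
    (hinj : Function.Injective f) (hft : ∀ C, f C ≠ t) (hsurj : ∀ C, C ≠ t → ∃ C', f C' = C)
    (hf : ∀ C, L'.absSum (f C) = L.absSum C) : L'.ev δ = δ 0 * L.ev δ := by
  classical
  -- The loops of `L'` are those of `L` and the additional loop `t`, which is the image of `none`.
  have hb : Function.Bijective (fun o : Option L.Loop => o.elim t f) := by
    constructor
    · rintro (_ | a) (_ | b) hab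
      · rfl
      · exact absurd hab.symm (hft b)
      · exact absurd hab (hft a)
      · exact congrArg some (hinj hab)
    · intro C
      by_cases hC : C = t
      · exact ⟨none, hC.symm⟩
      · obtain ⟨a, rfl⟩ := hsurj C hC
        exact ⟨some a, rfl⟩
  have := Fintype.prod_equiv (Equiv.ofBijective _ hb) (fun o => δ (L'.absSum (o.elim t f)))
    (fun C => δ (L'.absSum C)) fun o => rfl
  rw [ev, ← this, Fintype.prod_option]
  simp only [Option.elim, ht, ev, hf]

/-- A trivial loop has sum zero. -/
theorem sum_eq_zero_of_trivial (L : LoopSystem H) (a : H) (ha : L.join a = L.edge a)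
    (hv : L.value a = 0) : L.sum a = 0 := by
  have h1 : L.step a = a := by rw [step_apply, ← ha, L.join_join]
  rw [sum]
  refine Finset.sum_eq_zero fun k hk => ?_
  simp only [Finset.mem_filter, Finset.mem_univ, true_and] at hk
  obtain ⟨n, rfl⟩ := hk
  rw [Equiv.Perm.zpow_apply_eq_self_of_apply_eq_self h1, ← ha, L.value_join, hv, neg_zero]

omit [Fintype H] in
theorem loopOf_eq_iff_of_trivial (L : LoopSystem H) (a : H) (ha : L.join a = L.edge a) (x : H) :
    L.loopOf x = L.loopOf a ↔ x = a ∨ x = L.edge a := by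
  refine ⟨fun hx => (L.mem_iff_of_loopOf_eq (p := fun x => x = a ∨ x = L.edge a) ?_ ?_ hx).2
    (Or.inl rfl), ?_⟩
  · rintro x (rfl | rfl)
    · exact Or.inr rfl
    · exact Or.inl (L.edge_edge _)
  · rintro x (rfl | rfl)
    · exact Or.inr ha
    · left
      rw [← ha, L.join_join]
  · rintro (rfl | rfl)
    · rfl
    · exact L.loopOf_edge a

section embed

variable (L : LoopSystem H) (L' : LoopSystem H') (φ : H → H') (hφ : Function.Injective φ)
  (hE : ∀ h, L'.edge (φ h) = φ (L.edge h)) (hJ : ∀ h, L'.join (φ h) = φ (L.join h))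
  (hV : ∀ h, L'.value (φ h) = L.value h)

include hφ hE hJ

omit [Fintype H] [Fintype H'] in
-- The image of a loop is closed under both involutions, so no loop of `L'` can connect the images
-- of two different ones.
theorem loopOf_eq_of_embedding {h k : H} (hk : L'.loopOf (φ h) = L'.loopOf (φ k)) : L.loopOf h = L.loopOf k := by
  obtain ⟨x, hx, hxh⟩ := (L'.mem_iff_of_loopOf_eq (p := fun y => ∃ x, L.loopOf x = L.loopOf k ∧ φ x = y)
    (by
      rintro _ ⟨x, hx, rfl⟩
      exact ⟨L.edge x, by rw [loopOf_edge, hx], (hE x).symm⟩)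
    (by
      rintro _ ⟨x, hx, rfl⟩
      exact ⟨L.join x, by rw [loopOf_join, hx], (hJ x).symm⟩) hk).2 ⟨k, rfl, rfl⟩
  rw [← hx, hφ hxh]

include hV in
theorem sum_of_embedding (h : H) : L'.sum (φ h) = L.sum h := by
  have hS : ∀ h, φ (L.step h) = L'.step (φ h) := fun h => by
    rw [step_apply, step_apply, hE, hJ]
  rw [sum, sum]
  symm
  refine Finset.sum_bij (fun k _ => φ k) ?_ (fun _ _ _ _ h => hφ h) ?_ ?_
  · rintro k hk
    simp only [Finset.mem_filter, Finset.mem_univ, true_and] at hk ⊢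
    obtain ⟨n, rfl⟩ := hk
    exact ⟨n, (zpow_apply_of_semiconj hS n h).symm⟩
  · rintro k hk
    simp only [Finset.mem_filter, Finset.mem_univ, true_and] at hk
    obtain ⟨n, rfl⟩ := hk
    refine ⟨(L.step ^ n) h, ?_, zpow_apply_of_semiconj hS n h⟩
    simp only [Finset.mem_filter, Finset.mem_univ, true_and]
    exact ⟨n, rfl⟩
  · intro k _
    rw [hE, hV]

include hV in
/-- An embedding of loop systems whose complement is a single trivial loop. -/
theorem ev_of_embedding (a : H') (hr : ∀ x, x ∉ Set.range φ ↔ x = a ∨ x = L'.edge a)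
    (ha : L'.join a = L'.edge a) (hv : L'.value a = 0) : L'.ev δ = δ 0 * L.ev δ := by
  refine ev_eq_mul_of_injective δ L L' (L.lift (fun h => L'.loopOf (φ h)) ?_ ?_) (L'.loopOf a) ?_ ?_ ?_ ?_ ?_
  · intro h
    rw [← hE, loopOf_edge]
  · intro h
    rw [← hJ, loopOf_join]
  · rw [absSum_loopOf, sum_eq_zero_of_trivial L' a ha hv, Int.natAbs_zero]
  · intro C C' h
    obtain ⟨x, rfl⟩ := L.exists_loopOf C
    obtain ⟨y, rfl⟩ := L.exists_loopOf C'
    exact loopOf_eq_of_embedding L L' φ hφ hE hJ h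
  · intro C h
    obtain ⟨x, rfl⟩ := L.exists_loopOf C
    exact (hr _).2 ((L'.loopOf_eq_iff_of_trivial a ha _).1 h) ⟨x, rfl⟩
  · intro C hC
    obtain ⟨x, rfl⟩ := L'.exists_loopOf C
    have hx : x ∈ Set.range φ := by
      by_contra hx
      exact hC ((L'.loopOf_eq_iff_of_trivial a ha _).2 ((hr x).1 hx))
    obtain ⟨y, rfl⟩ := hx
    exact ⟨L.loopOf y, rfl⟩
  · intro C
    obtain ⟨x, rfl⟩ := L.exists_loopOf C
    rw [lift_loopOf, absSum_loopOf, absSum_loopOf, sum_of_embedding L L' φ hφ hE hJ hV]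

include hV in
theorem ev_of_bijective (hs : Function.Surjective φ) : L'.ev δ = L.ev δ := by
  symm
  refine Fintype.prod_bijective (L.lift (fun h => L'.loopOf (φ h)) ?_ ?_) ⟨?_, ?_⟩ _ _ ?_
  · intro h
    rw [← hE, loopOf_edge]
  · intro h
    rw [← hJ, loopOf_join]
  · intro C C' h
    obtain ⟨x, rfl⟩ := L.exists_loopOf C
    obtain ⟨y, rfl⟩ := L.exists_loopOf C'
    exact loopOf_eq_of_embedding L L' φ hφ hE hJ h
  · intro C
    obtain ⟨x, rfl⟩ := L'.exists_loopOf C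
    obtain ⟨y, rfl⟩ := hs x
    exact ⟨L.loopOf y, rfl⟩
  · intro C
    obtain ⟨x, rfl⟩ := L.exists_loopOf C
    rw [lift_loopOf, absSum_loopOf, absSum_loopOf, sum_of_embedding L L' φ hφ hE hJ hV]

end embed

omit [Fintype H] [Fintype H'] in
-- No equivariance of `ρ` is required, only that a step stays in its cycle. This suits excision,
-- where steps are skipped or points repeated.
theorem sameCycle_of_forall {σ : Equiv.Perm H} {τ : Equiv.Perm H'} (ρ : H → H')
    (h : ∀ x, τ.SameCycle (ρ x) (ρ (σ x))) {x y : H} (hxy : σ.SameCycle x y) :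
    τ.SameCycle (ρ x) (ρ y) := by
  obtain ⟨n, rfl⟩ := hxy
  induction n with
  | zero => exact Equiv.Perm.SameCycle.refl _ _
  | succ n ih =>
    rw [add_comm, zpow_one_add, Equiv.Perm.mul_apply]
    exact ih.trans (h _)
  | pred n ih =>
    rw [sub_eq_neg_add, zpow_add, Equiv.Perm.mul_apply, zpow_neg_one]
    refine ih.trans ?_
    have := h (σ⁻¹ ((σ ^ (-(n : ℤ))) x))
    rw [Equiv.Perm.inv_def, Equiv.apply_symm_apply] at this
    exact this.symm

/-! ### Cutting out an edge as a trivial loop. -/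

section excise

variable [DecidableEq H]

/-- Cut out the edge through `a` as a separate trivial loop, joining directly the half-edges it was
joined to. -/
def excise (L : LoopSystem H) (a : H) : LoopSystem H where
  edge := L.edge
  join h := if h = a then L.edge a else if h = L.edge a then a else
    if h = L.join a then L.join (L.edge a) else if h = L.join (L.edge a) then L.join a else L.join h
  -- The passage from `join a` through the cut edge to `join (edge a)` becomes one turn, whose value
  -- is the sum of the two old ones. If the edge is already closed up on itself, nothing changes.
  value h := if L.join a = L.edge a then L.value h else
    if h = a then 0 else if h = L.edge a then 0 else
    if h = L.join a then L.value h + L.value (L.edge a) else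
    if h = L.join (L.edge a) then L.value h + L.value a else L.value h
  edge_edge := L.edge_edge
  edge_ne := L.edge_ne
  join_join h := by
    have h1 := L.join_join
    have h2 := L.edge_edge a
    have h3 := L.edge_ne a
    have h4 := L.join_ne
    grind
  join_ne h := by
    have h1 := L.join_join
    have h2 := L.edge_edge a
    have h3 := L.edge_ne a
    have h4 := L.join_ne
    grind
  value_join h := by
    have h1 := L.join_join
    have h2 := L.edge_edge a
    have h3 := L.edge_ne a
    have h4 := L.join_ne
    have h5 := L.value_join
    by_cases hc : L.join a = L.edge a
    · simp only [hc, if_true]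
      grind
    · simp only [hc, if_false]
      grind

omit [Fintype H] in
-- Away from the cut edge, an excised step is an ordinary step, or two of them where the ordinary
-- traversal would run along that edge.
theorem sameCycle_excise_iff (L : LoopSystem H) (a : H) (ha : L.join a ≠ L.edge a) {h k : H}
    (h1 : h ≠ a) (h2 : h ≠ L.edge a) (k1 : k ≠ a) (k2 : k ≠ L.edge a) :
    (L.excise a).step.SameCycle h k ↔ L.step.SameCycle h k := by
  have e1 := L.join_join
  have e2 := L.edge_edge
  have e3 := L.edge_ne
  have e4 := L.join_ne
  have st : ∀ x, L.step.SameCycle x (L.step x) :=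
    fun x => Equiv.Perm.sameCycle_apply_right.2 (Equiv.Perm.SameCycle.refl _ _)
  have st' : ∀ x, (L.excise a).step.SameCycle x ((L.excise a).step x) :=
    fun x => Equiv.Perm.sameCycle_apply_right.2 (Equiv.Perm.SameCycle.refl _ _)
  constructor
  · refine sameCycle_of_forall (fun x => x) fun x => ?_
    have hx : (L.excise a).step x = x ∨ (L.excise a).step x = L.step x ∨
        (L.excise a).step x = L.step (L.step x) := by
      simp only [step_apply, excise]
      grind
    rcases hx with hx | hx | hx <;> rw [hx]
    · exact st x
    · exact (st x).trans (st _)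
  · intro hk
    -- The retraction moves the two ends of the cut edge one step forward; as `join a ≠ edge a`,
    -- this leads off the edge.
    have := sameCycle_of_forall (τ := (L.excise a).step)
      (fun x => if x = a then L.step a else if x = L.edge a then L.step (L.edge a) else x)
      (fun x => ?_) hk
    · simpa only [h1, h2, k1, k2, if_false] using this
    · by_cases hx : x = a ∨ x = L.edge a
      · have : (if L.step x = a then L.step a else if L.step x = L.edge a then L.step (L.edge a)
            else L.step x) =
            (if x = a then L.step a else if x = L.edge a then L.step (L.edge a) else x) := by
          simp only [step_apply]
          grind
        rw [this]
      · have : (if L.step x = a then L.step a else if L.step x = L.edge a then L.step (L.edge a)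
            else L.step x) = (L.excise a).step
            (if x = a then L.step a else if x = L.edge a then L.step (L.edge a) else x) := by
          simp only [step_apply, excise]
          grind
        rw [this]
        exact st' _

/-- The values lost on the cut edge reappear at the turns just before it, in either direction of
travel, and these belong to the same cycles. -/
theorem sum_excise (L : LoopSystem H) (a : H) (ha : L.join a ≠ L.edge a) {h : H}
    (h1 : h ≠ a) (h2 : h ≠ L.edge a) : (L.excise a).sum h = L.sum h := by
  classical
  have e1 := L.join_join
  have e2 := L.edge_edge
  have e3 := L.edge_ne
  have e4 := L.join_ne
  have hw : ∀ k, (L.excise a).value (L.edge k) = L.value (L.edge k) +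
      (if k = L.edge (L.join a) then L.value (L.edge a) else 0) +
      (if k = L.edge (L.join (L.edge a)) then L.value a else 0) -
      (if k = a then L.value (L.edge a) else 0) - (if k = L.edge a then L.value a else 0) := by
    intro k
    simp only [excise, ha, if_false]
    grind
  -- `edge (join a)` is the half-edge visited immediately before `a`.
  have s1 : L.step.SameCycle h (L.edge (L.join a)) ↔ L.step.SameCycle h a := by
    rw [← Equiv.Perm.sameCycle_apply_right, step_apply, e2, e1]
  have s2 : L.step.SameCycle h (L.edge (L.join (L.edge a))) ↔ L.step.SameCycle h (L.edge a) := by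
    rw [← Equiv.Perm.sameCycle_apply_right, step_apply, e2, e1]
  -- The two kinds of cycles differ only on the cut edge, where the new values vanish.
  have key : (L.excise a).sum h =
      ∑ k, if L.step.SameCycle h k then (L.excise a).value (L.edge k) else 0 := by
    rw [sum_eq_ite]
    refine Finset.sum_congr rfl fun k _ => ?_
    by_cases k1 : k = a
    · subst k1
      have : (L.excise k).value (L.edge k) = 0 := by
        simp [excise, ha, e3]
      change (if _ then (L.excise k).value (L.edge k) else 0) = _
      rw [this]
      simp
    by_cases k2 : k = L.edge a
    · have : (L.excise a).value (L.edge k) = 0 := by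
        simp [excise, ha, k2, e2]
      change (if _ then (L.excise a).value (L.edge k) else 0) = _
      rw [this]
      simp
    simp only [L.sameCycle_excise_iff a ha h1 h2 k1 k2]
    rfl
  have hite : ∀ (x : H) (y : ℤ), (∑ k, if L.step.SameCycle h k then (if k = x then y else 0) else 0)
      = if L.step.SameCycle h x then y else 0 := by
    intro x y
    rw [Finset.sum_eq_single x]
    · simp
    · intro b _ hb
      simp [hb]
    · simp
  rw [key, sum_eq_ite]
  simp only [hw]
  simp only [← Finset.sum_filter, Finset.sum_add_distrib, Finset.sum_sub_distrib]
  rw [← sub_eq_zero]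
  simp only [Finset.sum_filter, hite, s1, s2]
  ring

/-- The cut edge is a new trivial loop. All old loops survive, because a loop through the edge also
contains the half-edges `join a` and `join (edge a)` outside it. -/
theorem ev_excise (L : LoopSystem H) (a : H) (ha : L.join a ≠ L.edge a) :
    (L.excise a).ev δ = δ 0 * L.ev δ := by
  have e1 := L.join_join
  have e2 := L.edge_edge
  have e3 := L.edge_ne
  have e4 := L.join_ne
  -- An old loop is followed by pushing the ends of the cut edge to the half-edges they were joined
  -- to.
  let r : H → H := fun h => if h = a then L.join a else
    if h = L.edge a then L.join (L.edge a) else h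
  have r1 : ∀ h, r h ≠ a := by
    intro h
    simp only [r]
    grind
  have r2 : ∀ h, r h ≠ L.edge a := by
    intro h
    simp only [r]
    grind
  have rr : ∀ h, L.loopOf (r h) = L.loopOf h := by
    intro h
    simp only [r]
    split_ifs with i1 i2
    · rw [i1, loopOf_join]
    · rw [i2, loopOf_join]
    · rfl
  have hab : (L.excise a).join (L.join a) = L.join (L.edge a) := by
    simp only [excise]
    grind
  have hne : ∀ h, h ≠ a → h ≠ L.edge a → r h = h := fun h i j => by simp [r, i, j]
  have ta : (L.excise a).join a = (L.excise a).edge a := by simp [excise]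
  have sv : (L.excise a).value a = 0 := by simp [excise, ha]
  refine ev_eq_mul_of_injective δ L (L.excise a)
    (L.lift (fun h => (L.excise a).loopOf (r h)) ?_ ?_) ((L.excise a).loopOf a) ?_ ?_ ?_ ?_ ?_
  · intro h
    have hL : (L.excise a).loopOf (L.join (L.edge a)) = (L.excise a).loopOf (L.join a) := by
      rw [← hab, loopOf_join]
    by_cases i : h = a
    · subst i
      simpa [r, e3] using hL
    by_cases j : h = L.edge a
    · subst j
      simpa [r, e3, e2] using hL.symm
    have : r (L.edge h) = L.edge (r h) := by
      rw [hne h i j, hne]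
      · exact fun hh => j (by rw [← hh, e2])
      · exact fun hh => i (by rw [← e2 h, hh, e2])
    rw [this]
    exact (L.excise a).loopOf_edge (r h)
  · intro h
    have : r (L.join h) = r h ∨ r (L.join h) = (L.excise a).join (r h) := by
      simp only [r, excise]
      grind
    rcases this with hh | hh <;> rw [hh]
    rw [loopOf_join]
  · rw [absSum_loopOf, sum_eq_zero_of_trivial _ a ta sv, Int.natAbs_zero]
  · intro C C' h
    obtain ⟨x, rfl⟩ := L.exists_loopOf C
    obtain ⟨y, rfl⟩ := L.exists_loopOf C'
    rw [← rr x, ← rr y]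
    refine ((L.excise a).mem_iff_of_loopOf_eq (p := fun z => L.loopOf z = L.loopOf (r y))
      ?_ ?_ h).2 rfl
    · intro z hz
      exact (L.loopOf_edge z).trans hz
    · intro z hz
      rw [← hz]
      have : (L.excise a).join z = L.join z ∨ (L.excise a).join z = L.edge z ∨
          (L.excise a).join z = L.join (L.edge (L.join z)) := by
        simp only [excise]
        grind
      rcases this with hh | hh | hh <;> rw [hh] <;> simp only [loopOf_join, loopOf_edge]
  · intro C h
    obtain ⟨x, rfl⟩ := L.exists_loopOf C
    rcases ((L.excise a).loopOf_eq_iff_of_trivial a ta _).1 h with hh | hh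
    · exact r1 _ hh
    · exact r2 _ hh
  · intro C hC
    obtain ⟨x, rfl⟩ := (L.excise a).exists_loopOf C
    refine ⟨L.loopOf x, ?_⟩
    rw [lift_loopOf, hne x]
    · rintro rfl
      exact hC rfl
    · rintro rfl
      exact hC ((L.excise a).loopOf_edge a)
  · intro C
    obtain ⟨x, rfl⟩ := L.exists_loopOf C
    rw [lift_loopOf, ← rr x, absSum_loopOf, absSum_loopOf, sum_excise L a ha (r1 x) (r2 x)]

end excise

end LoopSystem

/-! ### Formal integer combinations -/

section formal

variable {κ R : Type*} [DecidableEq κ] [CommRing R]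

/-- The coefficient of a key in a formal integer combination. -/
def formalCoeff (S : List (ℤ × κ)) (k : κ) : ℤ :=
  (S.map fun t => if t.2 = k then t.1 else 0).sum

/-- The value of a formal integer combination. -/
def formalEval (g : κ → R) (S : List (ℤ × κ)) : R := (S.map fun t => (t.1 : R) * g t.2).sum

omit [DecidableEq κ] in
theorem formalEval_append (g : κ → R) (S S' : List (ℤ × κ)) :
    formalEval g (S ++ S') = formalEval g S + formalEval g S' := by
  simp [formalEval]

/-- Evaluation factors through the free abelian group on the keys. Keys outside both lists have
coefficient zero, so a finite check suffices. -/
theorem formalEval_eq (g : κ → R) {S S' : List (ℤ × κ)}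
    (h : ∀ t ∈ S ++ S', formalCoeff S t.2 = formalCoeff S' t.2) :
    formalEval g S = formalEval g S' := by
  let F : List (ℤ × κ) → (κ →₀ ℤ) := fun S => (S.map fun t => Finsupp.single t.2 t.1).sum
  have hF : ∀ S k, F S k = formalCoeff S k := by
    intro S k
    induction S with
    | nil => simp [F, formalCoeff]
    | cons t S ih =>
      have : F (t :: S) = Finsupp.single t.2 t.1 + F S := by simp [F]
      rw [this, Finsupp.add_apply, ih, Finsupp.single_apply]
      simp [formalCoeff]
  have hg : ∀ S, formalEval g S = (F S).sum fun k c => (c : R) * g k := by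
    intro S
    induction S with
    | nil => simp [F, formalEval]
    | cons t S ih =>
      have : F (t :: S) = Finsupp.single t.2 t.1 + F S := by simp [F]
      rw [this, Finsupp.sum_add_index', ← ih, Finsupp.sum_single_index]
      · simp [formalEval]
      · simp
      · simp
      · intro k a b
        push_cast
        ring
  rw [hg, hg]
  congr 1
  ext k
  rw [hF, hF]
  by_cases hk : ∃ t ∈ S ++ S', t.2 = k
  · obtain ⟨t, ht, rfl⟩ := hk
    exact h t ht
  · have hz : ∀ S₀ : List (ℤ × κ), (∀ t ∈ S₀, t.2 ≠ k) → formalCoeff S₀ k = 0 := by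
      intro S₀ h0
      refine List.sum_eq_zero fun x hx => ?_
      obtain ⟨t, ht, rfl⟩ := List.mem_map.1 hx
      rw [if_neg (h0 t ht)]
    rw [hz S fun t ht e => hk ⟨t, List.mem_append_left _ ht, e⟩,
      hz S' fun t ht e => hk ⟨t, List.mem_append_right _ ht, e⟩]

/-- The formal expansion of `c * A ^ e * (- A ^ 2 - A ^ (-2)) ^ l * k`. -/
def expandLoops : ℕ → ℤ → ℤ → κ → List (ℤ × ℤ × κ)
  | 0, c, e, k => [(c, e, k)]
  | l + 1, c, e, k => expandLoops l (-c) (e + 2) k ++ expandLoops l (-c) (e - 2) k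

omit [DecidableEq κ] in
theorem formalEval_expandLoops (A : Rˣ) (g : κ → R) (l : ℕ) (c e : ℤ) (k : κ) :
    formalEval (fun x : ℤ × κ => ((A ^ x.1 : Rˣ) : R) * g x.2) (expandLoops l c e k) =
      c * ((A ^ e : Rˣ) : R) * (- ((A ^ (2 : ℤ) : Rˣ) : R) - ((A ^ (-2 : ℤ) : Rˣ) : R)) ^ l * g k := by
  induction l generalizing c e with
  | zero => simp [expandLoops, formalEval, mul_assoc]
  | succ l ih =>
    rw [expandLoops, formalEval_append, ih, ih, zpow_add, zpow_sub, zpow_neg]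
    push_cast
    ring

end formal

/-! ### Local replacement: tangles described by finite tables. -/

namespace LoopSystem

variable {H T : Type}

/-- The joins and values of `L` on the image of `ι` are described by the table `τ`. -/
def Models (L : LoopSystem H) (ι : T → H) (τ : T → T × ℤ) : Prop :=
  ∀ t, L.join (ι t) = ι (τ t).1 ∧ L.value (ι t) = (τ t).2

/-- `L` and `L'` have the same edges, and the same joins and values outside the image of `ι`. -/
def AgreeOff (L L' : LoopSystem H) (ι : T → H) : Prop :=
  L.edge = L'.edge ∧ ∀ h, h ∉ Set.range ι → L.join h = L'.join h ∧ L.value h = L'.value h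

/-- This makes the weight `localEv` independent of the system chosen to realise a table. -/
theorem eq_of_agreeOff {L L' : LoopSystem H} {ι : T → H} {τ : T → T × ℤ} (h : AgreeOff L L' ι)
    (hL : L.Models ι τ) (hL' : L'.Models ι τ) : L = L' := by
  ext x
  · rw [h.1]
  · by_cases hx : x ∈ Set.range ι
    · obtain ⟨t, rfl⟩ := hx
      rw [(hL t).1, (hL' t).1]
    · exact (h.2 x hx).1
  · by_cases hx : x ∈ Set.range ι
    · obtain ⟨t, rfl⟩ := hx
      rw [(hL t).2, (hL' t).2]
    · exact (h.2 x hx).2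

theorem AgreeOff.symm {L L' : LoopSystem H} {ι : T → H} (h : AgreeOff L L' ι) : AgreeOff L' L ι :=
  ⟨h.1.symm, fun x hx => ⟨(h.2 x hx).1.symm, (h.2 x hx).2.symm⟩⟩

theorem AgreeOff.trans {L L' L'' : LoopSystem H} {ι : T → H} (h : AgreeOff L L' ι)
    (h' : AgreeOff L' L'' ι) : AgreeOff L L'' ι :=
  ⟨h.1.trans h'.1, fun x hx =>
    ⟨(h.2 x hx).1.trans (h'.2 x hx).1, (h.2 x hx).2.trans (h'.2 x hx).2⟩⟩

variable [DecidableEq T]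

/-- The effect on tables of cutting out the edge between `a` and `a'`. -/
def exciseTable (τ : T → T × ℤ) (a a' : T) (t : T) : T × ℤ :=
  if t = a then (a', 0) else if t = a' then (a, 0) else
    if t = (τ a).1 then ((τ a').1, (τ t).2 + (τ a').2) else
    if t = (τ a').1 then ((τ a).1, (τ t).2 + (τ a).2) else τ t

/-- `exciseTable` omits the degenerate case of `excise`; the last hypothesis rules it out. -/
theorem Models.excise [DecidableEq H] {L : LoopSystem H} {ι : T → H} {τ : T → T × ℤ}
    (hL : L.Models ι τ) (hι : Function.Injective ι) {a a' : T} (ha : L.edge (ι a) = ι a')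
    (hc : (τ a).1 ≠ a') : (L.excise (ι a)).Models ι (exciseTable τ a a') := by
  have h1 := (hL a).1
  have h2 := (hL a').1
  have h3 := (hL a).2
  have h4 := (hL a').2
  have hi : ∀ {x y}, ι x = ι y ↔ x = y := hι.eq_iff
  intro t
  have h5 := (hL t).1
  have h6 := (hL t).2
  simp only [LoopSystem.excise, exciseTable, ha, h1, h2, h3, h4, h5, h6, hi, if_neg hc]
  split_ifs <;> simp

omit [DecidableEq T] in
theorem agreeOff_excise [DecidableEq H] {L : LoopSystem H} {ι : T → H} {τ : T → T × ℤ}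
    (hL : L.Models ι τ) {a a' : T} (ha : L.edge (ι a) = ι a') :
    AgreeOff (L.excise (ι a)) L ι := by
  refine ⟨rfl, fun h hh => ?_⟩
  have e1 : h ≠ ι a := fun e => hh ⟨a, e.symm⟩
  have e2 : h ≠ ι a' := fun e => hh ⟨a', e.symm⟩
  have e3 : h ≠ ι (τ a).1 := fun e => hh ⟨_, e.symm⟩
  have e4 : h ≠ ι (τ a').1 := fun e => hh ⟨_, e.symm⟩
  simp [LoopSystem.excise, ha, (hL a).1, (hL a').1, e1, e2, e3, e4]

/-- Cut out successively the given edges, counting those that already are trivial loops. -/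
def reduceTable : List (T × T) → (T → T × ℤ) → ℕ × (T → T × ℤ)
  | [], τ => (0, τ)
  | (a, a') :: l, τ =>
    if (τ a).1 = a' then ((reduceTable l τ).1 + 1, (reduceTable l τ).2)
    else reduceTable l (exciseTable τ a a')

/-- The formal sum of reduced tables of a list of tables with exponents. -/
def reducedSum (elems : List T) (inner : List (T × T)) (S : List (ℤ × (T → T × ℤ))) :
    List (ℤ × ℤ × List (T × ℤ)) :=
  S.flatMap fun t => expandLoops (reduceTable inner t.2).1 1 t.1
    (elems.map (reduceTable inner t.2).2)

/-- Two formal sums of tables agree after reduction. -/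
def SameReduction (elems : List T) (inner : List (T × T)) (S S' : List (ℤ × (T → T × ℤ))) : Bool :=
  (reducedSum elems inner S ++ reducedSum elems inner S').all fun t =>
    decide (formalCoeff (reducedSum elems inner S) t.2 = formalCoeff (reducedSum elems inner S') t.2)

variable [Fintype H] {R : Type*} [CommRing R] (δ : ℕ → R)

/-- The weight of the loop system that is given by `τ` on the image of `ι`, and by `L` elsewhere. -/
noncomputable def localEv (L : LoopSystem H) (ι : T → H) (τ : T → T × ℤ) : R :=
  open Classical in
  if h : ∃ L' : LoopSystem H, AgreeOff L' L ι ∧ L'.Models ι τ then h.choose.ev δ else 0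

omit [DecidableEq T] in
theorem localEv_eq {L L' : LoopSystem H} {ι : T → H} {τ : T → T × ℤ} (h : AgreeOff L' L ι)
    (hL' : L'.Models ι τ) : localEv δ L ι τ = L'.ev δ := by
  have hex : ∃ L' : LoopSystem H, AgreeOff L' L ι ∧ L'.Models ι τ := ⟨L', h, hL'⟩
  rw [localEv, dif_pos hex]
  rw [eq_of_agreeOff (hex.choose_spec.1.trans h.symm) hex.choose_spec.2 hL']

/-- Each listed edge supplies a factor `δ 0` on the left. If the edge is cut, `ev_excise` absorbs
it; if its ends are already joined, nothing is cut and the factor is carried to the right. -/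
theorem localEv_reduceTable {L L' : LoopSystem H} {ι : T → H} (hι : Function.Injective ι)
    {τ : T → T × ℤ} (h : AgreeOff L' L ι) (hL' : L'.Models ι τ) (l : List (T × T))
    (hl : ∀ p ∈ l, L.edge (ι p.1) = ι p.2) :
    δ 0 ^ l.length * L'.ev δ =
      δ 0 ^ (reduceTable l τ).1 * localEv δ L ι (reduceTable l τ).2 := by
  classical
  induction l generalizing L' τ with
  | nil => simp [reduceTable, localEv_eq δ h hL']
  | cons p l ih =>
    obtain ⟨a, a'⟩ := p
    have ha : L'.edge (ι a) = ι a' := by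
      rw [h.1]
      exact hl (a, a') (by simp)
    have hl' : ∀ p ∈ l, L.edge (ι p.1) = ι p.2 := fun p hp => hl p (by simp [hp])
    by_cases hc : (τ a).1 = a'
    · rw [reduceTable, if_pos hc, List.length_cons, pow_succ', pow_succ', mul_assoc,
        ih h hL' hl', mul_assoc]
    · rw [reduceTable, if_neg hc, ← ih ((agreeOff_excise hL' ha).trans h)
        (hL'.excise hι ha hc) hl', ev_excise, List.length_cons]
      · ring
      · rw [(hL' a).1, ha]
        exact fun e => hc (hι e)

/-- The table with a given list of entries. -/
noncomputable def tableOfList (elems : List T) (k : List (T × ℤ)) : T → T × ℤ :=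
  have : Nonempty (T → T × ℤ) := ⟨fun t => (t, 0)⟩
  Function.invFun (fun τ : T → T × ℤ => elems.map τ) k

omit [DecidableEq T] in
-- Tables are recorded as lists of entries so that keys can be compared by evaluation; nothing is
-- lost, since `elems` contains every index.
theorem tableOfList_map {elems : List T} (helems : ∀ t, t ∈ elems) (τ : T → T × ℤ) :
    tableOfList elems (elems.map τ) = τ := by
  have : Nonempty (T → T × ℤ) := ⟨fun t => (t, 0)⟩
  refine Function.leftInverse_invFun (f := fun τ : T → T × ℤ => elems.map τ) ?_ τ
  intro τ τ' h
  funext t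
  exact List.map_inj_left.1 h t (helems t)

theorem reducedSum_cons (elems : List T) (inner : List (T × T)) (t : ℤ × (T → T × ℤ))
    (S : List (ℤ × (T → T × ℤ))) :
    reducedSum elems inner (t :: S) = expandLoops (reduceTable inner t.2).1 1 t.1
      (elems.map (reduceTable inner t.2).2) ++ reducedSum elems inner S :=
  List.flatMap_cons

/-- The weighted sum of a list of loop systems with exponents, computed from tables. -/
theorem sum_ev_eq_formalEval (A : Rˣ)
    (hδ : δ 0 = - ((A ^ (2 : ℤ) : Rˣ) : R) - ((A ^ (-2 : ℤ) : Rˣ) : R))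
    {elems : List T} (helems : ∀ t, t ∈ elems) {L : LoopSystem H} {ι : T → H}
    (hι : Function.Injective ι) {inner : List (T × T)}
    (hl : ∀ p ∈ inner, L.edge (ι p.1) = ι p.2) {α : Type} (l : List α) (e : α → ℤ)
    (M : α → LoopSystem H) (τ : α → T → T × ℤ) (hM : ∀ x ∈ l, AgreeOff (M x) L ι)
    (hτ : ∀ x ∈ l, (M x).Models ι (τ x)) :
    δ 0 ^ inner.length * (l.map fun x => ((A ^ e x : Rˣ) : R) * (M x).ev δ).sum =
      formalEval (fun x : ℤ × List (T × ℤ) => ((A ^ x.1 : Rˣ) : R) *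
        localEv δ L ι (tableOfList elems x.2))
        (reducedSum elems inner (l.map fun x => (e x, τ x))) := by
  induction l with
  | nil => simp [reducedSum, formalEval]
  | cons x l ih =>
    have h1 := ih (fun y hy => hM y (by simp [hy])) (fun y hy => hτ y (by simp [hy]))
    have h2 := localEv_reduceTable δ hι (hM x (by simp)) (hτ x (by simp)) inner hl
    rw [List.map_cons, List.sum_cons, mul_add, h1, List.map_cons]
    rw [reducedSum_cons, formalEval_append,
      formalEval_expandLoops A (fun k => localEv δ L ι
        (tableOfList elems k)),
      tableOfList_map helems, mul_left_comm, h2, ← hδ]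
    push_cast
    ring

variable {δ} in
-- For a fixed exterior, the weight of a reduced state depends only on its table, so equal formal
-- sums have equal values whatever the exterior is. The surplus power of `δ 0` is cancelled in the
-- domain.
theorem sum_ev_eq_sum_ev [IsDomain R] (A : Rˣ) (h0 : δ 0 ≠ 0)
    (hδ : δ 0 = - ((A ^ (2 : ℤ) : Rˣ) : R) - ((A ^ (-2 : ℤ) : Rˣ) : R))
    {elems : List T} (helems : ∀ t, t ∈ elems) {L : LoopSystem H} {ι : T → H}
    (hι : Function.Injective ι) {inner : List (T × T)}
    (hl : ∀ p ∈ inner, L.edge (ι p.1) = ι p.2) {α : Type} (l l' : List α) (e e' : α → ℤ)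
    (M M' : α → LoopSystem H) (τ τ' : α → T → T × ℤ) (hM : ∀ x ∈ l, AgreeOff (M x) L ι)
    (hτ : ∀ x ∈ l, (M x).Models ι (τ x)) (hM' : ∀ x ∈ l', AgreeOff (M' x) L ι)
    (hτ' : ∀ x ∈ l', (M' x).Models ι (τ' x))
    (hs : SameReduction elems inner (l.map fun x => (e x, τ x)) (l'.map fun x => (e' x, τ' x))) :
    (l.map fun x => ((A ^ e x : Rˣ) : R) * (M x).ev δ).sum =
      (l'.map fun x => ((A ^ e' x : Rˣ) : R) * (M' x).ev δ).sum := by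
  refine mul_left_cancel₀ (pow_ne_zero inner.length h0) ?_
  rw [sum_ev_eq_formalEval δ A hδ helems hι hl l e M τ hM hτ,
    sum_ev_eq_formalEval δ A hδ helems hι hl l' e' M' τ' hM' hτ']
  refine formalEval_eq _ fun t ht => ?_
  exact of_decide_eq_true (List.all_eq_true.1 hs t ht)

end LoopSystem

/-! ### Finite tables and checks for the Reidemeister moves. -/

/-- The table of a set of crossings and plain points, with the smoothings given by `s`. -/
def crossingTable {P : Type} (mate : P → P) (s right : P → Bool) (h : P × Bool) : (P × Bool) × ℤ :=
  ((mate h.1, if s h.1 then h.2 else !h.2),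
    if s h.1 then (if h.2 then -1 else 1) * (if right h.1 then 1 else -1) else 0)

/-- All half-edges at `n` points. -/
def allHalves (n : ℕ) : List (Fin n × Bool) :=
  (List.finRange n).flatMap fun p => [(p, false), (p, true)]

theorem mem_allHalves {n : ℕ} (h : Fin n × Bool) : h ∈ allHalves n := by
  obtain ⟨p, b⟩ := h
  cases b <;> simp [allHalves]

def boolTriples : List (Bool × Bool × Bool) :=
  [false, true].flatMap fun a => [false, true].flatMap fun b => [false, true].map fun c => (a, b, c)

/-- The contribution of a crossing to the exponent of a state. -/
def crossingExponent (pos s : Bool) : ℤ := if pos ^^ s then 1 else -1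

/-! The local tables of the Reidemeister moves. -/

def r1Mate (p : Fin 2) : Fin 2 := ![1, 0] p

def r1Table (f s : Bool) : Fin 2 × Bool → (Fin 2 × Bool) × ℤ :=
  crossingTable r1Mate (fun _ => s) ![f, !f]

def r1Inner : List ((Fin 2 × Bool) × (Fin 2 × Bool)) := [((0, true), (1, false))]

/-- The table of points without crossings. -/
def plainTable (n : ℕ) : Fin n × Bool → (Fin n × Bool) × ℤ :=
  crossingTable id (fun _ => false) fun _ => false

/-- The relation has zero on the right: the lists carry only coefficients `1`, so the negative
multiple of the erased diagram is moved to the left. The sign and `f` are independent because the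
kink may begin with its overpass or its underpass. -/
theorem r1_sameReduction (pos f : Bool) :
    LoopSystem.SameReduction (allHalves 2) r1Inner
      ([some false, some true, none].map fun s : Option Bool =>
        (s.elim (if pos then 3 else -3) (crossingExponent pos), s.elim (plainTable 2) (r1Table f)))
      (([] : List (Option Bool)).map fun _ => (0, plainTable 2)) = true := by
  revert pos f
  decide +kernel

/-- `0, 1` are the passages `c, d` through two crossings, and `2, 3` the opposite ones. -/
def r2Mate (p : Fin 4) : Fin 4 := ![2, 3, 0, 1] p

def r2Table (f : Bool) (s : Bool × Bool) : Fin 4 × Bool → (Fin 4 × Bool) × ℤ :=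
  crossingTable r2Mate ![s.1, s.2, s.1, s.2] ![f, !f, !f, f]

def r2Inner (t : Bool) : List ((Fin 4 × Bool) × (Fin 4 × Bool)) :=
  [((0, true), (1, false)), ((2, t), (3, !t))]

def boolPairs : List (Bool × Bool) :=
  [false, true].flatMap fun a => [false, true].map fun b => (a, b)

/-- One pair of smoothings leaves the two strands uncrossed. The other three turn the strands back
and cancel by A² + A⁻² + d = 0. -/
theorem r2_sameReduction (t pos : Bool) :
    LoopSystem.SameReduction (allHalves 4) (r2Inner t)
      (boolPairs.map fun s =>
        (crossingExponent pos s.1 + crossingExponent (!pos) s.2, r2Table pos s))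
      ([(false, false)].map fun _ => (0, plainTable 4)) = true := by
  revert t pos
  decide +kernel

/-- `0, 1, 2` are the overpasses `x, y, z` of a third Reidemeister move, and `3, 4, 5` the
corresponding underpasses. -/
def r3Mate (p : Fin 6) : Fin 6 := ![3, 4, 5, 0, 1, 2] p

/-- The reordering of the six passages in a third Reidemeister move. -/
def r3Swap (p : Fin 6) : Fin 6 := ![1, 0, 3, 2, 5, 4] p

def r3Table (px py pz : Bool) (s : Bool × Bool × Bool) : Fin 6 × Bool → (Fin 6 × Bool) × ℤ :=
  crossingTable r3Mate ![s.1, s.2.1, s.2.2, s.1, s.2.1, s.2.2] ![px, py, pz, !px, !py, !pz]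

def r3SlideTable (px py pz : Bool) (s : Bool × Bool × Bool) (h : Fin 6 × Bool) :
    (Fin 6 × Bool) × ℤ :=
  ((r3Swap (r3Table px py pz s (r3Swap h.1, h.2)).1.1, (r3Table px py pz s (r3Swap h.1, h.2)).1.2),
    (r3Table px py pz s (r3Swap h.1, h.2)).2)

def r3Exponent (px py pz : Bool) (s : Bool × Bool × Bool) : ℤ :=
  crossingExponent px s.1 + crossingExponent py s.2.1 + crossingExponent pz s.2.2

def r3Inner (t m b : Bool) : List ((Fin 6 × Bool) × (Fin 6 × Bool)) :=
  [((0, t), (1, !t)), ((3, m), (2, !m)), ((4, b), (5, !b))]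

/-- The slid triangle is read through `r3Swap`, so that both sides have the same inner edges. The
hypotheses select the directions and signs of genuine triangles, each of which is checked. -/
theorem r3_sameReduction (t m b px py pz : Bool) (h1 : (t ^^ px ^^ py) = (m ^^ px ^^ pz))
    (h2 : (t ^^ px ^^ py) = (b ^^ py ^^ pz)) :
    LoopSystem.SameReduction (allHalves 6) (r3Inner t m b)
      (boolTriples.map fun s => (r3Exponent px py pz s, r3Table px py pz s))
      (boolTriples.map fun s => (r3Exponent px py pz s, r3SlideTable px py pz s)) = true := by
  revert t m b px py pz
  decide +kernel

/-! ### The arrow polynomial as a weighted sum of loop systems. -/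

namespace GaussDiagram

/-- The loops of a state with the values of their cusps. -/
def loopSystem (D : GaussDiagram) (s : D.State) : LoopSystem D.Half where
  edge := D.edge
  join := D.join s
  value := D.cuspValue s
  edge_edge := D.edge_involutive
  join_join := D.join_involutive s
  edge_ne := by
    rintro ⟨p, b⟩ h
    cases b <;> simp [edge] at h
  join_ne := by
    rintro ⟨p, b⟩ h
    have h2 := s.2.2 p
    by_cases hp : s.1 p = true
    · simp only [join, hp, if_true, Prod.mk.injEq, and_true] at h
      simp [hp] at h2
      exact h2 h
    · simp [join, hp] at h
  value_join := D.cuspValue_join s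

theorem sum_loopSystem (D : GaussDiagram) (s : D.State) (h : D.Half) :
    (D.loopSystem s).sum h = D.cuspSum s h := by
  refine Finset.sum_congr ?_ fun _ _ => rfl
  ext k
  simp only [Finset.mem_filter]
  rfl

theorem absSum_loopSystem (D : GaussDiagram) (s : D.State) (C : D.Loop s) :
    (D.loopSystem s).absSum C / 2 = D.arrowNumber s C := by
  obtain ⟨h, rfl⟩ := (D.loopSystem s).exists_loopOf C
  rw [LoopSystem.absSum_loopOf, sum_loopSystem]
  rfl

/-- The unit `A`. -/
noncomputable def unitA : ArrowRingˣ where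
  val := MvPolynomial.C (LaurentPolynomial.T 1)
  inv := MvPolynomial.C (LaurentPolynomial.T (-1))
  val_inv := by rw [← map_mul, ← LaurentPolynomial.T_add]; simp
  inv_val := by rw [← map_mul, ← LaurentPolynomial.T_add]; simp

theorem unitA_zpow (n : ℤ) :
    ((unitA ^ n : ArrowRingˣ) : ArrowRing) = MvPolynomial.C (LaurentPolynomial.T n) := by
  have hnat : ∀ n : ℕ, ((unitA ^ n : ArrowRingˣ) : ArrowRing) =
      MvPolynomial.C (LaurentPolynomial.T n) := by
    intro n
    rw [Units.val_pow_eq_pow_val]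
    change (MvPolynomial.C (LaurentPolynomial.T 1)) ^ n = _
    rw [← map_pow, LaurentPolynomial.T_pow, mul_one]
  obtain ⟨n, rfl | rfl⟩ := n.eq_nat_or_neg
  · exact hnat n
  · rw [zpow_neg]
    refine Units.inv_eq_of_mul_eq_one_right ?_
    rw [zpow_natCast, hnat, ← map_mul, ← LaurentPolynomial.T_add]
    simp

theorem loopValue_ne_zero : loopValue ≠ 0 := by
  intro h
  have := congrArg (fun p : LaurentPolynomial ℤ => p.coeff 2) h
  simp [loopValue] at this

/-- The weight of a loop, by the absolute value of its sum of cusps. -/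
noncomputable def loopWeight (n : ℕ) : ArrowRing := MvPolynomial.C loopValue * K (n / 2)

theorem loopWeight_zero : loopWeight 0 = MvPolynomial.C loopValue := by
  simp [loopWeight, K]

theorem loopWeight_zero_ne : loopWeight 0 ≠ 0 := by
  rw [loopWeight_zero]
  simpa using loopValue_ne_zero

theorem loopWeight_zero_eq : loopWeight 0 =
    - ((unitA ^ (2 : ℤ) : ArrowRingˣ) : ArrowRing) - ((unitA ^ (-2 : ℤ) : ArrowRingˣ) : ArrowRing) := by
  rw [loopWeight_zero, unitA_zpow, unitA_zpow, loopValue, map_sub, map_neg]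

/-- The term of a state in the arrow polynomial, with an additional factor `d`. -/
noncomputable def stateTerm (D : GaussDiagram) (s : D.State) : ArrowRing :=
  ((unitA ^ D.exponent s : ArrowRingˣ) : ArrowRing) * (D.loopSystem s).ev loopWeight

/-- The state sum in which every loop has a factor `d`. -/
noncomputable def stateSum (D : GaussDiagram) : ArrowRing := ∑ s : D.State, D.stateTerm s

/-- The extra factor d makes the weight multiplicative over the loops. A nonempty diagram has a loop
in every state, so the natural subtraction in |S| - 1 does not truncate. -/
theorem stateSum_eq (D : GaussDiagram) [Nonempty D.Pt] :
    D.stateSum = MvPolynomial.C loopValue * D.arrowPolynomial := by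
  rw [stateSum, arrowPolynomial, Finset.mul_sum]
  refine Finset.sum_congr rfl fun s _ => ?_
  obtain ⟨p⟩ := ‹Nonempty D.Pt›
  have : Nonempty (D.Loop s) := ⟨Quot.mk _ (p, true)⟩
  have hpos : Fintype.card (D.Loop s) ≠ 0 := Fintype.card_ne_zero
  have hev : (D.loopSystem s).ev loopWeight =
      MvPolynomial.C loopValue ^ Fintype.card (D.Loop s) * ∏ C : D.Loop s, K (D.arrowNumber s C) := by
    change ∏ C : D.Loop s, MvPolynomial.C loopValue * K ((D.loopSystem s).absSum C / 2) = _
    rw [Finset.prod_mul_distrib, Finset.prod_const, Finset.card_univ]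
    simp only [absSum_loopSystem]
  obtain ⟨n, hn⟩ := Nat.exists_eq_succ_of_ne_zero hpos
  rw [stateTerm, hev, unitA_zpow, hn, Nat.succ_sub_one, map_mul, map_pow, pow_succ]
  ring

/-- The empty diagram needs separate treatment: its states have no loops, `0 - 1` is `0`, and both
sums are constants. -/
theorem mem_vars_stateSum (D : GaussDiagram) (i : ℕ+) :
    i ∈ D.stateSum.vars ↔ i ∈ D.arrowPolynomial.vars := by
  cases isEmpty_or_nonempty D.Pt with
  | inl h =>
    have hL : ∀ s, IsEmpty (D.Loop s) := fun s => ⟨fun C => by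
      obtain ⟨⟨p, b⟩⟩ := C
      exact h.elim p⟩
    have h1 : D.arrowPolynomial = MvPolynomial.C (∑ s : D.State, LaurentPolynomial.T (D.exponent s) *
        loopValue ^ (Fintype.card (D.Loop s) - 1)) := by
      rw [arrowPolynomial, map_sum]
      refine Finset.sum_congr rfl fun s _ => ?_
      rw [Finset.prod_of_isEmpty, mul_one]
    have h2 : D.stateSum = MvPolynomial.C (∑ s : D.State, LaurentPolynomial.T (D.exponent s)) := by
      rw [stateSum, map_sum]
      refine Finset.sum_congr rfl fun s _ => ?_
      have : IsEmpty (D.loopSystem s).Loop := hL s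
      rw [stateTerm, LoopSystem.ev, Finset.prod_of_isEmpty, mul_one, unitA_zpow]
    rw [h1, h2, MvPolynomial.vars_C, MvPolynomial.vars_C]
  | inr h => rw [stateSum_eq, MvPolynomial.vars_C_mul _ loopValue_ne_zero]

/-! ### States and crossings -/

section extend

variable (D : GaussDiagram) (c : D.Pt)

theorem mate_mem_crossing_iff (p : D.Pt) :
    (D.mate p = c ∨ D.mate p = D.mate c) ↔ (p = c ∨ p = D.mate c) := by
  have := D.mate_mate
  grind

theorem erase_mate_of_not_mem {p : D.Pt} (hp : ¬ (p = c ∨ p = D.mate c)) :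
    (D.erase c).mate p = D.mate p := if_neg hp

theorem erase_mate_of_mem {p : D.Pt} (hp : p = c ∨ p = D.mate c) :
    (D.erase c).mate p = p := if_pos hp

/-- Extend a state of the diagram without the crossing `c` by a smoothing of `c`. -/
def extendState (hc : D.mate c ≠ c) (s : (D.erase c).State) (b : Bool) : D.State where
  val p := if p = c ∨ p = D.mate c then b else s.1 p
  property := by
    refine ⟨fun p => ?_, fun p hp => ?_⟩
    · by_cases h : p = c ∨ p = D.mate c
      · exact (if_pos ((D.mate_mem_crossing_iff c p).2 h)).trans (if_pos h).symm
      · refine (if_neg (mt (D.mate_mem_crossing_iff c p).1 h)).trans (.trans ?_ (if_neg h).symm)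
        rw [← D.erase_mate_of_not_mem c h]
        exact s.2.1 p
    · have h : ¬ (p = c ∨ p = D.mate c) := by
        have := D.mate_mate
        grind
      exact (if_neg h).trans (s.2.2 p ((D.erase_mate_of_not_mem c h).trans hp))

theorem extendState_of_eq (hc : D.mate c ≠ c) (s : (D.erase c).State) (b : Bool) {p : D.Pt}
    (hp : p = c ∨ p = D.mate c) : (D.extendState c hc s b).1 p = b := if_pos hp

theorem extendState_of_ne (hc : D.mate c ≠ c) (s : (D.erase c).State) (b : Bool) {p : D.Pt}
    (h1 : p ≠ c) (h2 : p ≠ D.mate c) : (D.extendState c hc s b).1 p = s.1 p :=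
  if_neg fun h => h.elim h1 h2

/-- Restrict a state to the diagram without the crossing `c`. -/
def restrictState (s : D.State) : (D.erase c).State where
  val := fun p : D.Pt => if p = c ∨ p = D.mate c then false else s.1 p
  property := by
    refine ⟨fun (p : D.Pt) => ?_, fun (p : D.Pt) hp => ?_⟩
    · by_cases h : p = c ∨ p = D.mate c
      · rw [D.erase_mate_of_mem c h]
      · rw [D.erase_mate_of_not_mem c h]
        refine (if_neg (mt (D.mate_mem_crossing_iff c p).1 h)).trans (.trans ?_ (if_neg h).symm)
        exact s.2.1 p
    · by_cases h : p = c ∨ p = D.mate c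
      · exact if_pos h
      · exact (if_neg h).trans (s.2.2 p (by rwa [D.erase_mate_of_not_mem c h] at hp))

/-- A state is given by the smoothing of the crossing `c` and the remaining smoothings. -/
def stateEquiv (hc : D.mate c ≠ c) : D.State ≃ (D.erase c).State × Bool where
  toFun s := (D.restrictState c s, s.1 c)
  invFun t := D.extendState c hc t.1 t.2
  left_inv s := by
    refine Subtype.ext (funext fun p => ?_)
    by_cases h : p = c ∨ p = D.mate c
    · rw [extendState_of_eq _ _ _ _ _ h]
      rcases h with rfl | rfl
      · rfl
      · exact (s.2.1 c).symm
    · exact (if_neg h).trans (if_neg h)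
  right_inv t := by
    obtain ⟨s, b⟩ := t
    refine Prod.ext (Subtype.ext (funext fun (p : D.Pt) => ?_)) ?_
    · by_cases h : p = c ∨ p = D.mate c
      · exact (if_pos h).trans (s.2.2 p (D.erase_mate_of_mem c h)).symm
      · exact (if_neg h).trans (if_neg h)
    · exact D.extendState_of_eq c hc s b (Or.inl rfl)

theorem sum_states (hc : D.mate c ≠ c) {M : Type*} [AddCommMonoid M] (F : D.State → M) :
    ∑ s, F s = ∑ s : (D.erase c).State,
      (F (D.extendState c hc s false) + F (D.extendState c hc s true)) := by
  rw [Fintype.sum_equiv (D.stateEquiv c hc) F (fun t => F (D.extendState c hc t.1 t.2))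
    (fun s => congrArg F ((D.stateEquiv c hc).left_inv s).symm), Fintype.sum_prod_type]
  refine Finset.sum_congr rfl fun s _ => ?_
  rw [Fintype.sum_bool, add_comm]

theorem exponent_extendState (hc : D.mate c ≠ c) (s : (D.erase c).State) (b : Bool) :
    D.exponent (D.extendState c hc s b) =
      (D.erase c).exponent s + crossingExponent (D.isPos c) b := by
  have ho := D.isOver_mate c hc
  have hp := D.isPos_mate c
  have hm := D.mate_mate c
  rw [exponent, exponent, Finset.sum_filter, Finset.sum_filter]
  -- The crossing is counted at its overpass, which is either `c` or its mate; accordingly exactly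
  -- one of the two correction terms is active.
  have hk : ∀ k : D.Pt, (if D.mate k ≠ k ∧ D.isOver k = true then
        if D.isPos k ^^ (D.extendState c hc s b).1 k then (1 : ℤ) else -1 else 0) =
      (if (if k = c ∨ k = D.mate c then k else D.mate k) ≠ k ∧ D.isOver k = true then
        if D.isPos k ^^ s.1 k then (1 : ℤ) else -1 else 0) +
      (if k = c then (if D.isOver c then crossingExponent (D.isPos c) b else 0) else 0) +
      (if k = D.mate c then (if D.isOver c then 0 else crossingExponent (D.isPos c) b) else 0) := by
    intro k
    simp only [extendState, crossingExponent]
    by_cases k1 : k = c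
    · subst k1
      by_cases hh : D.isOver k = true <;> simp [hc, hc.symm, hh]
    by_cases k2 : k = D.mate c
    · subst k2
      by_cases hh : D.isOver c = true <;> simp [hc, hc.symm, hh, ho, hp, hm]
    simp [k1, k2]
  refine (Finset.sum_congr rfl fun k _ => hk k).trans ?_
  rw [Finset.sum_add_distrib, Finset.sum_add_distrib,
    Finset.sum_ite_eq', Finset.sum_ite_eq', add_assoc]
  refine congrArg₂ _ rfl ?_
  simp only [Finset.mem_univ, if_true]
  split_ifs <;> simp

end extend

/-- The half-edges at a family of points. -/
def halvesAt (D : GaussDiagram) {n : ℕ} (P : Fin n → D.Pt) (h : Fin n × Bool) : D.Half :=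
  (P h.1, h.2)

theorem halvesAt_injective (D : GaussDiagram) {n : ℕ} {P : Fin n → D.Pt}
    (hP : Function.Injective P) : Function.Injective (D.halvesAt P) := by
  rintro ⟨a, b⟩ ⟨a', b'⟩ h
  simp only [halvesAt, Prod.mk.injEq] at h
  rw [hP h.1, h.2]

theorem models_crossingTable (D : GaussDiagram) (s : D.State) {n : ℕ} {P : Fin n → D.Pt}
    {mate : Fin n → Fin n} {st right : Fin n → Bool} (h1 : ∀ a, D.mate (P a) = P (mate a))
    (h2 : ∀ a, s.1 (P a) = st a) (h3 : ∀ a, st a = true → D.fromRight (P a) = right a) :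
    (D.loopSystem s).Models (D.halvesAt P) (crossingTable mate st right) := by
  rintro ⟨a, b⟩
  have h1 := h1 a
  have h2 := h2 a
  have h3 := h3 a
  cases hst : st a <;>
    simp_all [loopSystem, join, cuspValue, halvesAt, crossingTable]

/-- Two states of diagrams with the same points and edges agree off the points `P`. -/
theorem agreeOff_of_eq (D : GaussDiagram) {n : ℕ} {P : Fin n → D.Pt}
    (s : D.State) (L : LoopSystem D.Half) (he : L.edge = D.edge)
    (h : ∀ p b, p ∉ Set.range P → L.join (p, b) = D.join s (p, b) ∧
      L.value (p, b) = D.cuspValue s (p, b)) :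
    LoopSystem.AgreeOff L (D.loopSystem s) (D.halvesAt P) := by
  refine ⟨he, ?_⟩
  rintro ⟨p, b⟩ hh
  refine h p b ?_
  rintro ⟨a, rfl⟩
  exact hh ⟨(a, b), rfl⟩

end GaussDiagram

/-! ### Invariance of the state sum under the moves. -/

namespace LoopSystem

/-- Transport a loop system along a bijection. -/
def pullback {H H' : Type} (L : LoopSystem H') (φ : H ≃ H') : LoopSystem H where
  edge h := φ.symm (L.edge (φ h))
  join h := φ.symm (L.join (φ h))
  value h := L.value (φ h)
  edge_edge h := by simp [L.edge_edge]
  join_join h := by simp [L.join_join]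
  edge_ne h hh := L.edge_ne (φ h) (φ.symm_apply_eq.1 hh)
  join_ne h hh := L.join_ne (φ h) (φ.symm_apply_eq.1 hh)
  value_join h := by simp [L.value_join]

theorem ev_pullback {H H' R : Type} [Fintype H] [Fintype H'] [CommMonoid R] (δ : ℕ → R)
    (L : LoopSystem H') (φ : H ≃ H') : (L.pullback φ).ev δ = L.ev δ :=
  (ev_of_bijective δ (L.pullback φ) L φ φ.injective (fun h => by simp [pullback])
    (fun h => by simp [pullback]) (fun h => rfl) φ.surjective).symm

end LoopSystem

namespace GaussDiagram

theorem edge_true (D : GaussDiagram) {p q : D.Pt} (h : D.next p = q) :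
    D.edge (p, true) = (q, false) := by simp [edge, h]

theorem edge_false (D : GaussDiagram) {p q : D.Pt} (h : D.next q = p) :
    D.edge (p, false) = (q, true) := by simp [edge, ← h]

theorem join_extendState (D : GaussDiagram) (c : D.Pt) (hc : D.mate c ≠ c) (s : (D.erase c).State)
    (b : Bool) (p : D.Pt) (x : Bool) (h1 : p ≠ c) (h2 : p ≠ D.mate c) :
    (D.loopSystem (D.extendState c hc s b)).join (p, x) = ((D.erase c).loopSystem s).join (p, x) ∧
    (D.loopSystem (D.extendState c hc s b)).value (p, x) =
      ((D.erase c).loopSystem s).value (p, x) := by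
  have e1 := D.extendState_of_ne c hc s b h1 h2
  have e2 := D.erase_mate_of_not_mem c (p := p) (fun h => h.elim h1 h2)
  constructor
  · simp only [loopSystem, join, e1, e2]
    rfl
  · simp only [loopSystem, cuspValue, e1]
    rfl

theorem zpow_unitA_add (m n : ℤ) : ((unitA ^ (m + n) : ArrowRingˣ) : ArrowRing) =
    ((unitA ^ m : ArrowRingˣ) : ArrowRing) * ((unitA ^ n : ArrowRingˣ) : ArrowRing) := by
  rw [zpow_add, Units.val_mul]

theorem stateTerm_extendState (D : GaussDiagram) (c : D.Pt) (hc : D.mate c ≠ c)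
    (s : (D.erase c).State) (b : Bool) :
    D.stateTerm (D.extendState c hc s b) =
      ((unitA ^ (D.erase c).exponent s : ArrowRingˣ) : ArrowRing) *
      (((unitA ^ crossingExponent (D.isPos c) b : ArrowRingˣ) : ArrowRing) *
        (D.loopSystem (D.extendState c hc s b)).ev loopWeight) := by
  rw [stateTerm, exponent_extendState, zpow_unitA_add, mul_assoc]

/-- The first Reidemeister move changes the state sum by a factor `- A ^ (± 3)`. -/
theorem stateSum_r1 (D : GaussDiagram) (c : D.Pt) (hc : D.mate c ≠ c) (h : D.next c = D.mate c) :
    D.stateSum = - ((unitA ^ (if D.isPos c then 3 else -3 : ℤ) : ArrowRingˣ) : ArrowRing) *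
      (D.erase c).stateSum := by
  rw [stateSum, sum_states D c hc, stateSum, Finset.mul_sum]
  refine Finset.sum_congr rfl fun s _ => ?_
  have hP : Function.Injective ![c, D.mate c] := by
    intro a a' haa
    fin_cases a <;> fin_cases a' <;> simp_all [hc.symm]
  have hm : ∀ a, D.mate (![c, D.mate c] a) = ![c, D.mate c] (r1Mate a) := by
    intro a
    fin_cases a <;> simp [r1Mate, D.mate_mate]
  have hr : ∀ a, ![c, D.mate c] a = c ∨ ![c, D.mate c] a = D.mate c := by
    intro a
    fin_cases a <;> simp
  -- `some b` stands for the smoothing `b` of the kink, and `none` for the erased diagram with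
  -- coefficient A^(±3); the three terms add up to zero.
  have key := LoopSystem.sum_ev_eq_sum_ev unitA loopWeight_zero_ne loopWeight_zero_eq mem_allHalves
    (L := ((D.erase c).loopSystem s : LoopSystem D.Half)) (D.halvesAt_injective hP)
    (inner := r1Inner) ?_ [some false, some true, none] []
    (fun o : Option Bool => o.elim (if D.isPos c then 3 else -3) (crossingExponent (D.isPos c)))
    (fun _ => 0)
    (fun o => o.elim ((D.erase c).loopSystem s) fun b => D.loopSystem (D.extendState c hc s b))
    (fun _ => (D.erase c).loopSystem s)
    (fun o => o.elim (plainTable 2) (r1Table (D.fromRight c))) (fun _ => plainTable 2)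
    ?_ ?_ ?_ ?_ (r1_sameReduction _ _)
  · simp only [List.map_cons, List.map_nil, List.sum_cons, List.sum_nil, Option.elim, add_zero] at key
    rw [stateTerm_extendState, stateTerm_extendState, stateTerm]
    have key' : ((unitA ^ crossingExponent (D.isPos c) false : ArrowRingˣ) : ArrowRing) *
          (D.loopSystem (D.extendState c hc s false)).ev loopWeight +
        (((unitA ^ crossingExponent (D.isPos c) true : ArrowRingˣ) : ArrowRing) *
          (D.loopSystem (D.extendState c hc s true)).ev loopWeight +
        ((unitA ^ (if D.isPos c then 3 else -3 : ℤ) : ArrowRingˣ) : ArrowRing) *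
          ((D.erase c).loopSystem s).ev loopWeight) = 0 := key
    linear_combination ((unitA ^ (D.erase c).exponent s : ArrowRingˣ) : ArrowRing) * key'
  · intro p hp
    simp only [r1Inner, List.mem_singleton] at hp
    subst hp
    exact D.edge_true h
  · rintro (_ | b) -
    · exact ⟨rfl, fun _ _ => ⟨rfl, rfl⟩⟩
    · refine (D.erase c).agreeOff_of_eq (P := ![c, D.mate c]) s _ rfl fun p x hp => ?_
      exact D.join_extendState c hc s b p x (fun e => hp ⟨0, e.symm⟩) fun e => hp ⟨1, e.symm⟩
  · rintro (_ | b) -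
    · exact (D.erase c).models_crossingTable s (P := ![c, D.mate c]) (mate := id)
        (st := fun _ => false) (right := fun _ => false)
        (fun a => D.erase_mate_of_mem c (hr a))
        (fun a => s.2.2 _ (D.erase_mate_of_mem c (hr a))) (by simp)
    · refine D.models_crossingTable _ hm (fun a => D.extendState_of_eq c hc s b (hr a)) ?_
      intro a _
      fin_cases a
      · rfl
      · exact D.fromRight_mate c hc
  · simp
  · simp

/-- The second Reidemeister move preserves the state sum. -/
theorem stateSum_r2 (D : GaussDiagram) (c d : D.Pt) (hc : D.mate c ≠ c) (hd : D.mate d ≠ d)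
    (oc : D.isOver c = true) (od : D.isOver d = true) (hs : D.isPos c ≠ D.isPos d)
    (h : D.next c = d) (h' : D.next (D.mate c) = D.mate d ∨ D.next (D.mate d) = D.mate c) :
    D.stateSum = ((D.erase c).erase d).stateSum := by
  have hdc : d ≠ c := fun e => hs (by rw [e])
  have hdm : d ≠ D.mate c := fun e => hs (by rw [e, D.isPos_mate])
  have hmd : D.mate d ≠ c := fun e => hdm (by rw [← e, D.mate_mate])
  have hmm : D.mate d ≠ D.mate c := fun e => hdc (by rw [← D.mate_mate d, e, D.mate_mate])
  have hd1 : (D.erase c).mate d = D.mate d := D.erase_mate_of_not_mem c (fun h => h.elim hdc hdm)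
  have hd' : (D.erase c).mate d ≠ d := by rwa [hd1]
  have hpos : D.isPos d = !D.isPos c := by
    revert hs
    cases D.isPos c <;> cases D.isPos d <;> simp
  let P : Fin 4 → D.Pt := ![c, d, D.mate c, D.mate d]
  have hP : Function.Injective P := by
    intro a a' haa
    fin_cases a <;> fin_cases a' <;> simp_all [P, Ne.symm]
  have hm : ∀ a, D.mate (P a) = P (r2Mate a) := by
    intro a
    fin_cases a <;> simp [P, r2Mate, D.mate_mate]
  have hoff : ∀ p, p ∉ Set.range P → p ≠ c ∧ p ≠ d ∧ p ≠ D.mate c ∧ p ≠ D.mate d := by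
    intro p hp
    exact ⟨fun e => hp ⟨0, e.symm⟩, fun e => hp ⟨1, e.symm⟩, fun e => hp ⟨2, e.symm⟩,
      fun e => hp ⟨3, e.symm⟩⟩
  rw [stateSum, sum_states D c hc, sum_states (D.erase c) d hd', stateSum]
  refine Finset.sum_congr rfl fun s _ => ?_
  let S : Bool × Bool → D.State := fun b =>
    D.extendState c hc ((D.erase c).extendState d hd' s b.2) b.1
  have hplain : ∀ a, ((D.erase c).erase d).mate (P a) = P a := by
    intro a
    fin_cases a
    · exact ((D.erase c).erase_mate_of_not_mem d 
        (fun e => e.elim hdc.symm fun e => hmd (e.trans hd1).symm)).trans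
        (D.erase_mate_of_mem c (Or.inl rfl))
    · exact (D.erase c).erase_mate_of_mem d (Or.inl rfl)
    · exact ((D.erase c).erase_mate_of_not_mem d 
        (fun e => e.elim hdm.symm fun e => hmm (e.trans hd1).symm)).trans
        (D.erase_mate_of_mem c (Or.inr rfl))
    · exact (D.erase c).erase_mate_of_mem d (Or.inr hd1.symm)
  -- `t` records whether the underpassing segment runs parallel or antiparallel to the overpassing
  -- one.
  obtain ⟨t, ht⟩ : ∃ t, D.edge (D.mate c, t) = (D.mate d, !t) := by
    rcases h' with h' | h'
    · exact ⟨true, D.edge_true h'⟩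
    · exact ⟨false, D.edge_false h'⟩
  have key := LoopSystem.sum_ev_eq_sum_ev unitA loopWeight_zero_ne loopWeight_zero_eq mem_allHalves
    (L := (((D.erase c).erase d).loopSystem s : LoopSystem D.Half)) (D.halvesAt_injective hP)
    (inner := r2Inner t) ?_ boolPairs [(false, false)]
    (fun b => crossingExponent (D.isPos c) b.1 + crossingExponent (!D.isPos c) b.2)
    (fun _ => 0)
    (fun b => D.loopSystem (S b))
    (fun _ => ((D.erase c).erase d).loopSystem s)
    (fun b => r2Table (D.isPos c) b) (fun _ => plainTable 4)
    ?_ ?_ ?_ ?_ (r2_sameReduction _ _)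
  · have hterm : ∀ b, D.stateTerm (S b) =
        ((unitA ^ ((D.erase c).erase d).exponent s : ArrowRingˣ) : ArrowRing) *
        (((unitA ^ (crossingExponent (D.isPos c) b.1 + crossingExponent (!D.isPos c) b.2) :
          ArrowRingˣ) : ArrowRing) * (D.loopSystem (S b)).ev loopWeight) := by
      intro b
      have h2 := (D.erase c).exponent_extendState d hd' s b.2
      have : (D.erase c).isPos d = !D.isPos c := hpos
      rw [stateTerm_extendState, h2, this, zpow_unitA_add, zpow_unitA_add]
      ring
    change D.stateTerm (S (false, false)) + D.stateTerm (S (true, false)) +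
      (D.stateTerm (S (false, true)) + D.stateTerm (S (true, true))) = _
    simp only [boolPairs, List.flatMap_cons, List.flatMap_nil, List.map_cons, List.map_nil,
      List.append_nil, List.cons_append, List.nil_append, List.sum_cons, List.sum_nil, add_zero,
      zpow_zero, Units.val_one, one_mul] at key
    rw [hterm, hterm, hterm, hterm, stateTerm]
    have key' : ((unitA ^ (crossingExponent (D.isPos c) false +
          crossingExponent (!D.isPos c) false) : ArrowRingˣ) : ArrowRing) *
          (D.loopSystem (S (false, false))).ev loopWeight +
        (((unitA ^ (crossingExponent (D.isPos c) false +
          crossingExponent (!D.isPos c) true) : ArrowRingˣ) : ArrowRing) *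
          (D.loopSystem (S (false, true))).ev loopWeight +
        (((unitA ^ (crossingExponent (D.isPos c) true +
          crossingExponent (!D.isPos c) false) : ArrowRingˣ) : ArrowRing) *
          (D.loopSystem (S (true, false))).ev loopWeight +
        ((unitA ^ (crossingExponent (D.isPos c) true +
          crossingExponent (!D.isPos c) true) : ArrowRingˣ) : ArrowRing) *
          (D.loopSystem (S (true, true))).ev loopWeight)) =
        (((D.erase c).erase d).loopSystem s).ev loopWeight := key
    linear_combination ((unitA ^ ((D.erase c).erase d).exponent s : ArrowRingˣ) : ArrowRing) * key'
  · intro p hp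
    simp only [r2Inner, List.mem_cons, List.not_mem_nil, or_false] at hp
    rcases hp with rfl | rfl
    · exact D.edge_true h
    · exact ht
  · rintro b -
    refine ((D.erase c).erase d).agreeOff_of_eq (P := P) s _ rfl fun p x hp => ?_
    obtain ⟨h1, h2, h3, h4⟩ := hoff p hp
    have e1 := D.join_extendState c hc ((D.erase c).extendState d hd' s b.2) b.1 p x h1 h3
    have e2 := (D.erase c).join_extendState d hd' s b.2 p x h2 (by rwa [hd1])
    exact ⟨e1.1.trans e2.1, e1.2.trans e2.2⟩
  · rintro b -
    refine D.models_crossingTable _ hm ?_ ?_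
    · intro a
      fin_cases a
      · exact D.extendState_of_eq c hc _ _ (Or.inl rfl)
      · exact (D.extendState_of_ne c hc _ _ hdc hdm).trans
          ((D.erase c).extendState_of_eq d hd' _ _ (Or.inl rfl))
      · exact D.extendState_of_eq c hc _ _ (Or.inr rfl)
      · exact (D.extendState_of_ne c hc _ _ hmd hmm).trans
          ((D.erase c).extendState_of_eq d hd' _ _ (Or.inr hd1.symm))
    · have f1 := D.fromRight_mate c hc
      have f2 := D.fromRight_mate d hd
      have g1 : D.fromRight c = D.isPos c := by simp [fromRight, oc]
      have g2 : D.fromRight d = !D.isPos c := by simp [fromRight, od, hpos]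
      rw [g1] at f1
      rw [g2, Bool.not_not] at f2
      intro a _
      fin_cases a
      · exact g1
      · exact g2
      · exact f1
      · exact f2
  · rintro - -
    exact ⟨rfl, fun _ _ => ⟨rfl, rfl⟩⟩
  · rintro - -
    exact ((D.erase c).erase d).models_crossingTable s (P := P) (mate := id)
      (st := fun _ => false) (right := fun _ => false) hplain (fun a => s.2.2 _ (hplain a)) (by simp)

end GaussDiagram

namespace GaussDiagram

/-- The third Reidemeister move preserves the state sum. -/
theorem stateSum_r3 (D : GaussDiagram) (x y z : D.Pt) (t m b : Bool)
    (hx : D.mate x ≠ x) (hy : D.mate y ≠ y) (hz : D.mate z ≠ z)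
    (ox : D.isOver x = true) (oy : D.isOver y = true) (oz : D.isOver z = true)
    (hxy : x ≠ y) (hxz : x ≠ z) (hyz : y ≠ z)
    (ht : D.Adj t x y) (hm : D.Adj m (D.mate x) z) (hb : D.Adj b (D.mate y) (D.mate z))
    (s1 : (t ^^ D.isPos x ^^ D.isPos y) = (m ^^ D.isPos x ^^ D.isPos z))
    (s2 : (t ^^ D.isPos x ^^ D.isPos y) = (b ^^ D.isPos y ^^ D.isPos z)) :
    (D.slide x y z).stateSum = D.stateSum := by
  have ux : D.isOver (D.mate x) = false := by rw [D.isOver_mate x hx, ox]; rfl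
  have uy : D.isOver (D.mate y) = false := by rw [D.isOver_mate y hy, oy]; rfl
  have uz : D.isOver (D.mate z) = false := by rw [D.isOver_mate z hz, oz]; rfl
  have hou : ∀ {p q : D.Pt}, D.isOver p = true → D.isOver q = false → p ≠ q := by
    rintro p q h1 h2 rfl
    rw [h1] at h2
    exact Bool.noConfusion h2
  have hmm : ∀ {p q : D.Pt}, p ≠ q → D.mate p ≠ D.mate q := by
    intro p q h e
    exact h (by rw [← D.mate_mate p, e, D.mate_mate])
  have xy' := hou ox uy
  have xz' := hou ox uz
  have xx' := hou ox ux
  have yx' := hou oy ux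
  have yy' := hou oy uy
  have yz' := hou oy uz
  have zx' := hou oz ux
  have zy' := hou oz uy
  have zz' := hou oz uz
  have mxy := hmm hxy
  have mxz := hmm hxz
  have myz := hmm hyz
  let P : Fin 6 → D.Pt := ![x, y, z, D.mate x, D.mate y, D.mate z]
  have hP : Function.Injective P := by
    intro a a' haa
    fin_cases a <;> fin_cases a' <;> first | rfl | (exfalso; revert haa; simp only [P]; first
      | exact hxy | exact hxy.symm | exact hxz | exact hxz.symm | exact hyz | exact hyz.symm
      | exact xy' | exact xy'.symm | exact xz' | exact xz'.symm | exact xx' | exact xx'.symm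
      | exact yx' | exact yx'.symm | exact yy' | exact yy'.symm | exact yz' | exact yz'.symm
      | exact zx' | exact zx'.symm | exact zy' | exact zy'.symm | exact zz' | exact zz'.symm
      | exact mxy | exact mxy.symm | exact mxz | exact mxz.symm | exact myz | exact myz.symm)
  have hmate : ∀ a, D.mate (P a) = P (r3Mate a) := by
    intro a
    fin_cases a <;> simp [P, r3Mate, D.mate_mate]
  have hoff : ∀ p, p ∉ Set.range P → p ≠ x ∧ p ≠ y ∧ p ≠ z ∧ p ≠ D.mate x ∧ p ≠ D.mate y ∧
      p ≠ D.mate z := by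
    intro p hp
    exact ⟨fun e => hp ⟨0, e.symm⟩, fun e => hp ⟨1, e.symm⟩, fun e => hp ⟨2, e.symm⟩,
      fun e => hp ⟨3, e.symm⟩, fun e => hp ⟨4, e.symm⟩, fun e => hp ⟨5, e.symm⟩⟩
  let σ := D.triangleSwap x y z
  have hσ : ∀ a, σ (P a) = P (r3Swap a) := by
    intro a
    change Equiv.swap x y (Equiv.swap (D.mate x) z (Equiv.swap (D.mate y) (D.mate z) (P a))) = _
    fin_cases a
    · change Equiv.swap x y (Equiv.swap (D.mate x) z (Equiv.swap (D.mate y) (D.mate z) x)) = y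
      rw [Equiv.swap_apply_of_ne_of_ne xy' xz', Equiv.swap_apply_of_ne_of_ne xx' hxz,
        Equiv.swap_apply_left]
    · change Equiv.swap x y (Equiv.swap (D.mate x) z (Equiv.swap (D.mate y) (D.mate z) y)) = x
      rw [Equiv.swap_apply_of_ne_of_ne yy' yz', Equiv.swap_apply_of_ne_of_ne yx' hyz,
        Equiv.swap_apply_right]
    · change Equiv.swap x y (Equiv.swap (D.mate x) z (Equiv.swap (D.mate y) (D.mate z) z)) =
        D.mate x
      rw [Equiv.swap_apply_of_ne_of_ne zy' zz', Equiv.swap_apply_right,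
        Equiv.swap_apply_of_ne_of_ne xx'.symm yx'.symm]
    · change Equiv.swap x y (Equiv.swap (D.mate x) z (Equiv.swap (D.mate y) (D.mate z) (D.mate x)))
        = z
      rw [Equiv.swap_apply_of_ne_of_ne mxy mxz, Equiv.swap_apply_left,
        Equiv.swap_apply_of_ne_of_ne hxz.symm hyz.symm]
    · change Equiv.swap x y (Equiv.swap (D.mate x) z (Equiv.swap (D.mate y) (D.mate z) (D.mate y)))
        = D.mate z
      rw [Equiv.swap_apply_left, Equiv.swap_apply_of_ne_of_ne mxz.symm zz'.symm,
        Equiv.swap_apply_of_ne_of_ne xz'.symm yz'.symm]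
    · change Equiv.swap x y (Equiv.swap (D.mate x) z (Equiv.swap (D.mate y) (D.mate z) (D.mate z)))
        = D.mate y
      rw [Equiv.swap_apply_right, Equiv.swap_apply_of_ne_of_ne mxy.symm zy'.symm,
        Equiv.swap_apply_of_ne_of_ne xy'.symm yy'.symm]
  have hσoff : ∀ p, p ∉ Set.range P → σ p = p := by
    intro p hp
    obtain ⟨h1, h2, h3, h4, h5, h6⟩ := hoff p hp
    change Equiv.swap x y (Equiv.swap (D.mate x) z (Equiv.swap (D.mate y) (D.mate z) p)) = _
    rw [Equiv.swap_apply_of_ne_of_ne h5 h6, Equiv.swap_apply_of_ne_of_ne h4 h3,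
      Equiv.swap_apply_of_ne_of_ne h1 h2]
  have hσs : ∀ a, σ.symm (P a) = P (r3Swap a) := by
    intro a
    rw [Equiv.symm_apply_eq, hσ]
    fin_cases a <;> rfl
  have hmoff : ∀ p, p ∉ Set.range P → D.mate p ∉ Set.range P := by
    rintro p hp ⟨a, ha⟩
    exact hp ⟨r3Mate a, by rw [← hmate, ha, D.mate_mate]⟩
  -- Sliding conjugates `next` by `σ` and keeps the crossings. Pulled back along `φ`, the edges are
  -- again those of `D`, and the crossings of the triangle are permuted instead.
  let φ : D.Half ≃ D.Half := Equiv.prodCongr σ (Equiv.refl Bool)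
  have hφe : ∀ h, φ.symm ((D.slide x y z).edge (φ h)) = D.edge h := by
    rintro ⟨p, c⟩
    have hn : ∀ q, (σ * D.next * σ⁻¹ : Equiv.Perm D.Pt) (σ q) = σ (D.next q) := fun q => by
      rw [Equiv.Perm.mul_apply, Equiv.Perm.mul_apply, Equiv.Perm.inv_def, Equiv.symm_apply_apply]
    refine (Equiv.symm_apply_eq φ).2 ?_
    cases c
    · have hn' : (σ * D.next * σ⁻¹ : Equiv.Perm D.Pt).symm (σ p) = σ (D.next.symm p) := by
        rw [Equiv.symm_apply_eq, hn, Equiv.apply_symm_apply]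
      exact Prod.ext hn' rfl
    · exact Prod.ext (hn p) rfl
  have e1y : (D.erase x).mate y = D.mate y :=
    D.erase_mate_of_not_mem x fun e => e.elim hxy.symm yx'
  have hy1 : (D.erase x).mate y ≠ y := by rwa [e1y]
  have e1z : (D.erase x).mate z = D.mate z :=
    D.erase_mate_of_not_mem x fun e => e.elim hxz.symm zx'
  have e2z : ((D.erase x).erase y).mate z = D.mate z :=
    ((D.erase x).erase_mate_of_not_mem y fun e =>
      e.elim hyz.symm fun e => zy' (e.trans e1y)).trans e1z
  have hz2 : ((D.erase x).erase y).mate z ≠ z := by rwa [e2z]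
  -- A state is split into its smoothings outside the triangle and the three smoothings inside; the
  -- comparison is made separately for each exterior.
  let S : (((D.erase x).erase y).erase z).State → Bool × Bool × Bool → D.State := fun s c =>
    D.extendState x hx ((D.erase x).extendState y hy1
      (((D.erase x).erase y).extendState z hz2 s c.2.2) c.2.1) c.1
  have hS : ∀ s c a, (S s c).1 (P a) = ![c.1, c.2.1, c.2.2, c.1, c.2.1, c.2.2] a := by
    intro s c a
    fin_cases a
    · exact D.extendState_of_eq x hx _ _ (Or.inl rfl)
    · exact (D.extendState_of_ne x hx _ _ hxy.symm yx').trans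
        ((D.erase x).extendState_of_eq y hy1 _ _ (Or.inl rfl))
    · exact (D.extendState_of_ne x hx _ _ hxz.symm zx').trans
        (((D.erase x).extendState_of_ne y hy1 _ _ hyz.symm (by rwa [e1y])).trans
        (((D.erase x).erase y).extendState_of_eq z hz2 _ _ (Or.inl rfl)))
    · exact D.extendState_of_eq x hx _ _ (Or.inr rfl)
    · exact (D.extendState_of_ne x hx _ _ xy'.symm mxy.symm).trans
        ((D.erase x).extendState_of_eq y hy1 _ _ (Or.inr e1y.symm))
    · exact (D.extendState_of_ne x hx _ _ xz'.symm mxz.symm).trans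
        (((D.erase x).extendState_of_ne y hy1 _ _ yz'.symm (by rw [e1y]; exact myz.symm)).trans
        (((D.erase x).erase y).extendState_of_eq z hz2 _ _ (Or.inr e2z.symm)))
  have hSoff : ∀ s c p, p ∉ Set.range P → (S s c).1 p = s.1 p := by
    intro s c p hp
    obtain ⟨h1, h2, h3, h4, h5, h6⟩ := hoff p hp
    exact (D.extendState_of_ne x hx _ _ h1 h4).trans
        (((D.erase x).extendState_of_ne y hy1 _ _ h2 (by rwa [e1y])).trans
        (((D.erase x).erase y).extendState_of_ne z hz2 _ _ h3 (by rwa [e2z])))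
  have hexp : ∀ s c, D.exponent (S s c) = (((D.erase x).erase y).erase z).exponent s +
      r3Exponent (D.isPos x) (D.isPos y) (D.isPos z) c := by
    intro s c
    have i1 := D.exponent_extendState x hx ((D.erase x).extendState y hy1
      (((D.erase x).erase y).extendState z hz2 s c.2.2) c.2.1) c.1
    have i2 := (D.erase x).exponent_extendState y hy1
      (((D.erase x).erase y).extendState z hz2 s c.2.2) c.2.1
    have i3 := ((D.erase x).erase y).exponent_extendState z hz2 s c.2.2
    have j2 : (D.erase x).isPos y = D.isPos y := rfl
    have j3 : ((D.erase x).erase y).isPos z = D.isPos z := rfl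
    rw [j2] at i2
    rw [j3] at i3
    refine i1.trans ?_
    rw [i2, i3, r3Exponent]
    ring
  have hr : ∀ a, D.fromRight (P a) = ![D.isPos x, D.isPos y, D.isPos z, !D.isPos x, !D.isPos y,
      !D.isPos z] a := by
    intro a
    fin_cases a <;> simp [P, fromRight, ox, oy, oz, ux, uy, uz, D.isPos_mate]
  have hmodel : ∀ s c, (D.loopSystem (S s c)).Models (D.halvesAt P)
      (r3Table (D.isPos x) (D.isPos y) (D.isPos z) c) := fun s c =>
    D.models_crossingTable (S s c) hmate (hS s c) fun a _ => hr a
  have hinner : ∀ p ∈ r3Inner t m b, D.edge (D.halvesAt P p.1) = D.halvesAt P p.2 := by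
    have hadj : ∀ {ε : Bool} {p q : D.Pt}, D.Adj ε p q → D.edge (p, ε) = (q, !ε) := by
      intro ε p q h
      cases ε
      · exact D.edge_false h
      · exact D.edge_true h
    intro p hp
    simp only [r3Inner, List.mem_cons, List.not_mem_nil, or_false] at hp
    rcases hp with rfl | rfl | rfl
    · exact hadj ht
    · exact hadj hm
    · exact hadj hb
  have key : ∀ s, (boolTriples.map fun c =>
      ((unitA ^ r3Exponent (D.isPos x) (D.isPos y) (D.isPos z) c : ArrowRingˣ) : ArrowRing) *
        (D.loopSystem (S s c)).ev loopWeight).sum = (boolTriples.map fun c =>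
      ((unitA ^ r3Exponent (D.isPos x) (D.isPos y) (D.isPos z) c : ArrowRingˣ) : ArrowRing) *
        (((D.slide x y z).loopSystem (S s c)).pullback φ).ev loopWeight).sum := by
    intro s
    refine LoopSystem.sum_ev_eq_sum_ev unitA loopWeight_zero_ne loopWeight_zero_eq mem_allHalves
      (L := D.loopSystem (S s (false, false, false))) (D.halvesAt_injective hP)
      (inner := r3Inner t m b) hinner boolTriples boolTriples _ _ _ _
      (r3Table (D.isPos x) (D.isPos y) (D.isPos z))
      (r3SlideTable (D.isPos x) (D.isPos y) (D.isPos z)) ?_ ?_ ?_ ?_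
      (r3_sameReduction t m b _ _ _ s1 s2)
    · rintro c -
      refine D.agreeOff_of_eq _ _ rfl fun p e hp => ?_
      constructor
      · simp only [loopSystem, join, hSoff _ _ p hp]
      · simp only [loopSystem, cuspValue, hSoff _ _ p hp]
    · exact fun c _ => hmodel s c
    · rintro c -
      refine D.agreeOff_of_eq _ _ (funext hφe) fun p e hp => ?_
      have hφp : φ (p, e) = (p, e) := Prod.ext (hσoff p hp) rfl
      have hφp' : ∀ e', φ.symm (D.mate p, e') = (D.mate p, e') := fun e' => by
        have : φ (D.mate p, e') = (D.mate p, e') := Prod.ext (hσoff _ (hmoff p hp)) rfl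
        exact (Equiv.symm_apply_eq φ).2 this.symm
      constructor
      · change φ.symm (D.join (S s c) (φ (p, e))) = _
        rw [hφp]
        simp only [join, hSoff _ _ p hp]
        split_ifs <;> exact hφp' _
      · change D.cuspValue (S s c) (φ (p, e)) = _
        rw [hφp]
        simp only [cuspValue, hSoff _ _ p hp]
    · rintro c - ⟨a, e⟩
      have hφa : φ (D.halvesAt P (a, e)) = D.halvesAt P (r3Swap a, e) := Prod.ext (hσ a) rfl
      have hφa' : ∀ k : Fin 6 × Bool,
          φ.symm (D.halvesAt P k) = D.halvesAt P (r3Swap k.1, k.2) := fun k =>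
        Prod.ext (hσs k.1) rfl
      have hm1 := hmodel s c (r3Swap a, e)
      constructor
      · change φ.symm ((D.loopSystem (S s c)).join (φ (D.halvesAt P (a, e)))) = _
        rw [hφa, hm1.1, hφa']
        rfl
      · change (D.loopSystem (S s c)).value (φ (D.halvesAt P (a, e))) = _
        rw [hφa, hm1.2]
        rfl
  have hsum : ∀ F : D.State → ArrowRing, ∑ s, F s =
      ∑ s, (boolTriples.map fun c => F (S s c)).sum := by
    intro F
    rw [sum_states D x hx, sum_states (D.erase x) y hy1, sum_states ((D.erase x).erase y) z hz2]
    refine Finset.sum_congr rfl fun s _ => ?_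
    simp only [boolTriples, List.flatMap_cons, List.flatMap_nil, List.map_cons, List.map_nil,
      List.append_nil, List.cons_append, List.nil_append, List.sum_cons, List.sum_nil, add_zero, S]
    ring
  have hfac : ∀ (s : (((D.erase x).erase y).erase z).State) (G : D.State → ArrowRing),
      (boolTriples.map fun c => ((unitA ^ D.exponent (S s c) : ArrowRingˣ) : ArrowRing) *
        G (S s c)).sum =
      ((unitA ^ (((D.erase x).erase y).erase z).exponent s : ArrowRingˣ) : ArrowRing) *
      (boolTriples.map fun c =>
      ((unitA ^ r3Exponent (D.isPos x) (D.isPos y) (D.isPos z) c : ArrowRingˣ) : ArrowRing) *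
        G (S s c)).sum := by
    intro s G
    rw [← List.sum_map_mul_left]
    congr 2
    funext c
    rw [hexp, zpow_unitA_add, mul_assoc]
  have h1 : D.stateSum = ∑ s : D.State, ((unitA ^ D.exponent s : ArrowRingˣ) : ArrowRing) *
      (D.loopSystem s).ev loopWeight := rfl
  have h2 : (D.slide x y z).stateSum = ∑ s : D.State,
      ((unitA ^ D.exponent s : ArrowRingˣ) : ArrowRing) *
      (((D.slide x y z).loopSystem s).pullback φ).ev loopWeight := by
    change ∑ s : D.State, (D.slide x y z).stateTerm s = _
    refine Finset.sum_congr rfl fun s _ => ?_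
    exact congrArg₂ (· * ·) rfl
      (LoopSystem.ev_pullback loopWeight ((D.slide x y z).loopSystem s) φ).symm
  rw [h1, h2, hsum, hsum]
  refine Finset.sum_congr rfl fun s _ => ?_
  rw [hfac s fun s => (((D.slide x y z).loopSystem s).pullback φ).ev loopWeight,
    hfac s fun s => (D.loopSystem s).ev loopWeight, key]

/-- Renaming the points preserves the state sum. -/
theorem stateSum_iso {D D' : GaussDiagram} (h : Iso D D') : D.stateSum = D'.stateSum := by
  have hmate : ∀ p, h.e.symm (D'.mate p) = D.mate (h.e.symm p) := fun p => by
    rw [Equiv.symm_apply_eq, h.mate_eq, Equiv.apply_symm_apply]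
  have hfix : ∀ p, D'.mate (h.e p) = h.e p ↔ D.mate p = p := fun p => by
    rw [← h.mate_eq, h.e.apply_eq_iff_eq]
  let E : D.State ≃ D'.State :=
    { toFun := fun s => ⟨fun p => s.1 (h.e.symm p), fun p => (congrArg s.1 (hmate p)).trans (s.2.1 _),
        fun p hp => s.2.2 _ (by rw [← hmate, hp])⟩
      invFun := fun s => ⟨fun p => s.1 (h.e p),
        fun p => (congrArg s.1 (h.mate_eq p)).trans (s.2.1 _),
        fun p hp => s.2.2 _ ((hfix p).2 hp)⟩
      left_inv := fun s => Subtype.ext (funext fun p => congrArg s.1 (h.e.symm_apply_apply p))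
      right_inv := fun s => Subtype.ext (funext fun p => congrArg s.1 (h.e.apply_symm_apply p)) }
  have hE : ∀ s p, (E s).1 (h.e p) = s.1 p := fun s p => congrArg s.1 (h.e.symm_apply_apply p)
  refine Fintype.sum_equiv E _ _ fun s => ?_
  rw [stateTerm, stateTerm]
  congr 1
  · congr 2
    rw [exponent, exponent, Finset.sum_filter, Finset.sum_filter]
    refine Fintype.sum_equiv h.e _ _ fun p => ?_
    by_cases hp : D.mate p = p
    · rw [if_neg (fun e => e.1 hp), if_neg (fun e => e.1 ((hfix p).2 hp))]
    · simp only [hE, ← h.isOver_eq p hp, ← h.isPos_eq p hp, ne_eq, hfix]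
  · symm
    refine LoopSystem.ev_of_bijective loopWeight (D.loopSystem s) (D'.loopSystem (E s))
      (Prod.map h.e id) (h.e.injective.prodMap Function.injective_id) ?_ ?_ ?_
      (h.e.surjective.prodMap Function.surjective_id)
    · rintro ⟨p, b⟩
      have hn : D'.next.symm (h.e p) = h.e (D.next.symm p) := by
        rw [Equiv.symm_apply_eq, ← h.next_eq, Equiv.apply_symm_apply]
      cases b
      · exact Prod.ext hn rfl
      · exact Prod.ext (h.next_eq p).symm rfl
    · rintro ⟨p, b⟩
      simp only [loopSystem, join, Prod.map_apply, hE, ← h.mate_eq]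
      split_ifs <;> rfl
    · rintro ⟨p, b⟩
      simp only [loopSystem, cuspValue, Prod.map_apply, hE]
      split_ifs with h1 <;> try rfl
      all_goals
        have hp : D.mate p ≠ p := fun hp => by simp [s.2.2 p hp] at h1
        simp_all [fromRight, h.isOver_eq p hp, h.isPos_eq p hp]

/-- Deleting a plain point preserves the state sum. -/
theorem stateSum_unmark {D D' : GaussDiagram} (h : Unmark D D') : D.stateSum = D'.stateSum := by
  classical
  have hr : ∀ q, q ≠ h.m → ∃ p, h.f p = q := by
    intro q hq
    have : q ∈ Set.range h.f := by rw [h.f_range]; exact hq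
    exact this
  have hm : ∀ p, h.f p ≠ h.m := by
    intro p
    have : h.f p ∈ Set.range h.f := ⟨p, rfl⟩
    rw [h.f_range] at this
    exact this
  have hfix : ∀ p, D.mate (h.f p) = h.f p ↔ D'.mate p = p := fun p => by
    rw [← h.mate_eq, h.f_inj.eq_iff]
  obtain ⟨p₀, -⟩ := hr _ h.next_m
  have : Nonempty D'.Pt := ⟨p₀⟩
  choose! g hg using hr
  have gf : ∀ p, g (h.f p) = p := fun p => h.f_inj (hg _ (hm p))
  -- States correspond because a plain point always has the value `false`.
  let E : D.State ≃ D'.State :=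
    { toFun := fun s => ⟨fun p => s.1 (h.f p),
        fun p => (congrArg s.1 (h.mate_eq p)).trans (s.2.1 _),
        fun p hp => s.2.2 _ ((hfix p).2 hp)⟩
      invFun := fun s => ⟨fun q => if q = h.m then false else s.1 (g q), fun q => by
          by_cases hq : q = h.m
          · rw [hq, h.mate_m]
          · obtain ⟨p, rfl⟩ : ∃ p, h.f p = q := ⟨g q, hg q hq⟩
            simp only [← h.mate_eq, if_neg (hm _), gf, s.2.1], fun q hq => by
          by_cases hq' : q = h.m
          · exact if_pos hq'
          · obtain ⟨p, rfl⟩ : ∃ p, h.f p = q := ⟨g q, hg q hq'⟩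
            simp only [if_neg hq', gf]
            exact s.2.2 p ((hfix p).1 hq)⟩
      left_inv := fun s => Subtype.ext (funext fun q => by
          by_cases hq : q = h.m
          · exact (if_pos hq).trans (s.2.2 q (by rw [hq, h.mate_m])).symm
          · exact (if_neg hq).trans (congrArg s.1 (hg q hq)))
      right_inv := fun s => Subtype.ext (funext fun p =>
          (if_neg (hm p)).trans (congrArg s.1 (gf p))) }
  have hE : ∀ s p, (E s).1 p = s.1 (h.f p) := fun s p => rfl
  refine Fintype.sum_equiv E _ _ fun s => ?_
  rw [stateTerm, stateTerm]
  congr 1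
  · congr 2
    rw [exponent, exponent, Finset.sum_filter, Finset.sum_filter]
    symm
    rw [← Finset.sum_subset (Finset.subset_univ (Finset.univ.image h.f)), Finset.sum_image]
    · refine Finset.sum_congr rfl fun p _ => ?_
      by_cases hp : D'.mate p = p
      · rw [if_neg (fun e => e.1 hp), if_neg (fun e => e.1 ((hfix p).2 hp))]
      · simp only [hE, h.isOver_eq p hp, h.isPos_eq p hp, ne_eq, hfix]
    · exact fun _ _ _ _ e => h.f_inj e
    · intro q _ hq
      have : q = h.m := by
        by_contra hc
        exact hq (Finset.mem_image.2 ⟨g q, Finset.mem_univ _, hg q hc⟩)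
      rw [this, if_neg fun e => e.1 h.mate_m]
  · have hsm : s.1 h.m = false := s.2.2 _ h.mate_m
    have hea : (D.loopSystem s).edge (h.m, true) = (D.next h.m, false) := D.edge_true rfl
    have hja : (D.loopSystem s).join (h.m, true) = (h.m, false) := by
      simp [loopSystem, join, hsm, h.mate_m]
    have hne : (D.loopSystem s).join (h.m, true) ≠ (D.loopSystem s).edge (h.m, true) := by
      rw [hea, hja]
      exact fun e => h.next_m (congrArg Prod.fst e).symm
    -- Deleting the plain point amounts to cutting out the edge that leaves it and discarding the
    -- trivial loop, both at the price of one factor d.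
    refine mul_left_cancel₀ loopWeight_zero_ne ?_
    rw [← LoopSystem.ev_excise _ _ _ hne]
    let ψ : D'.Half → D.Half := fun x => (h.f x.1, x.2)
    -- The incoming end at `next m` belongs to the cut edge; the incoming end at `m` takes over its
    -- role.
    let φ : D'.Half → D.Half := fun x =>
      if ψ x = (D.next h.m, false) then (h.m, false) else ψ x
    have hψ : Function.Injective ψ := by
      rintro ⟨p, b⟩ ⟨q, c⟩ e
      have e1 : h.f p = h.f q := congrArg Prod.fst e
      have e2 : b = c := congrArg Prod.snd e
      exact Prod.ext (h.f_inj e1) e2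
    have hψm : ∀ x b, ψ x ≠ (h.m, b) := fun x b e => hm x.1 (congrArg Prod.fst e)
    have hψr : ∀ y : D.Half, y.1 ≠ h.m → ∃ x, ψ x = y := fun y hy =>
      ⟨(g y.1, y.2), Prod.ext (hg _ hy) rfl⟩
    have hψj : ∀ x, D.join s (ψ x) = ψ (D'.join (E s) x) := by
      rintro ⟨p, b⟩
      simp only [join, ψ, hE, ← h.mate_eq]
      split_ifs <;> rfl
    have hψv : ∀ x, D.cuspValue s (ψ x) = D'.cuspValue (E s) x := by
      rintro ⟨p, b⟩
      simp only [cuspValue, ψ, hE]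
      split_ifs with h1 <;> try rfl
      all_goals
        have hp : D'.mate p ≠ p := fun hp => by simp [s.2.2 _ ((hfix p).2 hp)] at h1
        simp_all [fromRight, h.isOver_eq p hp, h.isPos_eq p hp]
    have hjn : D.join s (D.next h.m, false) ≠ (D.next h.m, false) :=
      (D.loopSystem s).join_ne _
    have hj2 := D.join_involutive s
    have hvm : D.cuspValue s (h.m, true) = 0 := by simp [cuspValue, hsm]
    have hvm' : D.cuspValue s (h.m, false) = 0 := by simp [cuspValue, hsm]
    have hnm := h.next_m
    have hmm : ((h.m, false) : D.Half) ≠ (h.m, true) := fun e => Bool.noConfusion (congrArg Prod.snd e)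
    have hmn : ((h.m, false) : D.Half) ≠ (D.next h.m, false) := fun e =>
      hnm (congrArg Prod.fst e).symm
    have hjo : ∀ y, (((D.loopSystem s).excise (h.m, true)).join y) =
        if y = (h.m, true) then (D.next h.m, false) else if y = (D.next h.m, false) then (h.m, true)
        else if y = (h.m, false) then D.join s (D.next h.m, false) else
        if y = D.join s (D.next h.m, false) then (h.m, false) else D.join s y := by
      intro y
      simp only [LoopSystem.excise, hea, hja]
      rfl
    have hva : ∀ y, (((D.loopSystem s).excise (h.m, true)).value y) =
        if y = (h.m, true) then 0 else if y = (D.next h.m, false) then 0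
        else if y = (h.m, false) then
          D.cuspValue s y + D.cuspValue s (D.next h.m, false) else
        if y = D.join s (D.next h.m, false) then D.cuspValue s y + D.cuspValue s (h.m, true)
        else D.cuspValue s y := by
      intro y
      simp only [LoopSystem.excise, hea, hja, hmn, if_false]
      rfl
    refine LoopSystem.ev_of_embedding loopWeight (D'.loopSystem (E s)) _ φ ?_ ?_ ?_ ?_
      (h.m, true) ?_ ?_ ?_
    · intro x y e
      refine hψ ?_
      have h1 := hψm x
      have h2 := hψm y
      simp only [φ] at e
      grind
    · have ht : ∀ p, D.edge (φ (p, true)) = φ (D'.edge (p, true)) := by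
        intro p
        have h1 : φ (p, true) = (h.f p, true) := if_neg fun e => Bool.noConfusion (congrArg Prod.snd e)
        rw [h1, D.edge_true rfl, D'.edge_true rfl]
        have h2 := h.next_eq p
        by_cases hp : D.next (h.f p) = h.m
        · rw [if_pos hp] at h2
          rw [hp]
          have h3 : ψ (D'.next p, false) = (D.next h.m, false) := Prod.ext h2 rfl
          exact (if_pos h3).symm
        · rw [if_neg hp] at h2
          have h3 : ψ (D'.next p, false) = (D.next (h.f p), false) := Prod.ext h2 rfl
          refine (Eq.trans (if_neg ?_) h3).symm
          rw [h3]
          exact fun e => hm p (D.next.injective (congrArg Prod.fst e))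
      have hf : ∀ x, D.edge (φ x) = φ (D'.edge x) := by
        rintro ⟨p, b⟩
        cases b
        · have h1 : D'.edge (D'.next.symm p, true) = (p, false) := D'.edge_true (by simp)
          rw [← h1, ← ht, D.edge_involutive, D'.edge_involutive]
        · exact ht p
      exact hf
    · intro x
      rw [hjo]
      change _ = φ (D'.join (E s) x)
      by_cases h1 : ψ x = (D.next h.m, false)
      · have h2 : φ x = (h.m, false) := if_pos h1
        have h3 : φ (D'.join (E s) x) = ψ (D'.join (E s) x) :=
          if_neg (by rw [← hψj, h1]; exact hjn)
        rw [h2, h3, ← hψj, h1, if_neg hmm, if_neg hmn, if_pos rfl]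
      · have h2 : φ x = ψ x := if_neg h1
        rw [h2, if_neg (hψm _ _), if_neg h1, if_neg (hψm _ _)]
        by_cases h3 : ψ x = D.join s (D.next h.m, false)
        · rw [if_pos h3]
          exact (if_pos (by rw [← hψj, h3, hj2])).symm
        · rw [if_neg h3, hψj]
          exact (if_neg fun e => h3 (by rw [← e, ← hψj, hj2])).symm
    · intro x
      rw [hva]
      change _ = D'.cuspValue (E s) x
      rw [← hψv]
      by_cases h1 : ψ x = (D.next h.m, false)
      · have h2 : φ x = (h.m, false) := if_pos h1
        rw [h2, if_neg hmm, if_neg hmn, if_pos rfl, hvm', zero_add, h1]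
      · have h2 : φ x = ψ x := if_neg h1
        rw [h2, if_neg (hψm _ _), if_neg h1, if_neg (hψm _ _), hvm, add_zero, ite_self]
    · intro y
      rw [show ((D.loopSystem s).excise (h.m, true)).edge (h.m, true) = (D.next h.m, false) from hea]
      constructor
      · intro hy
        by_contra hc
        push Not at hc
        by_cases hy1 : y = (h.m, false)
        · obtain ⟨x, hx⟩ := hψr (D.next h.m, false) hnm
          exact hy ⟨x, (if_pos hx).trans hy1.symm⟩
        · have hy2 : y.1 ≠ h.m := by
            intro e
            obtain ⟨p, b⟩ := y
            cases b
            · exact hy1 (Prod.ext e rfl)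
            · exact hc.1 (Prod.ext e rfl)
          obtain ⟨x, rfl⟩ := hψr y hy2
          exact hy ⟨x, if_neg hc.2⟩
      · rintro hy ⟨x, rfl⟩
        by_cases h1 : ψ x = (D.next h.m, false)
        · have h2 : φ x = (h.m, false) := if_pos h1
          rw [h2] at hy
          exact hy.elim hmm hmn
        · have h2 : φ x = ψ x := if_neg h1
          rw [h2] at hy
          exact hy.elim (hψm _ _) h1
    · rw [hjo, if_pos rfl]
      exact hea.symm
    · rw [hva, if_pos rfl]

/-- A move multiplies the state sum by a unit `± A ^ n`. -/
theorem Move.stateSum_eq {D D' : GaussDiagram} (h : Move D D') :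
    ∃ u : ArrowRingˣ, (∃ n : ℤ, (u : ArrowRing) = (unitA ^ n : ArrowRingˣ) ∨
      (u : ArrowRing) = - (unitA ^ n : ArrowRingˣ)) ∧ D.stateSum = u * D'.stateSum := by
  cases h with
  | iso h => exact ⟨1, ⟨0, Or.inl (by simp)⟩, by rw [stateSum_iso h, Units.val_one, one_mul]⟩
  | unmark h => exact ⟨1, ⟨0, Or.inl (by simp)⟩, by rw [stateSum_unmark h, Units.val_one, one_mul]⟩
  | r1 c hc h =>
    exact ⟨- unitA ^ (if D.isPos c then 3 else -3 : ℤ), ⟨_, Or.inr (Units.val_neg _)⟩, by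
      rw [stateSum_r1 D c hc h, Units.val_neg]⟩
  | r2 c d hc hd oc od hs h h' =>
    exact ⟨1, ⟨0, Or.inl (by simp)⟩, by
      rw [stateSum_r2 D c d hc hd oc od hs h h', Units.val_one, one_mul]⟩
  | r3 x y z t m b hx hy hz ox oy oz hxy hxz hyz ht hm hb s1 s2 =>
    exact ⟨1, ⟨0, Or.inl (by simp)⟩, by
      rw [stateSum_r3 D x y z t m b hx hy hz ox oy oz hxy hxz hyz ht hm hb s1 s2, Units.val_one,
        one_mul]⟩

/-- The factor ± A ^ n is a nonzero constant of the polynomial ring in the variables K, so it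
changes no set of variables. -/
theorem Move.vars_arrowPolynomial {D D' : GaussDiagram} (h : Move D D') (i : ℕ+) :
    i ∈ D.arrowPolynomial.vars ↔ i ∈ D'.arrowPolynomial.vars := by
  obtain ⟨u, ⟨n, hu⟩, h⟩ := h.stateSum_eq
  rw [← mem_vars_stateSum, ← mem_vars_stateSum, h]
  have hT : (LaurentPolynomial.T n : LaurentPolynomial ℤ) ≠ 0 :=
    (LaurentPolynomial.isUnit_T n).ne_zero
  rcases hu with hu | hu
  · rw [hu, unitA_zpow, MvPolynomial.vars_C_mul _ hT]
  · rw [hu, unitA_zpow, ← map_neg, MvPolynomial.vars_C_mul _ (neg_ne_zero.2 hT)]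

end GaussDiagram

/-- If a variable occurs in the arrow polynomial of one diagram of a virtual link, then it occurs in
the arrow polynomial of all of them. -/
theorem VirtualLink.arrowPolynomialContains_mk {D : GaussDiagram} {i : ℕ+}
    (h : i ∈ D.arrowPolynomial.vars) :
    VirtualLink.ArrowPolynomialContains (Quot.mk GaussDiagram.Move D) i := by
  intro D' hD'
  have : ∀ D D' : GaussDiagram, Relation.EqvGen GaussDiagram.Move D D' →
      (i ∈ D.arrowPolynomial.vars ↔ i ∈ D'.arrowPolynomial.vars) := by
    intro D D' h
    induction h with
    | rel _ _ h => exact h.vars_arrowPolynomial i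
    | refl => rfl
    | symm _ _ _ ih => exact ih.symm
    | trans _ _ _ _ _ ih1 ih2 => exact ih1.trans ih2
  exact (this _ _ (Quot.eqvGen_exact hD')).2 h

/-! ### Diagrams of genus zero: index functions and vanishing arrow numbers. -/

namespace GaussDiagram

variable (D : GaussDiagram)

theorem rot_bijective : Function.Bijective D.rot := by
  rw [← Finite.injective_iff_bijective]
  rintro ⟨p, b⟩ ⟨q, c⟩ h
  have h1 := D.mate_mate p
  have h2 := D.mate_mate q
  have h3 := D.fromRight_mate p
  have h4 := D.fromRight_mate q
  simp only [rot] at h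
  split_ifs at h <;> simp only [Prod.mk.injEq] at h <;> grind

theorem mk_rot_fst (h : D.Half) :
    Quot.mk (fun p q : D.Pt => q = D.mate p) (D.rot h).1 = Quot.mk _ h.1 := by
  unfold rot
  split_ifs
  · rfl
  · exact (Quot.sound (r := fun p q : D.Pt => q = D.mate p) rfl).symm
  · exact (Quot.sound (r := fun p q : D.Pt => q = D.mate p) rfl).symm

/-- The sign of a half-edge: `1` if it leaves its point and `-1` if it arrives there. -/
def halfSign (h : D.Half) : ℚ := if h.2 then 1 else -1

/-- The value of a cusp is the jump of an index function of the complementary regions. -/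
theorem cuspValue_eq_of_index (s : D.State) (F : D.Half → ℚ)
    (hrot : ∀ h, F (D.rot (D.edge h)) = F h) (hedge : ∀ h, F (D.edge h) = F h - D.halfSign h)
    (h : D.Half) : (D.cuspValue s h : ℚ) =
      (F (D.join s h) - D.halfSign (D.join s h) / 2) - (F h - D.halfSign h / 2) := by
  -- Turning past a half-edge around its vertex changes the index as crossing its edge does.
  have hr : ∀ k, F (D.rot k) = F k - D.halfSign k := fun k => by
    rw [← hedge, ← hrot (D.edge k), D.edge_involutive]
  obtain ⟨p, b⟩ := h
  have h1 := hr (p, b)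
  have h2 := hr (D.join s (p, b))
  have h3 := D.fromRight_mate p
  have h4 := D.mate_mate p
  have h5 := s.2.2 p
  by_cases hp : D.mate p = p
  · have h6 := h5 hp
    simp only [rot, join, cuspValue, halfSign, hp, h6] at h1 h2 ⊢
    cases b <;> simp at h1 ⊢ <;> linarith
  · have h7 : ¬ p = D.mate p := fun e => hp e.symm
    have h6 := h3 hp
    cases hs : s.1 p <;> cases hf : D.fromRight p <;> cases b <;>
      simp [rot, join, cuspValue, halfSign, hp, h7, hs, hf, h4, h6] at h1 h2 ⊢ <;> linarith

/-- The mean `g` of the indices on the two sides of a strand is constant along edges and jumps by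
the cusp value at a turn. Its total change around a closed loop is zero. -/
theorem cuspSum_eq_zero_of_index (s : D.State) (F : D.Half → ℚ)
    (hrot : ∀ h, F (D.rot (D.edge h)) = F h) (hedge : ∀ h, F (D.edge h) = F h - D.halfSign h)
    (h : D.Half) : D.cuspSum s h = 0 := by
  classical
  let g : D.Half → ℚ := fun h => F h - D.halfSign h / 2
  have hg : ∀ k, g (D.edge k) = g k := by
    rintro ⟨p, b⟩
    simp only [g, hedge]
    cases b <;> simp [halfSign, edge] <;> ring
  have key : (D.cuspSum s h : ℚ) = 0 := by
    rw [cuspSum, Int.cast_sum]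
    have : ∀ k, (D.cuspValue s (D.edge k) : ℚ) = g (D.step s k) - g k := fun k => by
      rw [D.cuspValue_eq_of_index s F hrot hedge, ← hg k]
      rfl
    simp only [this, Finset.sum_sub_distrib, sub_eq_zero]
    refine Finset.sum_equiv (D.step s) ?_ fun _ _ => rfl
    intro k
    simp [Equiv.Perm.sameCycle_apply_right]
  exact_mod_cast key

section Planar

/-- The vertices of the underlying graph of the diagram. -/
abbrev Vertex : Type := Quot fun p q : D.Pt => q = D.mate p

noncomputable instance : Fintype D.Vertex := Fintype.ofFinite _

noncomputable instance : Fintype D.Boundary :=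
  @Fintype.ofFinite _ (inferInstanceAs (Finite (Quot _)))

noncomputable instance : DecidableEq D.Vertex := Classical.decEq _

/-- The coboundary of a function on the vertices. -/
def vertexCoboundary : (D.Vertex → ℚ) →ₗ[ℚ] (D.Pt → ℚ) where
  toFun u p := u (Quot.mk _ (D.next p)) - u (Quot.mk _ p)
  map_add' u v := by
    ext p
    simp only [Pi.add_apply]
    ring
  map_smul' c u := by
    ext p
    simp only [Pi.smul_apply, smul_eq_mul, RingHom.id_apply]
    ring

/-- The flows on the edges: functions orthogonal to all coboundaries. -/
noncomputable def flows : Submodule ℚ (D.Pt → ℚ) :=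
  LinearMap.ker (LinearMap.toMatrix' D.vertexCoboundary).transpose.mulVecLin

theorem mem_flows {w : D.Pt → ℚ} (hw : ∀ u, ∑ p, w p * D.vertexCoboundary u p = 0) :
    w ∈ D.flows := by
  rw [flows, LinearMap.mem_ker]
  ext v
  simp only [Matrix.mulVecLin_apply, Matrix.mulVec, dotProduct, Matrix.transpose_apply,
    LinearMap.toMatrix'_apply, Pi.zero_apply]
  rw [← hw (Pi.single v 1)]
  refine Finset.sum_congr rfl fun p _ => ?_
  rw [mul_comm]

/-- Rank-nullity for the coboundary and its transpose, which have the same rank. -/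
theorem finrank_flows : Module.finrank ℚ D.flows + Fintype.card D.Vertex =
    Fintype.card D.Pt + Module.finrank ℚ (LinearMap.ker D.vertexCoboundary) := by
  have h1 := LinearMap.finrank_range_add_finrank_ker
    (LinearMap.toMatrix' D.vertexCoboundary).transpose.mulVecLin
  have h2 := LinearMap.finrank_range_add_finrank_ker D.vertexCoboundary
  have h3 := Matrix.rank_transpose (LinearMap.toMatrix' D.vertexCoboundary)
  have h4 : (LinearMap.toMatrix' D.vertexCoboundary).rank =
      Module.finrank ℚ (LinearMap.range D.vertexCoboundary) := by
    rw [Matrix.rank, ← Matrix.toLin'_apply', Matrix.toLin'_toMatrix']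
  rw [Matrix.rank] at h3
  rw [Module.finrank_fintype_fun_eq_card] at h1 h2
  rw [flows]
  omega

/-- Every point has one edge arriving and one leaving, as `next` is a permutation. -/
theorem one_mem_flows : (fun _ => 1 : D.Pt → ℚ) ∈ D.flows := by
  refine D.mem_flows fun u => ?_
  simp only [one_mul, vertexCoboundary, LinearMap.coe_mk, AddHom.coe_mk, Finset.sum_sub_distrib,
    sub_eq_zero]
  exact Equiv.sum_comp D.next fun p => u (Quot.mk _ p)

variable {D} (S : D.SurfaceRep)

/-- The function on half-edges that reads off the value of the adjacent region. -/
def SurfaceRep.pull (f : S.Region → ℚ) (h : D.Half) : ℚ := f (S.region (Quot.mk _ h))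

theorem SurfaceRep.pull_rot_edge (f : S.Region → ℚ) (h : D.Half) :
    S.pull f (D.rot (D.edge h)) = S.pull f h :=
  congrArg (fun c => f (S.region c))
    (Quot.sound (r := fun h k : D.Half => k = D.rot (D.edge h)) rfl).symm

/-- The jump across the edges of a function on the regions. -/
def SurfaceRep.regionCoboundary : (S.Region → ℚ) →ₗ[ℚ] (D.Pt → ℚ) where
  toFun f p := S.pull f (p, true) - S.pull f (D.edge (p, true))
  map_add' u v := by
    ext p
    simp only [pull, Pi.add_apply]
    ring
  map_smul' c u := by
    ext p
    simp only [pull, Pi.smul_apply, smul_eq_mul, RingHom.id_apply]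
    ring

theorem sum_half (G : D.Half → ℚ) :
    ∑ h, G h = ∑ p, (G (p, true) + G (D.edge (p, true))) := by
  rw [Fintype.sum_prod_type, Finset.sum_add_distrib]
  simp only [Fintype.sum_bool, Finset.sum_add_distrib]
  congr 1
  exact (Equiv.sum_comp D.next fun p => G (p, false)).symm

/-- Around a vertex, the jumps of a function on the regions cancel. Summation over the half-edges
expresses this: region values are constant along boundary circles, vertex values under rotation, and
the two sums agree after reindexing. -/
theorem SurfaceRep.regionCoboundary_mem_flows (f : S.Region → ℚ) :
    S.regionCoboundary f ∈ D.flows := by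
  refine D.mem_flows fun u => ?_
  let U : D.Half → ℚ := fun h => u (Quot.mk _ h.1)
  have h1 : ∑ p, S.regionCoboundary f p * D.vertexCoboundary u p =
      ∑ h, S.pull f h * (U (D.edge h) - U h) := by
    rw [sum_half]
    refine Finset.sum_congr rfl fun p _ => ?_
    change (S.pull f (p, true) - S.pull f (D.edge (p, true))) *
      (U (D.edge (p, true)) - U (p, true)) = _
    rw [D.edge_involutive]
    ring
  have h2 : ∑ h, S.pull f h * U (D.edge h) = ∑ h, S.pull f h * U h := by
    rw [← (Equiv.ofBijective _ D.rot_bijective).sum_comp fun h => S.pull f h * U h,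
      ← Equiv.sum_comp D.edge_involutive.toPerm fun h => S.pull f h * U (D.edge h)]
    refine Finset.sum_congr rfl fun h _ => ?_
    have h3 := S.pull_rot_edge f (D.edge h)
    rw [D.edge_involutive] at h3
    have h4 : U (D.rot h) = U h := congrArg u (D.mk_rot_fst h)
    simp only [Function.Involutive.coe_toPerm, Equiv.ofBijective_apply]
    rw [h3, h4, D.edge_involutive]
  rw [h1]
  simp only [mul_sub, Finset.sum_sub_distrib, h2, sub_self]

/-- Compatible functions on half-edges and regions are constant, since the surface is connected. -/
theorem SurfaceRep.eq_of_compatible (F : D.Half → ℚ) (f : S.Region → ℚ)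
    (he : ∀ h, F (D.edge h) = F h) (hr : ∀ h, F (D.rot h) = F h)
    (hf : ∀ h, f (S.region (Quot.mk _ h)) = F h) :
    (∀ r r', f r = f r') ∧ ∀ h r, F h = f r := by
  have key : ∀ u v : D.Half ⊕ S.Region, Sum.elim F f u = Sum.elim F f v := by
    intro u v
    have h := S.connected u v
    induction h with
    | rel _ _ h =>
      obtain ⟨h, rfl, rfl | rfl | rfl⟩ := h
      · exact (he h).symm
      · exact (hr h).symm
      · exact (hf h).symm
    | refl => rfl
    | symm _ _ _ ih => exact ih.symm
    | trans _ _ _ _ _ ih1 ih2 => exact ih1.trans ih2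
  exact ⟨fun r r' => key (.inr r) (.inr r'), fun h r => key (.inl h) (.inr r)⟩

/-- A function without jumps is constant because the surface is connected, so the kernel has
dimension at most one. -/
theorem SurfaceRep.card_region_le :
    Fintype.card S.Region ≤ Module.finrank ℚ (LinearMap.range S.regionCoboundary) + 1 := by
  have h1 := LinearMap.finrank_range_add_finrank_ker S.regionCoboundary
  rw [Module.finrank_fintype_fun_eq_card] at h1
  obtain ⟨r₀⟩ := S.nonempty
  have h2 : Module.finrank ℚ (LinearMap.ker S.regionCoboundary) ≤ 1 := by
    have hinj : Function.Injective
        ((LinearMap.proj r₀ : (S.Region → ℚ) →ₗ[ℚ] ℚ) ∘ₗ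
          (LinearMap.ker S.regionCoboundary).subtype) := by
      rw [← LinearMap.ker_eq_bot, LinearMap.ker_eq_bot']
      rintro ⟨f, hf⟩ h0
      have hf' : ∀ p, S.pull f (D.edge (p, true)) = S.pull f (p, true) := fun p =>
        (sub_eq_zero.1 (congrFun (LinearMap.mem_ker.1 hf) p)).symm
      have he : ∀ h, S.pull f (D.edge h) = S.pull f h := by
        rintro ⟨p, b⟩
        cases b
        · have h3 : D.edge (D.next.symm p, true) = (p, false) := by simp [edge]
          rw [← h3, D.edge_involutive, hf']
        · exact hf' p
      have hr : ∀ h, S.pull f (D.rot h) = S.pull f h := fun h => by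
        rw [← he h, ← S.pull_rot_edge f (D.edge h), D.edge_involutive]
      have h4 := S.eq_of_compatible (S.pull f) f he hr fun _ => rfl
      refine Subtype.ext (funext fun r => ?_)
      exact (h4.1 r r₀).trans h0
    have := LinearMap.finrank_le_finrank_of_injective hinj
    rwa [Module.finrank_self] at this
  omega

/-- The components of the diagram and the regions are the nodes of a connected graph whose edges are
the boundary circles, so there are at most one more nodes than circles. This covers disconnected
diagrams, whose regions need not be discs. -/
theorem SurfaceRep.finrank_ker_vertexCoboundary_le :
    Module.finrank ℚ (LinearMap.ker D.vertexCoboundary) + Fintype.card S.Region ≤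
      Fintype.card D.Boundary + 1 := by
  let T : (D.Vertex → ℚ) × (S.Region → ℚ) →ₗ[ℚ] (D.Boundary → ℚ) :=
    -- The chosen half-edge of a boundary circle is immaterial on the kernel of `vertexCoboundary`,
    -- whose members are constant along the circle.
    { toFun := fun x c => x.1 (Quot.mk _ (Quot.out c).1) - x.2 (S.region c)
      map_add' := fun x y => by
        ext c
        simp only [Prod.fst_add, Prod.snd_add, Pi.add_apply]
        ring
      map_smul' := fun a x => by
        ext c
        simp only [Prod.smul_fst, Prod.smul_snd, Pi.smul_apply, smul_eq_mul, RingHom.id_apply]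
        ring }
  obtain ⟨r₀⟩ := S.nonempty
  let T' : LinearMap.ker D.vertexCoboundary × (S.Region → ℚ) →ₗ[ℚ] (D.Boundary → ℚ) × ℚ :=
    (T ∘ₗ (LinearMap.prodMap (LinearMap.ker D.vertexCoboundary).subtype LinearMap.id)).prod
      (LinearMap.proj r₀ ∘ₗ LinearMap.snd ℚ _ _)
  have hinj : Function.Injective T' := by
    rw [← LinearMap.ker_eq_bot, LinearMap.ker_eq_bot']
    rintro ⟨⟨u, hu⟩, f⟩ h0
    let U : D.Half → ℚ := fun h => u (Quot.mk _ h.1)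
    have hp : ∀ p, U (D.edge (p, true)) = U (p, true) := fun p =>
      sub_eq_zero.1 (congrFun (LinearMap.mem_ker.1 hu) p)
    have he : ∀ h, U (D.edge h) = U h := by
      rintro ⟨p, b⟩
      cases b
      · have h3 : D.edge (D.next.symm p, true) = (p, false) := by simp [edge]
        rw [← h3, D.edge_involutive, hp]
      · exact hp p
    have hr : ∀ h, U (D.rot h) = U h := fun h => congrArg u (D.mk_rot_fst h)
    have hout : ∀ h k : D.Half, Relation.EqvGen (fun h k : D.Half => k = D.rot (D.edge h)) h k →
        U h = U k := by
      intro h k hk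
      induction hk with
      | rel h k hk => rw [hk, hr, he]
      | refl => rfl
      | symm _ _ _ ih => exact ih.symm
      | trans _ _ _ _ _ ih1 ih2 => exact ih1.trans ih2
    have hf : ∀ h, f (S.region (Quot.mk _ h)) = U h := by
      intro h
      have h1 : U (Quot.out (Quot.mk (fun h k : D.Half => k = D.rot (D.edge h)) h)) = U h :=
        hout _ _ (Quot.eqvGen_exact (Quot.out_eq _))
      rw [← h1]
      exact (sub_eq_zero.1 (congrFun (congrArg Prod.fst h0) (Quot.mk _ h))).symm
    have h4 := S.eq_of_compatible U f he hr hf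
    have h5 : f r₀ = 0 := congrArg Prod.snd h0
    refine Prod.ext (Subtype.ext (funext ?_)) (funext fun r => (h4.1 r r₀).trans h5)
    rintro ⟨p⟩
    exact (h4.2 (p, true) r₀).trans h5
  have := LinearMap.finrank_le_finrank_of_injective hinj
  rwa [Module.finrank_prod, Module.finrank_prod, Module.finrank_fintype_fun_eq_card,
    Module.finrank_fintype_fun_eq_card, Module.finrank_self] at this

/-- Every boundary circle belongs to exactly one region, so the counts over the regions add up to
the number of circles. -/
theorem SurfaceRep.eulerChar_eq : S.eulerChar = Fintype.card D.Vertex - Fintype.card D.Pt +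
    2 * Fintype.card S.Region - Fintype.card D.Boundary - 2 * ∑ r, (S.regionGenus r : ℤ) := by
  classical
  have h : ∑ r, Nat.card {c : D.Boundary // S.region c = r} = Fintype.card D.Boundary := by
    rw [← Fintype.card_congr (Equiv.sigmaFiberEquiv S.region), Fintype.card_sigma]
    exact Finset.sum_congr rfl fun r _ => Nat.card_eq_fintype_card
  rw [eulerChar, ← h, Nat.card_eq_fintype_card]
  simp only [Finset.sum_sub_distrib, Finset.sum_const, Finset.card_univ, ← Finset.mul_sum]
  push_cast
  ring

/-- On a sphere, the constant function `1` on the edges is the jump of a function on the regions. -/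
theorem SurfaceRep.exists_index (h0 : S.HasGenus 0) :
    ∃ f, S.regionCoboundary f = fun _ => 1 := by
  have h1 := S.card_region_le
  have h2 := S.finrank_ker_vertexCoboundary_le
  have h3 := D.finrank_flows
  have h4 := S.eulerChar_eq
  rw [HasGenus] at h0
  have h5 : 0 ≤ ∑ r, (S.regionGenus r : ℤ) := Finset.sum_nonneg fun r _ => Int.natCast_nonneg _
  have h6 : LinearMap.range S.regionCoboundary ≤ D.flows := by
    rintro _ ⟨f, rfl⟩
    exact S.regionCoboundary_mem_flows f
  -- With V vertices, E edges, B boundary circles, R regions and k the dimension of the kernel of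
  -- `vertexCoboundary`, the flows have dimension E - V + k ≤ E - V + B + 1 - R. Euler
  -- characteristic 2 bounds this by R - 1, which is at most the rank of `regionCoboundary`.
  have h7 : LinearMap.range S.regionCoboundary = D.flows := by
    refine Submodule.eq_of_le_of_finrank_le h6 ?_
    push_cast at h0
    omega
  have h8 := D.one_mem_flows
  rw [← h7] at h8
  exact h8

/-- All cusps of the states of a planar diagram cancel. -/
theorem SurfaceRep.cuspSum_eq_zero (h0 : S.HasGenus 0) (s : D.State) (h : D.Half) :
    D.cuspSum s h = 0 := by
  obtain ⟨f, hf⟩ := S.exists_index h0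
  have hp : ∀ p, S.pull f (p, true) - S.pull f (D.edge (p, true)) = 1 := congrFun hf
  refine D.cuspSum_eq_zero_of_index s (S.pull f) (S.pull_rot_edge f) ?_ h
  rintro ⟨p, b⟩
  cases b
  · have h3 : D.edge (D.next.symm p, true) = (p, false) := by simp [edge]
    have h4 := hp (D.next.symm p)
    rw [← h3, D.edge_involutive, h3]
    rw [h3] at h4
    simp only [halfSign]
    norm_num
    linarith
  · have h4 := hp p
    simp only [halfSign, if_true]
    linarith

/-- No variable occurs in the arrow polynomial of a planar diagram. -/
theorem SurfaceRep.vars_arrowPolynomial (h0 : S.HasGenus 0) : D.arrowPolynomial.vars = ∅ := by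
  have h1 : ∀ (s : D.State) (C : D.Loop s), D.arrowNumber s C = 0 := by
    rintro s ⟨h⟩
    change (D.cuspSum s h).natAbs / 2 = 0
    rw [S.cuspSum_eq_zero h0]
    rfl
  have h2 : K 0 = 1 := by simp [K]
  rw [arrowPolynomial]
  simp only [h1, h2, Finset.prod_const_one, mul_one, ← map_sum]
  exact MvPolynomial.vars_C

end Planar

end GaussDiagram

/-! ### Detecting a variable through the states with a single loop. -/

namespace GaussDiagram

section SingleLoop

variable (D : GaussDiagram) (s : D.State)

theorem not_sameCycle_step_edge (h : D.Half) : ¬ (D.step s).SameCycle h (D.edge h) :=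
  (D.loopSystem s).not_sameCycle_edge h

/-- A loop meets at most as many cusps as there are disoriented points. -/
theorem natAbs_cuspSum_le (h : D.Half) :
    (D.cuspSum s h).natAbs ≤ (Finset.univ.filter fun p => s.1 p = true).card := by
  classical
  -- `A` collects the arrivals at cusps along one traversal, and `σ` sends an arrival to that of the
  -- same cusp in the reversed traversal. The two directions use different half-edges, and a
  -- disoriented point has only two, so `2 * A.card` is at most twice the number of such points.
  let A : Finset D.Half := Finset.univ.filter fun k =>
    (D.step s).SameCycle h k ∧ s.1 (D.edge k).1 = true
  let σ : D.Half → D.Half := fun k => D.edge (D.step s k)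
  have hσe : ∀ k, D.edge (σ k) = D.step s k := fun k => D.edge_involutive _
  have hσ : Function.Injective σ := D.edge_involutive.injective.comp (D.step s).injective
  have hjs : ∀ k, s.1 (D.join s k).1 = s.1 k.1 := by
    intro k
    have := s.2.1 k.1
    simp only [join]
    split_ifs <;> exact this
  have h1 : (D.cuspSum s h).natAbs ≤ A.card := by
    have h2 : D.cuspSum s h = ∑ k ∈ A, D.cuspValue s (D.edge k) := by
      rw [cuspSum]
      refine (Finset.sum_subset ?_ ?_).symm
      · exact fun k hk => by simp only [A, Finset.mem_filter] at hk ⊢; exact ⟨hk.1, hk.2.1⟩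
      · intro k hk hk'
        simp only [A, Finset.mem_filter] at hk hk'
        have h3 : s.1 (D.edge k).1 = false := by
          by_contra hc
          exact hk' ⟨hk.1, hk.2, by simpa using hc⟩
        simp [cuspValue, h3]
    rw [h2]
    refine (Int.natAbs_sum_le _ _).trans ?_
    rw [Finset.card_eq_sum_ones]
    refine Finset.sum_le_sum fun k _ => ?_
    simp only [cuspValue]
    split_ifs <;> simp
  have h2 : Disjoint A (A.image σ) := by
    rw [Finset.disjoint_left]
    rintro k hk hk'
    obtain ⟨l, hl, rfl⟩ := Finset.mem_image.1 hk'
    simp only [A, Finset.mem_filter, Finset.mem_univ, true_and] at hk hl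
    refine D.not_sameCycle_step_edge s (D.step s l) ?_
    exact (Equiv.Perm.sameCycle_apply_left.2 hl.1.symm).trans hk.1
  have h3 : (A ∪ A.image σ).image D.edge ⊆
      (Finset.univ.filter fun p => s.1 p = true) ×ˢ (Finset.univ : Finset Bool) := by
    intro k hk
    simp only [Finset.mem_product, Finset.mem_filter, Finset.mem_univ, true_and, and_true]
    obtain ⟨l, hl, rfl⟩ := Finset.mem_image.1 hk
    rcases Finset.mem_union.1 hl with hl | hl
    · simp only [A, Finset.mem_filter] at hl
      exact hl.2.2
    · obtain ⟨m, hm, rfl⟩ := Finset.mem_image.1 hl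
      simp only [A, Finset.mem_filter] at hm
      rw [hσe, step_apply, hjs]
      exact hm.2.2
  have h4 := Finset.card_le_card h3
  rw [Finset.card_image_of_injective _ D.edge_involutive.injective, Finset.card_union_of_disjoint h2,
    Finset.card_image_of_injective _ hσ, Finset.card_product, Finset.card_univ,
    Fintype.card_bool] at h4
  omega

/-- If some cycle of half-edges contains at least one half of every edge, then the state has a single
loop, and the sum of its cusps can be computed along these half-edges. -/
theorem single_loop_of_cycle (h₀ : D.Half) (o : D.Half → Prop) [DecidablePred o]
    (h1 : ∀ k, o k → (D.step s).SameCycle h₀ k) (h2 : ∀ k, o k ∨ o (D.edge k)) :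
    Fintype.card (D.Loop s) = 1 ∧
      ∀ C, D.arrowNumber s C = (∑ k with o k, D.cuspValue s (D.edge k)).natAbs / 2 := by
  classical
  have h3 : ∀ k, (D.loopSystem s).loopOf k = (D.loopSystem s).loopOf h₀ := by
    have h4 : ∀ k, o k → (D.loopSystem s).loopOf k = (D.loopSystem s).loopOf h₀ := by
      intro k hk
      obtain ⟨n, rfl⟩ := h1 k hk
      exact (D.loopSystem s).loopOf_step_zpow n h₀
    intro k
    rcases h2 k with hk | hk
    · exact h4 k hk
    · rw [← h4 _ hk]
      exact ((D.loopSystem s).loopOf_edge k).symm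
  have h5 : ∀ C : D.Loop s, C = (D.loopSystem s).loopOf h₀ := by
    intro C
    obtain ⟨k, rfl⟩ := (D.loopSystem s).exists_loopOf C
    exact h3 k
  refine ⟨Fintype.card_eq_one_iff.2 ⟨_, h5⟩, fun C => ?_⟩
  rw [h5 C]
  change (D.cuspSum s h₀).natAbs / 2 = _
  congr 2
  refine Finset.sum_congr (Finset.filter_congr fun k _ => ⟨fun hk => ?_, h1 k⟩) fun _ _ => rfl
  -- A cycle never contains both halves of an edge; hence `o` describes the cycle exactly.
  refine (h2 k).resolve_right fun hc => D.not_sameCycle_step_edge s k ?_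
  exact hk.symm.trans (h1 _ hc)

end SingleLoop

/-- At a zero of `d = -A² - A⁻²`, only the states with a single loop contribute. -/
theorem mem_vars_of_single_loop (D : GaussDiagram) [Nonempty D.Pt] (i : ℕ+) (e : ℤ)
    (h1 : ∀ s : D.State, Fintype.card (D.Loop s) = 1 → (∀ C, D.arrowNumber s C = i) →
      D.exponent s = e)
    (h2 : ∃ s : D.State, Fintype.card (D.Loop s) = 1 ∧ ∀ C, D.arrowNumber s C = i) :
    i ∈ D.arrowPolynomial.vars := by
  classical
  -- d = -A⁻² (A⁴ + 1) vanishes at a root of A⁴ = -1.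
  obtain ⟨ζ, hζ⟩ := IsAlgClosed.exists_pow_nat_eq (-1 : ℂ) (n := 4) (by norm_num)
  have hζ0 : ζ ≠ 0 := by
    rintro rfl
    norm_num at hζ
  let Φ : LaurentPolynomial ℤ →+* ℂ := LaurentPolynomial.eval₂ (Int.castRingHom ℂ) (Units.mk0 ζ hζ0)
  have hT : ∀ n, Φ (LaurentPolynomial.T n) = ζ ^ n := fun n => by
    simp only [Φ, LaurentPolynomial.eval₂_T, Units.val_zpow_eq_zpow_val, Units.val_mk0]
  have hd : Φ loopValue = 0 := by
    rw [loopValue, map_sub, map_neg, hT, hT]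
    have h3 : ζ ^ (2 : ℤ) * (- ζ ^ (2 : ℤ) - ζ ^ (-2 : ℤ)) = 0 := by
      rw [mul_sub, mul_neg, ← zpow_add₀ hζ0, ← zpow_add₀ hζ0]
      have h4 : ζ ^ (2 + 2 : ℤ) = -1 := by
        rw [← hζ, ← zpow_natCast ζ 4]
        norm_num
      rw [h4]
      norm_num
    exact (mul_eq_zero.1 h3).resolve_left (zpow_ne_zero _ hζ0)
  have hK : ∀ n, MvPolynomial.coeff (Finsupp.single i 1) (MvPolynomial.map Φ (K n)) =
      if n = i then 1 else 0 := by
    intro n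
    by_cases hn : 0 < n
    · obtain ⟨m, rfl⟩ : ∃ m : ℕ+, (m : ℕ) = n := ⟨⟨n, hn⟩, rfl⟩
      have hm : K m = MvPolynomial.X m := dif_pos m.pos
      rw [hm, MvPolynomial.map_X, MvPolynomial.coeff_X]
      refine if_congr ?_ rfl rfl
      rw [Finsupp.single_left_inj one_ne_zero, PNat.coe_inj]
    · have h3 : n ≠ i := by
        have := i.pos
        omega
      rw [K, dif_neg hn, map_one, MvPolynomial.coeff_one, if_neg h3, if_neg]
      intro h4
      have := DFunLike.congr_fun h4 i
      simp at this
  have hterm : ∀ s : D.State, MvPolynomial.coeff (Finsupp.single i 1) (MvPolynomial.map Φ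
      (MvPolynomial.C (LaurentPolynomial.T (D.exponent s) *
        loopValue ^ (Fintype.card (D.Loop s) - 1)) * ∏ C : D.Loop s, K (D.arrowNumber s C))) =
      if Fintype.card (D.Loop s) = 1 ∧ ∀ C, D.arrowNumber s C = i then ζ ^ e else 0 := by
    intro s
    rw [map_mul, MvPolynomial.map_C, MvPolynomial.coeff_C_mul, map_mul, map_pow, hd, hT]
    by_cases hc : Fintype.card (D.Loop s) = 1
    · obtain ⟨C₀, hC₀⟩ := Fintype.card_eq_one_iff.1 hc
      have hu : (Finset.univ : Finset (D.Loop s)) = {C₀} := by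
        ext C
        simp [hC₀ C]
      rw [hc, hu, Finset.prod_singleton, hK]
      by_cases ha : D.arrowNumber s C₀ = i
      · have ha' : ∀ C, D.arrowNumber s C = i := fun C => by rw [hC₀ C, ha]
        rw [if_pos ha, if_pos ⟨rfl, ha'⟩, h1 s hc ha']
        simp
      · rw [if_neg ha, if_neg fun h => ha (h.2 C₀), mul_zero]
    · obtain ⟨p⟩ := ‹Nonempty D.Pt›
      have : Nonempty (D.Loop s) := ⟨Quot.mk _ (p, true)⟩
      have hpos : Fintype.card (D.Loop s) ≠ 0 := Fintype.card_ne_zero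
      rw [if_neg fun h => hc h.1, zero_pow (by omega), mul_zero, zero_mul]
  by_contra hi
  have h3 : MvPolynomial.coeff (Finsupp.single i 1) D.arrowPolynomial = 0 := by
    by_contra h4
    exact hi ((MvPolynomial.mem_vars_iff_mem_support i).2
      ⟨_, MvPolynomial.mem_support_iff.2 h4, by simp⟩)
  have h4 : MvPolynomial.coeff (Finsupp.single i 1) (MvPolynomial.map Φ D.arrowPolynomial) = 0 := by
    rw [MvPolynomial.coeff_map, h3, map_zero]
  -- After specialisation the coefficient of K_i is ζ ^ e times the number of contributing states.
  -- The common exponent prevents cancellation.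
  rw [arrowPolynomial, map_sum, MvPolynomial.coeff_sum, Finset.sum_congr rfl fun s _ => hterm s,
    ← Finset.sum_filter, Finset.sum_const, nsmul_eq_mul, mul_eq_zero, Nat.cast_eq_zero,
    Finset.card_eq_zero] at h4
  rcases h4 with h4 | h4
  · obtain ⟨s, hs⟩ := h2
    have : s ∈ (∅ : Finset D.State) := by
      rw [← h4]
      exact Finset.mem_filter.2 ⟨Finset.mem_univ _, hs⟩
    simp at this
  · exact zpow_ne_zero _ hζ0 h4

/-! ### Surfaces glued from discs, and minimal genus one. -/

theorem rot_of_crossing (D : GaussDiagram) {h : D.Half} (hp : D.mate h.1 ≠ h.1) :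
    D.rot h = (D.mate h.1, h.2 ^^ !D.fromRight h.1) := by
  rw [rot, if_neg hp]
  cases D.fromRight h.1 <;> simp

/-- The surface obtained by gluing a disc to every boundary circle. -/
noncomputable def discRep (D : GaussDiagram) [Nonempty D.Pt]
    (hc : ∀ h k : D.Half, Quot.mk (fun h k => k = D.edge h ∨ k = D.rot h) h = Quot.mk _ k) :
    D.SurfaceRep where
  Region := D.Boundary
  fintypeRegion := inferInstance
  region := id
  regionGenus _ := 0
  nonempty := by
    obtain ⟨p⟩ := ‹Nonempty D.Pt›
    exact ⟨Quot.mk _ (p, true)⟩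
  connected := by
    have h1 : ∀ h k : D.Half, Relation.EqvGen (fun u v : D.Half ⊕ D.Boundary =>
        ∃ h : D.Half, u = Sum.inl h ∧ (v = Sum.inl (D.edge h) ∨ v = Sum.inl (D.rot h) ∨
          v = Sum.inr (id (Quot.mk _ h)))) (Sum.inl h) (Sum.inl k) := by
      intro h k
      induction Quot.eqvGen_exact (hc h k) with
      | rel h k hk =>
        refine .rel _ _ ⟨h, rfl, ?_⟩
        rcases hk with rfl | rfl
        · exact Or.inl rfl
        · exact Or.inr (Or.inl rfl)
      | refl => exact .refl _
      | symm _ _ _ ih => exact .symm _ _ ih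
      | trans _ _ _ _ _ ih1 ih2 => exact .trans _ _ _ ih1 ih2
    have h2 : ∀ h : D.Half, Relation.EqvGen (fun u v : D.Half ⊕ D.Boundary =>
        ∃ h : D.Half, u = Sum.inl h ∧ (v = Sum.inl (D.edge h) ∨ v = Sum.inl (D.rot h) ∨
          v = Sum.inr (id (Quot.mk _ h)))) (Sum.inl h) (Sum.inr (Quot.mk _ h)) :=
      fun h => .rel _ _ ⟨h, rfl, Or.inr (Or.inr rfl)⟩
    have h3 : ∀ u : D.Half ⊕ D.Boundary, ∃ k : D.Half, Relation.EqvGen (fun u v =>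
        ∃ h : D.Half, u = Sum.inl h ∧ (v = Sum.inl (D.edge h) ∨ v = Sum.inl (D.rot h) ∨
          v = Sum.inr (id (Quot.mk _ h)))) (Sum.inl k) u := by
      rintro (h | c)
      · exact ⟨h, .refl _⟩
      · obtain ⟨h, rfl⟩ := Quot.exists_rep c
        exact ⟨h, h2 h⟩
    intro u v
    obtain ⟨h, hu⟩ := h3 u
    obtain ⟨k, hv⟩ := h3 v
    exact .trans _ _ _ (.symm _ _ hu) (.trans _ _ _ (h1 h k) hv)

theorem discRep_eulerChar (D : GaussDiagram) [Nonempty D.Pt]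
    (hc : ∀ h k : D.Half, Quot.mk (fun h k => k = D.edge h ∨ k = D.rot h) h = Quot.mk _ k) :
    (D.discRep hc).eulerChar =
      Nat.card D.Vertex - Nat.card D.Pt + Nat.card D.Boundary := by
  have h1 : Fintype.card (D.discRep hc).Region = Fintype.card D.Boundary := rfl
  have h2 : ∑ r, ((D.discRep hc).regionGenus r : ℤ) = 0 := Finset.sum_eq_zero fun _ _ => rfl
  rw [SurfaceRep.eulerChar_eq, h1, h2, Nat.card_eq_fintype_card, Nat.card_eq_fintype_card,
    Nat.card_eq_fintype_card]
  ring

/-- A quotient can be counted by a system of representatives. -/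
theorem card_quot_eq_card {α β : Type} (r : α → α → Prop) (f : α → β)
    (g : β → α) (hf : ∀ a a', r a a' → f a = f a') (hfg : ∀ b, f (g b) = b)
    (hgf : ∀ a, Quot.mk r (g (f a)) = Quot.mk r a) : Nat.card (Quot r) = Nat.card β :=
  Nat.card_congr
    { toFun := Quot.lift f hf
      invFun := fun b => Quot.mk r (g b)
      left_inv := by rintro ⟨a⟩; exact hgf a
      right_inv := hfg }

/-- A virtual link with a diagram of genus one whose arrow polynomial contains a variable has minimal
genus one. -/
theorem hasMinimalGenus_one {D : GaussDiagram} (S : D.SurfaceRep) (hS : S.HasGenus 1) {i : ℕ+}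
    (h : i ∈ D.arrowPolynomial.vars) :
    VirtualLink.HasMinimalGenus (Quot.mk GaussDiagram.Move D) 1 := by
  refine ⟨⟨D, rfl, S, hS⟩, ?_⟩
  rintro n ⟨D', hD', S', hS'⟩
  rw [Nat.one_le_iff_ne_zero]
  rintro rfl
  -- By invariance the variable also occurs for a diagram on a sphere, where no variable can occur.
  have h1 := VirtualLink.arrowPolynomialContains_mk h D' hD'
  rw [S'.vars_arrowPolynomial hS'] at h1
  simp at h1

end GaussDiagram

/-- A function on `ZMod n` that does not change from each element to the next is constant. -/
theorem ZMod.eq_of_add_one {n : ℕ} [NeZero n] {α : Type*} (f : ZMod n → α)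
    (h : ∀ j, f (j + 1) = f j) (j k : ZMod n) : f j = f k := by
  have h1 : ∀ m : ℕ, f m = f 0 := by
    intro m
    induction m with
    | zero => rw [Nat.cast_zero]
    | succ m ih => rw [Nat.cast_succ, h, ih]
  rw [← ZMod.natCast_zmod_val j, ← ZMod.natCast_zmod_val k, h1, h1]

theorem Equiv.Perm.sameCycle_of_add_one {n : ℕ} [NeZero n] {α : Type*} {σ : Equiv.Perm α}
    (f : ZMod n → α) (h : ∀ j, σ.SameCycle (f j) (f (j + 1))) (j k : ZMod n) :
    σ.SameCycle (f j) (f k) := by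
  have h1 := ZMod.eq_of_add_one (fun k => σ.SameCycle (f j) (f k)) (fun k => propext
    ⟨fun hk => hk.trans (h k).symm, fun hk => hk.trans (h k)⟩) k j
  exact h1.mpr (.refl _ _)

/-! ### The chain link. -/

namespace GaussDiagram

section ChainLink

variable (n : ℕ) [NeZero n]

/-- A link consisting of a long component and `n` small ones, each of which has one crossing with
the long component. -/
def chainLink : GaussDiagram where
  Pt := ZMod n × Bool
  fintypePt := @instFintypeProd _ _ (ZMod.fintype n) _
  next :=
    { toFun := fun p => (if p.2 then p.1 + 1 else p.1, p.2)
      invFun := fun p => (if p.2 then p.1 - 1 else p.1, p.2)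
      left_inv := by rintro ⟨j, b⟩; cases b <;> simp
      right_inv := by rintro ⟨j, b⟩; cases b <;> simp }
  mate p := (p.1, !p.2)
  isOver p := p.2
  isPos _ := true
  mate_mate := by rintro ⟨j, b⟩; simp
  isOver_mate := by rintro ⟨j, b⟩ _; rfl
  isPos_mate := by rintro ⟨j, b⟩; rfl

/-- The half-edges of `chainLink n`, by their crossing, strand and direction. -/
abbrev linkHalf (j : ZMod n) (a b : Bool) : (chainLink n).Half := ((j, a), b)

instance : Nonempty (chainLink n).Pt := ⟨((0 : ZMod n), false)⟩

/-- The strand bit is constant along components and takes both values: it separates the long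
component from the small ones. -/
theorem chainLink_two_le_numComponents : 2 ≤ (chainLink n).numComponents := by
  let f : (Quot fun p q : (chainLink n).Pt => q = (chainLink n).next p) → Bool :=
    Quot.lift (fun p => p.2) (by rintro ⟨j, b⟩ _ rfl; rfl)
  have hf : Function.Surjective f := fun b => ⟨Quot.mk _ ((0 : ZMod n), b), rfl⟩
  have := Nat.card_le_card_of_surjective f hf
  rwa [Nat.card_eq_fintype_card, Fintype.card_bool] at this

theorem chainLink_rot (j : ZMod n) (a b : Bool) :
    (chainLink n).rot (linkHalf n j a b) = linkHalf n j (!a) (b ^^ !a) := by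
  rw [rot_of_crossing]
  · cases a <;> rfl
  · cases a <;> simp [chainLink]

theorem chainLink_connected (h k : (chainLink n).Half) :
    Quot.mk (fun h k => k = (chainLink n).edge h ∨ k = (chainLink n).rot h) h = Quot.mk _ k := by
  let q : (chainLink n).Half → Quot fun h k : (chainLink n).Half =>
    k = (chainLink n).edge h ∨ k = (chainLink n).rot h := Quot.mk _
  have he : ∀ h, q h = q ((chainLink n).edge h) := fun h => Quot.sound (Or.inl rfl)
  have hr : ∀ h, q h = q ((chainLink n).rot h) := fun h => Quot.sound (Or.inr rfl)
  have h1 : ∀ j, q (linkHalf n j true true) = q (linkHalf n j false true) := fun j =>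
    (hr (linkHalf n j true true)).trans (by rw [chainLink_rot]; rfl)
  have h2 : ∀ j, q (linkHalf n j false true) = q (linkHalf n j true false) := fun j =>
    (hr (linkHalf n j false true)).trans (by rw [chainLink_rot]; rfl)
  have h3 : ∀ j, q (linkHalf n j true false) = q (linkHalf n j false false) := fun j =>
    (hr (linkHalf n j true false)).trans (by rw [chainLink_rot]; rfl)
  have h4 : ∀ j, q (linkHalf n j true true) = q (linkHalf n (j + 1) true false) := fun j =>
    he (linkHalf n j true true)
  have h5 : ∀ j k, q (linkHalf n j true true) = q (linkHalf n k true true) :=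
    ZMod.eq_of_add_one _ fun j => by rw [h1, h2, ← h4]
  have h6 : ∀ j a b, q (linkHalf n j a b) = q (linkHalf n 0 true true) := by
    intro j a b
    rw [← h5 j 0]
    cases a <;> cases b
    · rw [← h3, ← h2, ← h1]
    · rw [← h1]
    · rw [← h2, ← h1]
    · rfl
  obtain ⟨⟨j, a⟩, b⟩ := h
  obtain ⟨⟨j', a'⟩, b'⟩ := k
  exact (h6 j a b).trans (h6 j' a' b').symm

theorem chainLink_card_vertex : Nat.card (chainLink n).Vertex = n := by
  refine (card_quot_eq_card (β := ZMod n) _ (fun p : (chainLink n).Pt => p.1)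
    (fun j => ((j, true) : ZMod n × Bool)) ?_ ?_ ?_).trans (Nat.card_zmod n)
  · rintro ⟨j, b⟩ _ rfl
    rfl
  · intro j
    rfl
  · rintro ⟨j, b⟩
    cases b
    · exact Quot.sound rfl
    · rfl

/-- Each boundary circle consists of four half-edges and is represented by its unique half-edge of
the form `linkHalf n j true true`. -/
theorem chainLink_card_boundary : Nat.card (chainLink n).Boundary = n := by
  have h1 : ∀ j, (chainLink n).rot ((chainLink n).edge (linkHalf n j true true)) =
      linkHalf n (j + 1) false false := fun j => chainLink_rot n (j + 1) true false
  have h2 : ∀ j, (chainLink n).rot ((chainLink n).edge (linkHalf n j false false)) =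
      linkHalf n j true false := fun j => chainLink_rot n j false true
  have h3 : ∀ j, (chainLink n).rot ((chainLink n).edge (linkHalf n j true false)) =
      linkHalf n (j - 1) false true := fun j => chainLink_rot n (j - 1) true true
  have h4 : ∀ j, (chainLink n).rot ((chainLink n).edge (linkHalf n j false true)) =
      linkHalf n j true true := fun j => chainLink_rot n j false false
  refine (card_quot_eq_card (β := ZMod n) _ (fun h : (chainLink n).Half =>
    if h.2 then h.1.1 else h.1.1 - 1) (fun j => linkHalf n j true true) ?_ ?_ ?_).trans
    (Nat.card_zmod n)
  · rintro ⟨⟨j, a⟩, b⟩ _ rfl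
    cases a <;> cases b
    · rw [h2]
    · rw [h4]
    · rw [h3]; rfl
    · rw [h1]
      exact (add_sub_cancel_right j 1).symm
  · intro j
    rfl
  · let q : (chainLink n).Half → (chainLink n).Boundary := Quot.mk _
    have hq : ∀ h k, (chainLink n).rot ((chainLink n).edge h) = k → q h = q k :=
      fun h k hk => Quot.sound hk.symm
    rintro ⟨⟨j, a⟩, b⟩
    cases a <;> cases b
    · have := hq _ _ (h1 (j - 1))
      rw [sub_add_cancel] at this
      exact this
    · exact (hq _ _ (h4 j)).symm
    · have := hq _ _ (h1 (j - 1))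
      rw [sub_add_cancel] at this
      exact this.trans (hq _ _ (h2 j))
    · rfl

theorem chainLink_card_pt : Nat.card (chainLink n).Pt = 2 * n := by
  change Nat.card (ZMod n × Bool) = _
  rw [Nat.card_prod, Nat.card_zmod, Nat.card_eq_fintype_card, Fintype.card_bool, mul_comm]

/-- The Euler characteristic is n - 2 n + n = 0. -/
theorem chainLink_hasGenus_one :
    ((chainLink n).discRep (chainLink_connected n)).HasGenus 1 := by
  rw [SurfaceRep.HasGenus, discRep_eulerChar, chainLink_card_vertex, chainLink_card_boundary,
    chainLink_card_pt]
  push_cast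
  ring

/-- Arrow number n requires all 2 n points to be disoriented, so only one state qualifies. Its
single loop runs through every crossing twice and meets 2 n cusps of equal value. -/
theorem chainLink_vars (i : ℕ+) (hi : (i : ℕ) = n) : i ∈ (chainLink n).arrowPolynomial.vars := by
  let s₀ : (chainLink n).State := ⟨fun _ => true, fun _ => rfl, by
    rintro ⟨j, b⟩ h
    cases b <;> simp [chainLink] at h⟩
  refine mem_vars_of_single_loop (chainLink n) i ((chainLink n).exponent s₀) ?_ ⟨s₀, ?_⟩
  · intro s _ hs
    have h1 : n ≤ ((chainLink n).cuspSum s (linkHalf n 0 true true)).natAbs / 2 :=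
      hi.ge.trans (hs (Quot.mk _ (linkHalf n 0 true true))).ge
    have h2 := (chainLink n).natAbs_cuspSum_le s (linkHalf n 0 true true)
    have h3 := chainLink_card_pt n
    rw [Nat.card_eq_fintype_card] at h3
    have h4 : (Finset.univ.filter fun p => s.1 p = true) = Finset.univ := by
      refine Finset.eq_univ_of_card _ (le_antisymm (Finset.card_le_univ _) ?_)
      omega
    have h5 : s = s₀ := Subtype.ext (funext fun p => by
      have := Finset.mem_univ p
      rw [← h4] at this
      exact (Finset.mem_filter.1 this).2)
    rw [h5]
  · have h1 : ∀ j, (chainLink n).step s₀ (linkHalf n j true true) = linkHalf n (j + 1) false false :=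
      fun j => rfl
    have h2 : ∀ j, (chainLink n).step s₀ (linkHalf n j false false) = linkHalf n j true true :=
      fun j => rfl
    have h3 := Equiv.Perm.sameCycle_of_add_one (σ := (chainLink n).step s₀) (fun j => linkHalf n j true true)
      fun j => by
        rw [← h2 (j + 1), ← h1 j, Equiv.Perm.sameCycle_apply_right, Equiv.Perm.sameCycle_apply_right]
    -- One traversal leaves along outgoing ends on the long component and incoming ends on the small
    -- ones.
    have h4 := (chainLink n).single_loop_of_cycle s₀ (linkHalf n 0 true true)
      (fun h => h.1.2 = h.2) ?_ ?_
    · refine ⟨h4.1, fun C => (h4.2 C).trans ?_⟩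
      have h5 : ∑ k : (chainLink n).Half with k.1.2 = k.2,
          (chainLink n).cuspValue s₀ ((chainLink n).edge k) =
          ∑ k : (ZMod n × Bool) × Bool, if k.1.2 = k.2 then 1 else 0 := by
        rw [Finset.sum_filter]
        refine Finset.sum_congr rfl ?_
        rintro ⟨⟨j, a⟩, b⟩ _
        cases a <;> cases b <;> rfl
      rw [h5, Fintype.sum_prod_type, Fintype.sum_prod_type]
      simp [hi]
      omega
    · rintro ⟨⟨j, a⟩, b⟩ (rfl : a = b)
      cases a
      · rw [← Equiv.Perm.sameCycle_apply_right]
        exact h3 0 j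
      · exact h3 0 j
    · rintro ⟨⟨j, a⟩, b⟩
      cases a <;> cases b <;> first | exact Or.inl rfl | exact Or.inr rfl

end ChainLink

end GaussDiagram

/-! ### The chain knot. -/

namespace GaussDiagram

section ChainKnot

variable (n : ℕ) [NeZero n]

/-- A knot consisting of `n` blocks. A block has four passages, numbered in binary, through two
positive crossings; the first one consists of the passages `0` and `2`, and the second one of the
passages `1` and `3`. -/
def chainKnot : GaussDiagram where
  Pt := ZMod n × Bool × Bool
  fintypePt := @instFintypeProd _ _ (ZMod.fintype n) _
  next :=
    { toFun := fun p => (if p.2.1 && p.2.2 then p.1 + 1 else p.1, p.2.1 ^^ p.2.2, !p.2.2)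
      invFun := fun p => (if !p.2.1 && !p.2.2 then p.1 - 1 else p.1, p.2.1 ^^ !p.2.2, !p.2.2)
      left_inv := by rintro ⟨j, a, b⟩; cases a <;> cases b <;> simp
      right_inv := by rintro ⟨j, a, b⟩; cases a <;> cases b <;> simp }
  mate p := (p.1, !p.2.1, p.2.2)
  isOver p := p.2.1 == p.2.2
  isPos _ := true
  mate_mate := by rintro ⟨j, a, b⟩; simp
  isOver_mate := by rintro ⟨j, a, b⟩ _; cases a <;> cases b <;> rfl
  isPos_mate := by rintro ⟨j, a, b⟩; rfl

/-- The half-edges of `chainKnot n`, by their block, passage and direction. -/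
abbrev knotHalf (j : ZMod n) (a b c : Bool) : (chainKnot n).Half := ((j, a, b), c)

instance : Nonempty (chainKnot n).Pt := ⟨((0 : ZMod n), false, false)⟩

theorem chainKnot_mate_ne (p : (chainKnot n).Pt) : (chainKnot n).mate p ≠ p := by
  obtain ⟨j, a, b⟩ := p
  cases a <;> simp [chainKnot]

/-- The four passages of a block follow one another, and the last leads to the next block, so the
blocks are run through cyclically. -/
theorem chainKnot_numComponents : (chainKnot n).numComponents = 1 := by
  rw [numComponents, Nat.card_eq_one_iff_unique]
  let q : (chainKnot n).Pt → Quot fun p q : (chainKnot n).Pt => q = (chainKnot n).next p :=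
    Quot.mk _
  have hq : ∀ p, q p = q ((chainKnot n).next p) := fun p => Quot.sound rfl
  have h0 : ∀ j : ZMod n, q (j, false, false) = q (j, false, true) := fun j =>
    hq (j, false, false)
  have h1 : ∀ j : ZMod n, q (j, false, true) = q (j, true, false) := fun j =>
    hq (j, false, true)
  have h2 : ∀ j : ZMod n, q (j, true, false) = q (j, true, true) := fun j =>
    hq (j, true, false)
  have h3 : ∀ j : ZMod n, q (j, true, true) = q (j + 1, false, false) := fun j =>
    hq (j, true, true)
  have h4 : ∀ j k : ZMod n, q (j, false, false) = q (k, false, false) :=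
    ZMod.eq_of_add_one _ fun j => ((h0 j).trans ((h1 j).trans ((h2 j).trans (h3 j)))).symm
  have h5 : ∀ p, q p = q ((0 : ZMod n), false, false) := by
    rintro ⟨j, a, b⟩
    rw [← h4 j 0]
    cases a <;> cases b
    · rfl
    · rw [h0]
    · rw [h0, h1]
    · rw [h0, h1, h2]
  refine ⟨⟨?_⟩, ⟨q ((0 : ZMod n), false, false)⟩⟩
  rintro ⟨p⟩ ⟨p'⟩
  exact (h5 p).trans (h5 p').symm

theorem chainKnot_rot (j : ZMod n) (a b c : Bool) :
    (chainKnot n).rot (knotHalf n j a b c) = knotHalf n j (!a) b (c ^^ (a ^^ b)) := by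
  rw [rot_of_crossing _ (chainKnot_mate_ne n _)]
  cases a <;> cases b <;> rfl

theorem chainKnot_connected (h k : (chainKnot n).Half) :
    Quot.mk (fun h k => k = (chainKnot n).edge h ∨ k = (chainKnot n).rot h) h = Quot.mk _ k := by
  let q : (chainKnot n).Half → Quot fun h k : (chainKnot n).Half =>
    k = (chainKnot n).edge h ∨ k = (chainKnot n).rot h := Quot.mk _
  have he : ∀ h, q h = q ((chainKnot n).edge h) := fun h => Quot.sound (Or.inl rfl)
  have hr : ∀ j a b c, q (knotHalf n j a b c) = q (knotHalf n j (!a) b (c ^^ (a ^^ b))) :=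
    fun j a b c => by
      rw [← chainKnot_rot]
      exact Quot.sound (Or.inr rfl)
  have hr1 : ∀ j a b c, q (knotHalf n j a b c) = q (knotHalf n j false b true) := by
    intro j a b c
    cases b <;> cases a <;> cases c
    · exact (hr j false false false).trans (hr j true false false)
    · rfl
    · exact hr j true false false
    · exact (hr j false false true).symm
    · exact (hr j false true false).trans (hr j true true true)
    · rfl
    · exact (hr j false true true).symm
    · exact hr j true true true
  have h1 : ∀ j, q (knotHalf n j false false true) = q (knotHalf n j false true true) := fun j =>
    (he _).trans (hr1 j false true false)
  have h2 : ∀ j, q (knotHalf n j false true true) = q (knotHalf n (j + 1) false false true) :=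
    fun j => (hr1 j true true true).symm.trans ((he _).trans (hr1 (j + 1) false false false))
  have h3 : ∀ j k, q (knotHalf n j false false true) = q (knotHalf n k false false true) :=
    ZMod.eq_of_add_one _ fun j => ((h1 j).trans (h2 j)).symm
  have h4 : ∀ j a b c, q (knotHalf n j a b c) = q (knotHalf n 0 false false true) := by
    intro j a b c
    rw [← h3 j 0, hr1]
    cases b
    · rfl
    · rw [h1]
  obtain ⟨⟨j, a, b⟩, c⟩ := h
  obtain ⟨⟨j', a', b'⟩, c'⟩ := k
  exact (h4 j a b c).trans (h4 j' a' b' c').symm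

theorem chainKnot_card_vertex : Nat.card (chainKnot n).Vertex = 2 * n := by
  refine (card_quot_eq_card (β := ZMod n × Bool) _ (fun p : (chainKnot n).Pt => (p.1, p.2.2))
    (fun x => ((x.1, false, x.2) : ZMod n × Bool × Bool)) ?_ ?_ ?_).trans ?_
  · rintro ⟨j, a, b⟩ _ rfl
    rfl
  · rintro ⟨j, b⟩
    rfl
  · rintro ⟨j, a, b⟩
    cases a
    · rfl
    · exact Quot.sound rfl
  · rw [Nat.card_prod, Nat.card_zmod, Nat.card_eq_fintype_card, Fintype.card_bool, mul_comm]

/-- There are two kinds of boundary circles, n of each: bigons inside a block (`h7`, `h8`), and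
circles of six half-edges shared by two neighbouring blocks (`h1` to `h6`). -/
theorem chainKnot_card_boundary : Nat.card (chainKnot n).Boundary = 2 * n := by
  let φ : (chainKnot n).Half → (chainKnot n).Half := fun h => (chainKnot n).rot ((chainKnot n).edge h)
  have h1 : ∀ j, φ (knotHalf n j false false true) = knotHalf n j true true true :=
    fun j => chainKnot_rot n j false true false
  have h2 : ∀ j, φ (knotHalf n j true true true) = knotHalf n (j + 1) true false false :=
    fun j => chainKnot_rot n (j + 1) false false false
  have h3 : ∀ j, φ (knotHalf n j true false false) = knotHalf n j true true false :=
    fun j => chainKnot_rot n j false true true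
  have h4 : ∀ j, φ (knotHalf n j true true false) = knotHalf n j false false false :=
    fun j => chainKnot_rot n j true false true
  have h5 : ∀ j, φ (knotHalf n j false false false) = knotHalf n (j - 1) false true true :=
    fun j => chainKnot_rot n (j - 1) true true true
  have h6 : ∀ j, φ (knotHalf n j false true true) = knotHalf n j false false true :=
    fun j => chainKnot_rot n j true false false
  have h7 : ∀ j, φ (knotHalf n j false true false) = knotHalf n j true false true :=
    fun j => chainKnot_rot n j false false true
  have h8 : ∀ j, φ (knotHalf n j true false true) = knotHalf n j false true false :=
    fun j => chainKnot_rot n j true true false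
  -- The second component marks the bigons. On a circle of six, incoming ends lie one block further
  -- than outgoing ones, whence the shift.
  let f : (chainKnot n).Half → ZMod n × Bool := fun h =>
    (if (h.1.2.1 ^^ h.1.2.2) && (h.1.2.1 == h.2) || h.2 then h.1.1 else h.1.1 - 1,
      (h.1.2.1 ^^ h.1.2.2) && (h.1.2.1 == h.2))
  have hf : ∀ h, f h = f (φ h) := by
    rintro ⟨⟨j, a, b⟩, c⟩
    cases a <;> cases b <;> cases c
    · rw [h5]; rfl
    · rw [h1]; rfl
    · rw [h7]; rfl
    · rw [h6]; rfl
    · rw [h3]; rfl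
    · rw [h8]; rfl
    · rw [h4]; rfl
    · rw [h2]
      exact Prod.ext (add_sub_cancel_right j 1).symm rfl
  refine (card_quot_eq_card (β := ZMod n × Bool) _ f
    (fun x => knotHalf n x.1 x.2 false true) ?_ ?_ ?_).trans ?_
  · rintro h _ rfl
    exact hf h
  · rintro ⟨j, b⟩
    cases b <;> rfl
  · let q : (chainKnot n).Half → (chainKnot n).Boundary := Quot.mk _
    have hq : ∀ h k, φ h = k → q h = q k := fun h k hk => Quot.sound hk.symm
    have r3 : ∀ j, q (knotHalf n j false false true) = q (knotHalf n j true true true) :=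
      fun j => hq _ _ (h1 j)
    have r2 : ∀ j, q (knotHalf n (j - 1) false false true) = q (knotHalf n j true false false) := by
      intro j
      have := hq _ _ (h2 (j - 1))
      rw [sub_add_cancel] at this
      exact (r3 _).trans this
    have r3' : ∀ j, q (knotHalf n (j - 1) false false true) = q (knotHalf n j true true false) :=
      fun j => (r2 j).trans (hq _ _ (h3 j))
    rintro ⟨⟨j, a, b⟩, c⟩
    cases a <;> cases b <;> cases c
    · exact (r3' j).trans (hq _ _ (h4 j))
    · rfl
    · exact (hq _ _ (h7 j)).symm
    · exact (hq _ _ (h6 j)).symm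
    · exact r2 j
    · rfl
    · exact r3' j
    · exact r3 j
  · rw [Nat.card_prod, Nat.card_zmod, Nat.card_eq_fintype_card, Fintype.card_bool, mul_comm]

theorem chainKnot_card_pt : Nat.card (chainKnot n).Pt = 4 * n := by
  change Nat.card (ZMod n × Bool × Bool) = _
  rw [Nat.card_prod, Nat.card_prod, Nat.card_zmod, Nat.card_eq_fintype_card, Fintype.card_bool,
    mul_comm]

/-- The Euler characteristic is 2 n - 4 n + 2 n = 0. -/
theorem chainKnot_hasGenus_one :
    ((chainKnot n).discRep (chainKnot_connected n)).HasGenus 1 := by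
  rw [SurfaceRep.HasGenus, discRep_eulerChar, chainKnot_card_vertex, chainKnot_card_boundary,
    chainKnot_card_pt]
  push_cast
  ring

/-- A state with a single loop contains at most one disoriented crossing in every block. -/
theorem chainKnot_not_both (s : (chainKnot n).State)
    (hs : Fintype.card ((chainKnot n).Loop s) = 1) (j : ZMod n) :
    ¬ (s.1 (j, false, false) = true ∧ s.1 (j, false, true) = true) := by
  rintro ⟨hc, hd⟩
  have hc' : s.1 (j, true, false) = true := (s.2.1 (j, false, false)).trans hc
  have hd' : s.1 (j, true, true) = true := (s.2.1 (j, false, true)).trans hd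
  obtain ⟨C₀, hC⟩ := Fintype.card_eq_one_iff.1 hs
  let L := (chainKnot n).loopSystem s
  -- If both crossings are disoriented, the two edges leading from the first to the second crossing
  -- of the block close up to a loop of their own, which misses the remaining half-edges.
  let P : (chainKnot n).Half → Prop := fun h => h.1.1 = j ∧ h.2 = !h.1.2.2
  have h1 : P (knotHalf n j false false true) ↔ P (knotHalf n j false false false) := by
    refine L.mem_iff_of_loopOf_eq ?_ ?_ ((hC _).trans (hC _).symm)
    · rintro ⟨⟨k, a, b⟩, c⟩ ⟨hk, hb⟩
      obtain rfl : k = j := hk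
      obtain rfl : c = !b := hb
      cases a <;> cases b <;> exact ⟨rfl, rfl⟩
    · rintro ⟨⟨k, a, b⟩, c⟩ ⟨hk, hb⟩
      obtain rfl : k = j := hk
      obtain rfl : c = !b := hb
      have h2 : s.1 (k, a, b) = true := by cases a <;> cases b <;> assumption
      have h3 : L.join ((k, a, b), !b) = ((k, !a, b), !b) := if_pos h2
      change P (L.join ((k, a, b), !b))
      rw [h3]
      exact ⟨rfl, rfl⟩
  exact Bool.noConfusion (h1.1 ⟨rfl, rfl⟩).2

theorem chainKnot_exponent (s : (chainKnot n).State) : (chainKnot n).exponent s =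
    ∑ j : ZMod n, ((if s.1 (j, false, false) then -1 else 1) +
      if s.1 (j, false, true) then -1 else 1 : ℤ) := by
  have h1 : (chainKnot n).exponent s = ∑ p : ZMod n × Bool × Bool,
      if (p.2.1 == p.2.2) = true then (if s.1 p then -1 else 1 : ℤ) else 0 := by
    rw [exponent, Finset.sum_filter]
    refine Finset.sum_congr rfl fun p _ => ?_
    refine if_congr (and_iff_right (chainKnot_mate_ne n p)) ?_ rfl
    change (if (true ^^ s.1 p) = true then (1 : ℤ) else -1) = _
    cases s.1 p <;> rfl
  have h2 : ∀ j, s.1 (j, true, true) = s.1 (j, false, true) := fun j => s.2.1 (j, false, true)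
  rw [h1, Fintype.sum_prod_type]
  refine Finset.sum_congr rfl fun j _ => ?_
  rw [Fintype.sum_prod_type, Fintype.sum_bool, Fintype.sum_bool, Fintype.sum_bool]
  simp [h2, add_comm]

theorem chainKnot_card_disoriented (s : (chainKnot n).State) :
    ((Finset.univ.filter fun p => s.1 p = true).card : ℤ) =
    ∑ j : ZMod n, (2 * (if s.1 (j, false, false) then 1 else 0) +
      2 * if s.1 (j, false, true) then 1 else 0 : ℤ) := by
  have h1 : ((Finset.univ.filter fun p => s.1 p = true).card : ℤ) =
      ∑ p : ZMod n × Bool × Bool, if s.1 p = true then (1 : ℤ) else 0 := by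
    rw [Finset.card_filter]
    push_cast
    rfl
  have h2 : ∀ j, s.1 (j, true, true) = s.1 (j, false, true) := fun j => s.2.1 (j, false, true)
  have h3 : ∀ j, s.1 (j, true, false) = s.1 (j, false, false) := fun j => s.2.1 (j, false, false)
  rw [h1, Fintype.sum_prod_type]
  refine Finset.sum_congr rfl fun j _ => ?_
  rw [Fintype.sum_prod_type, Fintype.sum_bool, Fintype.sum_bool, Fintype.sum_bool]
  simp only [h2, h3]
  ring

/-- The number of disoriented points is 2 n minus the exponent. By `chainKnot_not_both` every block
contributes at least zero to the exponent, so 2 n disoriented points force exponent zero. -/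
theorem chainKnot_exponent_of_single_loop (s : (chainKnot n).State)
    (hs : Fintype.card ((chainKnot n).Loop s) = 1)
    (hn : 2 * n ≤ (Finset.univ.filter fun p => s.1 p = true).card) :
    (chainKnot n).exponent s = 0 := by
  have h1 : ((Finset.univ.filter fun p => s.1 p = true).card : ℤ) =
      2 * n - (chainKnot n).exponent s := by
    have h4 : (2 * n : ℤ) = ∑ j : ZMod n, 2 := by
      simp [mul_comm]
    rw [chainKnot_card_disoriented, chainKnot_exponent, h4, ← Finset.sum_sub_distrib]
    refine Finset.sum_congr rfl fun j _ => ?_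
    split_ifs <;> rfl
  have h2 : 0 ≤ (chainKnot n).exponent s := by
    rw [chainKnot_exponent]
    refine Finset.sum_nonneg fun j _ => ?_
    have h3 := chainKnot_not_both n s hs j
    split_ifs with h4 h5 h5
    · exact absurd ⟨h4, h5⟩ h3
    all_goals norm_num
  omega

/-- Arrow number n requires at least 2 n disoriented points, so all contributing states have
exponent zero, even if there are several. -/
theorem chainKnot_vars (i : ℕ+) (hi : (i : ℕ) = n) : i ∈ (chainKnot n).arrowPolynomial.vars := by
  refine mem_vars_of_single_loop (chainKnot n) i 0 ?_ ?_
  · intro s hs ha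
    refine chainKnot_exponent_of_single_loop n s hs ?_
    have h1 : n ≤ ((chainKnot n).cuspSum s (knotHalf n 0 true true true)).natAbs / 2 :=
      hi.ge.trans (ha (Quot.mk _ (knotHalf n 0 true true true))).ge
    have h2 := (chainKnot n).natAbs_cuspSum_le s (knotHalf n 0 true true true)
    omega
  -- The first crossing of every block is disoriented, the second one is not.
  · let s : (chainKnot n).State := ⟨fun p => !p.2.2, fun _ => rfl, fun p hp =>
      absurd hp (chainKnot_mate_ne n p)⟩
    refine ⟨s, ?_⟩
    let σ := (chainKnot n).step s
    have h1 : ∀ j, σ (knotHalf n j false false true) = knotHalf n j true true true := fun j => rfl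
    have h2 : ∀ j, σ (knotHalf n j true true true) = knotHalf n (j + 1) true false false :=
      fun j => rfl
    have h3 : ∀ j, σ (knotHalf n j true false false) = knotHalf n j true true false := fun j => rfl
    have h4 : ∀ j, σ (knotHalf n j true true false) = knotHalf n j false false true := fun j => rfl
    have h5 := Equiv.Perm.sameCycle_of_add_one (σ := σ) (fun j => knotHalf n j false false true)
      fun j => by
        rw [← h4 (j + 1), ← h3 (j + 1), ← h2 j, ← h1 j]
        simp only [Equiv.Perm.sameCycle_apply_right]
        rfl
    -- The predicate lists the four half-edges per block visited by the cycle of `h1` to `h4`; two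
    -- of them lead to cusps, both of value 1, so the cusp sum is 2 n.
    have h6 := (chainKnot n).single_loop_of_cycle s (knotHalf n 0 false false true)
      (fun h => (if h.2 then h.1.2.1 == h.1.2.2 else h.1.2.1) = true) ?_ ?_
    · refine ⟨h6.1, fun C => (h6.2 C).trans ?_⟩
      have h7 : ∑ h : (chainKnot n).Half with (if h.2 then h.1.2.1 == h.1.2.2 else h.1.2.1) = true,
          (chainKnot n).cuspValue s ((chainKnot n).edge h) =
          ∑ h : (ZMod n × Bool × Bool) × Bool, if (h.1.2.1 && h.1.2.2) = true then 1 else 0 := by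
        rw [Finset.sum_filter]
        refine Finset.sum_congr rfl ?_
        rintro ⟨⟨j, a, b⟩, c⟩ _
        cases a <;> cases b <;> cases c <;> rfl
      rw [h7, Fintype.sum_prod_type, Fintype.sum_prod_type]
      simp [hi, Fintype.sum_prod_type]
      omega
    · rintro ⟨⟨j, a, b⟩, c⟩ hk
      have h8 := h5 0 j
      have h9 : σ.SameCycle (knotHalf n 0 false false true) (knotHalf n j true true false) := by
        rwa [← Equiv.Perm.sameCycle_apply_right, h4]
      cases a <;> cases b <;> cases c
      · exact absurd hk (by simp)
      · exact h8
      · exact absurd hk (by simp)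
      · exact absurd hk (by simp)
      · change σ.SameCycle _ (knotHalf n j true false false)
        rwa [← Equiv.Perm.sameCycle_apply_right, h3]
      · exact absurd hk (by simp)
      · exact h9
      · change σ.SameCycle _ (σ (knotHalf n j false false true))
        rwa [Equiv.Perm.sameCycle_apply_right]
    · rintro ⟨⟨j, a, b⟩, c⟩
      cases a <;> cases b <;> cases c <;> first | exact Or.inl rfl | exact Or.inr rfl

end ChainKnot

end GaussDiagram

theorem mainTheorem5 (i : ℕ+) :
    (∃ L : VirtualLink, L.numComponents = 1 ∧ L.HasMinimalGenus 1 ∧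
      L.ArrowPolynomialContains i) ∧
    (∃ L : VirtualLink, 2 ≤ L.numComponents ∧ L.HasMinimalGenus 1 ∧
      L.ArrowPolynomialContains i) := by
  have : NeZero (i : ℕ) := ⟨i.ne_zero⟩
  have hk := GaussDiagram.chainKnot_vars i i rfl
  have hl := GaussDiagram.chainLink_vars i i rfl
  exact ⟨⟨Quot.mk _ (GaussDiagram.chainKnot i), GaussDiagram.chainKnot_numComponents i,
      GaussDiagram.hasMinimalGenus_one _ (GaussDiagram.chainKnot_hasGenus_one i) hk,
      VirtualLink.arrowPolynomialContains_mk hk⟩,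
    ⟨Quot.mk _ (GaussDiagram.chainLink i), GaussDiagram.chainLink_two_le_numComponents i,
      GaussDiagram.hasMinimalGenus_one _ (GaussDiagram.chainLink_hasGenus_one i) hl,
      VirtualLink.arrowPolynomialContains_mk hl⟩⟩
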